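/- Throughout, manifolds and maps are smooth, $U^{\mathbb C}$ denotes the complexification of a Euclidean space $U$, endowed with the complex bilinear extension of the inner product, and a complex subspace of $U^{\mathbb C}$ is called coisotropic if it contains its orthogonal complement. **Setting.** Let $M$ be a Riemannian manifold endowed with a metric connection $\nabla$ on $TM$ whose torsion is totally antisymmetric. Let $\pi:Y\to M$ be a proper surjective submersion which is a subbundle of the bundle of complex Grassmannians $\mathrm{Gr}(T^{\mathbb C}M)$, with inclusion $y\mapsto\sigma(y)\subseteq T^{\mathbb C}_{\pi(y)}M$, such that each fibre $Y_x$ $(x\in M)$ is a (compact) complex submanifold of a Grassmannian of $T_x^{\mathbb C}M$, invariant under complex conjugation and formed of coisotropic subspaces. Assume that $\nabla$ induces a connection $\mathcal H\subseteq TY$ on $Y$, i.e. the directions in which $\sigma$ is parallel form a complement of $\ker d\pi$ in $TY$. Let $\mathcal B\subseteq\mathcal H^{\mathbb C}$ be given by $d\pi(\mathcal B_y)=\sigma(y)$ and let $\mathcal C=\mathcal B\oplus(\ker d\pi)^{0,1}$. Endow $Y$ with the Riemannian metric for which $\mathcal H=(\ker d\pi)^\perp$, $\pi$ is a Riemannian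 submersion, and the metric induced on each $Y_x$ is the one induced by the Kähler metric of $\mathrm{Gr}(T_x^{\mathbb C}M)$ (up to a fixed positive constant factor); the fibres of $\pi$ are totally geodesic. Let $Z$ be a complex manifold with a conjugation (an involutive antiholomorphic diffeomorphism), and let $\varphi:Y\to Z$ be a surjective submersion which intertwines the conjugations, is injective on each $Y_x$, and satisfies $\mathcal C=(d\varphi)^{-1}(T^{0,1}Z)$. (That is, $M$ is endowed with a Riemannian twistorial structure with $E=TM$, given by $\varphi:Y\to Z$ and $\pi:Y\to M$.) Let $\mathcal K=(\ker d\varphi)^\perp$, let $J$ be the orthogonal complex structure on $\mathcal K$ for which $d\varphi|_{\mathcal K}$ is complex linear, let $P_{\mathcal H\cap\mathcal K}$ be the orthogonal projection onto $\mathcal H\cap\mathcal K$, let $I^{\mathcal H}$ be the integrability tensor of $\mathcal H$, $I^{\mathcal H}(A,B)=-(\text{the component of }[A,B]\text{ in }\ker d\pi)$ for sections $A$, $B$ of $\mathcal H$, and let $T$ be the section of $\mathcal H\otimes\Lambda^2\mathcal H^*$ corresponding, through $\pi$, to the torsion of $\nabla$. For a vector valued $2$-form $\Theta$, put $\mathrm{trace}_\omega\Theta=\sum_i\Theta(e_i,Je_i)$,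 where $(e_i)$ is any orthonormal basis of $\mathcal H\cap\mathcal K$ (this is the trace with respect to the Kähler form $\omega$ of $(\mathcal H\cap\mathcal K,J)$). **Corollary 3.5.** The fibres of $\varphi$ are totally geodesic, and the following assertions are equivalent: (i) $\varphi$ pulls back (locally defined) holomorphic functions on $Z$ to harmonic functions on $Y$; (ii) $\mathrm{trace}_\omega\bigl(I^{\mathcal H}+P_{\mathcal H\cap\mathcal K}T\bigr)=0$. Consequently, for any Kähler metric on the complex manifold $Z$, if (ii) holds then $\varphi$ is a harmonic map. -/

import Mathlib

open Bundle Filter Topology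
open scoped Manifold ContDiff TensorProduct

noncomputable section

namespace RTwist

/-! ## Complexified vector spaces

The complexification of a real vector space `V` is `ℂ ⊗[ℝ] V`; its elements are
`1 ⊗ u + I ⊗ v` with `u, v : V`. -/

section Complexification

variable (V : Type*) [AddCommGroup V] [Module ℝ V]

/-- Real part `1 ⊗ u + I ⊗ v ↦ u`. -/
def rePart : ℂ ⊗[ℝ] V →ₗ[ℝ] V :=
  (TensorProduct.lid ℝ V).toLinearMap ∘ₗ LinearMap.rTensor V Complex.reLm

/-- Imaginary part `1 ⊗ u + I ⊗ v ↦ v`. -/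
def imPart : ℂ ⊗[ℝ] V →ₗ[ℝ] V :=
  (TensorProduct.lid ℝ V).toLinearMap ∘ₗ LinearMap.rTensor V Complex.imLm

/-- Complex conjugation `1 ⊗ u + I ⊗ v ↦ 1 ⊗ u - I ⊗ v`, as a conjugate-linear map. -/
def conjC : ℂ ⊗[ℝ] V →ₛₗ[starRingEnd ℂ] ℂ ⊗[ℝ] V where
  toFun := LinearMap.rTensor V Complex.conjAe.toLinearMap
  map_add' := map_add _
  map_smul' z a := by
    induction a using TensorProduct.induction_on with
    | zero => simp
    | tmul w v => simp [TensorProduct.smul_tmul']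
    | add a b ha hb => rw [smul_add, map_add, ha, hb, map_add, smul_add]

/-- The inclusion `u ↦ 1 ⊗ u` of `V` in its complexification. -/
def incl : V →ₗ[ℝ] ℂ ⊗[ℝ] V := TensorProduct.mk ℝ ℂ V 1

/-- The map `v ↦ I ⊗ v`. -/
def inclI : V →ₗ[ℝ] ℂ ⊗[ℝ] V := TensorProduct.mk ℝ ℂ V Complex.I

end Complexification

section ComplexifiedInner

variable {V : Type*} [NormedAddCommGroup V] [InnerProductSpace ℝ V]

/-- The complex bilinear extension of the inner product of `V`. -/
def bilC (a b : ℂ ⊗[ℝ] V) : ℂ := LinearMap.BilinForm.baseChange ℂ (innerₗ V) a b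

/-- The Hermitian extension of the inner product of `V`, conjugate-linear in `a`. -/
def hermC (a b : ℂ ⊗[ℝ] V) : ℂ := bilC (conjC V a) b

/-- A complex subspace `S` of the complexification is coisotropic if it contains its orthogonal
complement with respect to the complex bilinear extension of the inner product. -/
def IsCoisotropic (S : Submodule ℂ (ℂ ⊗[ℝ] V)) : Prop :=
  ∀ a : ℂ ⊗[ℝ] V, (∀ b ∈ S, bilC a b = 0) → a ∈ S

end ComplexifiedInner

/-! ## Pullback connections -/

section Connections

variable {E : Type*} [NormedAddCommGroup E] [NormedSpace ℝ E]
  {M : Type*} [TopologicalSpace M] [ChartedSpace E M]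
  {E' : Type*} [NormedAddCommGroup E'] [NormedSpace ℝ E']
  {N : Type*} [TopologicalSpace N] [ChartedSpace E' N]

variable (E M) in
/-- Connections on the tangent bundle of `M`. For a connection `cov`, a vector field `X` and a
tangent vector `a` at `x`, the derivative `∇_a X` is written `cov X x a`. -/
abbrev AffineConnection [IsManifold 𝓘(ℝ, E) ∞ M] :=
  CovariantDerivative 𝓘(ℝ, E) E (TangentSpace 𝓘(ℝ, E) : M → Type _)

/-- The pullback `f^*∇` to `f^*TM` of a connection `∇` on `TM` by `f : N → M`: for a section `s`
of `f^*TM`, the derivative `(f^*∇)_a s` at `y`, where `a` is tangent to `N` at `y`. In the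
trivialization of `TM` given by the chart at `f y`, this is the derivative of the components of `s`
plus the derivative, in the direction `df(a)`, of the vector field which has constant components
and the value `s y` at `f y`. -/
def pullbackCov [IsManifold 𝓘(ℝ, E) ∞ M] (cov : AffineConnection E M) (f : N → M)
    (s : Π y : N, TangentSpace 𝓘(ℝ, E) (f y)) (y : N) :
    TangentSpace 𝓘(ℝ, E') y →L[ℝ] TangentSpace 𝓘(ℝ, E) (f y) :=
  let t := trivializationAt E (TangentSpace 𝓘(ℝ, E) : M → Type _) (f y)
  (t.symmL ℝ (f y)) ∘L
      (mvfderiv 𝓘(ℝ, E') (fun y' ↦ (t ⟨f y', s y'⟩ : M × E).2) y) +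
    (cov (FiberBundle.extend E (s y)) (f y)) ∘L (mfderiv 𝓘(ℝ, E') 𝓘(ℝ, E) f y)

/-- A section `s` of the pullback `f^*TM` is smooth at `y`. -/
def SmoothSecAt [IsManifold 𝓘(ℝ, E) ∞ M] (f : N → M)
    (s : Π y : N, TangentSpace 𝓘(ℝ, E) (f y)) (y : N) : Prop :=
  ContMDiffAt 𝓘(ℝ, E') (𝓘(ℝ, E).tangent) ∞
    (fun y' ↦ (⟨f y', s y'⟩ : TangentBundle 𝓘(ℝ, E) M)) y

/-- The derivative `(f^*∇)_A s` of a section `s` of the complexification of `f^*TM`, for `A` in the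
complexification of the tangent space of `N` at `y`; it is complex linear in `A`. -/
def pullbackCovC [IsManifold 𝓘(ℝ, E) ∞ M] (cov : AffineConnection E M) (f : N → M)
    (s : Π y : N, ℂ ⊗[ℝ] TangentSpace 𝓘(ℝ, E) (f y)) (y : N) :
    ℂ ⊗[ℝ] TangentSpace 𝓘(ℝ, E') y →ₗ[ℂ] ℂ ⊗[ℝ] TangentSpace 𝓘(ℝ, E) (f y) :=
  LinearMap.liftBaseChange ℂ
    (incl _ ∘ₗ (pullbackCov cov f (fun y' ↦ rePart _ (s y')) y).toLinearMap +
      inclI _ ∘ₗ (pullbackCov cov f (fun y' ↦ imPart _ (s y')) y).toLinearMap)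

/-- The kernel of the differential of `f` at `y`. -/
def vert (E E' : Type*) [NormedAddCommGroup E] [NormedSpace ℝ E]
    [NormedAddCommGroup E'] [NormedSpace ℝ E']
    {M : Type*} [TopologicalSpace M] [ChartedSpace E M]
    {N : Type*} [TopologicalSpace N] [ChartedSpace E' N] (f : N → M) (y : N) :
    Submodule ℝ (TangentSpace 𝓘(ℝ, E') y) :=
  LinearMap.ker (mfderiv 𝓘(ℝ, E') 𝓘(ℝ, E) f y).toLinearMap

/-- A smooth surjective submersion. -/
structure IsSurjSubmersion (E E' : Type*) [NormedAddCommGroup E] [NormedSpace ℝ E]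
    [NormedAddCommGroup E'] [NormedSpace ℝ E']
    {M : Type*} [TopologicalSpace M] [ChartedSpace E M]
    {N : Type*} [TopologicalSpace N] [ChartedSpace E' N] (f : N → M) : Prop where
  smooth : ContMDiff 𝓘(ℝ, E') 𝓘(ℝ, E) ∞ f
  surj : Function.Surjective f
  submersion : ∀ y, Function.Surjective (mfderiv 𝓘(ℝ, E') 𝓘(ℝ, E) f y)

end Connections

/-! ## Riemannian notions -/

instance finiteDimensional_tangentSpace {E : Type*} [NormedAddCommGroup E] [NormedSpace ℝ E]
    [FiniteDimensional ℝ E] {M : Type*} [TopologicalSpace M] [ChartedSpace E M] (x : M) :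
    FiniteDimensional ℝ (TangentSpace 𝓘(ℝ, E) x) :=
  inferInstanceAs (FiniteDimensional ℝ E)

section Riemannian

variable {E : Type*} [NormedAddCommGroup E] [NormedSpace ℝ E] [FiniteDimensional ℝ E]
  {M : Type*} [TopologicalSpace M] [ChartedSpace E M] [IsManifold 𝓘(ℝ, E) ∞ M]
  [RiemannianBundle (fun x : M ↦ TangentSpace 𝓘(ℝ, E) x)]
  [IsContMDiffRiemannianBundle 𝓘(ℝ, E) ∞ E (fun x : M ↦ TangentSpace 𝓘(ℝ, E) x)]
  {E' : Type*} [NormedAddCommGroup E'] [NormedSpace ℝ E'] [FiniteDimensional ℝ E']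
  {N : Type*} [TopologicalSpace N] [ChartedSpace E' N] [IsManifold 𝓘(ℝ, E') ∞ N]
  [RiemannianBundle (fun y : N ↦ TangentSpace 𝓘(ℝ, E') y)]
  [IsContMDiffRiemannianBundle 𝓘(ℝ, E') ∞ E' (fun y : N ↦ TangentSpace 𝓘(ℝ, E') y)]

/-- `cov` is a metric connection: `a⟨X, X'⟩ = ⟨∇_a X, X'⟩ + ⟨X, ∇_a X'⟩` for any tangent vector `a`
and any vector fields `X`, `X'` which are differentiable at the base point of `a`. -/
def IsMetric (cov : AffineConnection E M) : Prop :=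
  ∀ (x : M) (X X' : Π x : M, TangentSpace 𝓘(ℝ, E) x) (a : TangentSpace 𝓘(ℝ, E) x),
    MDifferentiableAt 𝓘(ℝ, E) 𝓘(ℝ, E).tangent
      (fun x' ↦ (⟨x', X x'⟩ : TangentBundle 𝓘(ℝ, E) M)) x →
    MDifferentiableAt 𝓘(ℝ, E) 𝓘(ℝ, E).tangent
      (fun x' ↦ (⟨x', X' x'⟩ : TangentBundle 𝓘(ℝ, E) M)) x →
    mvfderiv 𝓘(ℝ, E) (fun x' ↦ inner ℝ (X x') (X' x')) x a =
      inner ℝ (cov X x a) (X' x) + inner ℝ (X x) (cov X' x a)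

/-- `cov` is the Levi-Civita connection: metric and torsion free. -/
def IsLeviCivita (cov : AffineConnection E M) : Prop :=
  IsMetric cov ∧ ∀ x : M, cov.torsion x = 0

/-- The (metric) connection has totally antisymmetric torsion: `⟨T(u, v), w⟩` is a 3-form. It is
always antisymmetric in `u, v`. -/
def HasSkewTorsion (cov : AffineConnection E M) : Prop :=
  ∀ (x : M) (u v w : TangentSpace 𝓘(ℝ, E) x),
    inner ℝ (cov.torsion x u v) w = - inner ℝ (cov.torsion x u w) v

variable (E) in
/-- The fibres of the submersion `f : N → M` are totally geodesic with respect to the connection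
`covN` of `N`: if `X` is a vector field tangent to the fibres and `a` is a vector tangent to a
fibre then `∇_a X` is tangent to the fibre. -/
def HasTotallyGeodesicFibres {M : Type*} [TopologicalSpace M] [ChartedSpace E M]
    (covN : AffineConnection E' N) (f : N → M) : Prop :=
  ∀ (y : N) (X : Π y : N, TangentSpace 𝓘(ℝ, E') y) (a : TangentSpace 𝓘(ℝ, E') y),
    SmoothSecAt (E := E') (E' := E') id X y →
    (∀ᶠ y' in 𝓝 y, X y' ∈ vert E E' f y') → a ∈ vert E E' f y →
    covN X y a ∈ vert E E' f y

/-- The Hessian `∇df(a, b) = a(B f) - (∇_a B) f` of a complex valued function, where `B` is a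
vector field which extends `b`. -/
def hess (covN : AffineConnection E' N) (f : N → ℂ) (y : N)
    (a b : TangentSpace 𝓘(ℝ, E') y) : ℂ :=
  mvfderiv 𝓘(ℝ, E')
      (fun y' ↦ mvfderiv 𝓘(ℝ, E') f y' (FiberBundle.extend E' b y')) y a -
    mvfderiv 𝓘(ℝ, E') f y (covN (FiberBundle.extend E' b) y a)

/-- The Laplacian: the trace of the Hessian. -/
def laplacian (covN : AffineConnection E' N) (f : N → ℂ) (y : N) : ℂ :=
  let e := stdOrthonormalBasis ℝ (TangentSpace 𝓘(ℝ, E') y)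
  ∑ i, hess covN f y (e i) (e i)

/-- The second fundamental form `∇df(a, b) = (f^*∇^M)_a (df B) - df(∇^N_a B)` of a map `f : N → M`,
where `B` is a vector field which extends `b`. -/
def secondFundamentalForm {M : Type*} [TopologicalSpace M] [ChartedSpace E M]
    [IsManifold 𝓘(ℝ, E) ∞ M]
    (covN : AffineConnection E' N) (covM : AffineConnection E M) (f : N → M) (y : N)
    (a b : TangentSpace 𝓘(ℝ, E') y) : TangentSpace 𝓘(ℝ, E) (f y) :=
  pullbackCov covM f
      (fun y' ↦ mfderiv 𝓘(ℝ, E') 𝓘(ℝ, E) f y' (FiberBundle.extend E' b y')) y a -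
    mfderiv 𝓘(ℝ, E') 𝓘(ℝ, E) f y (covN (FiberBundle.extend E' b) y a)

/-- `f` is a harmonic map: its tension field, the trace of its second fundamental form, vanishes.
Here `covN`, `covM` are the Levi-Civita connections. -/
def IsHarmonicMap {M : Type*} [TopologicalSpace M] [ChartedSpace E M] [IsManifold 𝓘(ℝ, E) ∞ M]
    (covN : AffineConnection E' N) (covM : AffineConnection E M) (f : N → M) : Prop :=
  ∀ y : N, let e := stdOrthonormalBasis ℝ (TangentSpace 𝓘(ℝ, E') y)
    ∑ i, secondFundamentalForm covN covM f y (e i) (e i) = 0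

open Classical in
/-- The horizontal lift of `w ∈ T_{f y} M`: the vector orthogonal to `ker df` which `df` maps to `w`
(for a submersion, there is exactly one). -/
def horizontalLift {M : Type*} [TopologicalSpace M] [ChartedSpace E M] (f : N → M) (y : N)
    (w : TangentSpace 𝓘(ℝ, E) (f y)) : TangentSpace 𝓘(ℝ, E') y :=
  if h : ∃ u ∈ (vert E E' f y)ᗮ, mfderiv 𝓘(ℝ, E') 𝓘(ℝ, E) f y u = w then h.choose else 0

/-- `f` is a Riemannian submersion: `df` is isometric on `(ker df)ᗮ`. -/
def IsRiemannianSubmersion (f : N → M) : Prop :=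
  IsSurjSubmersion E E' f ∧ ∀ (y : N), ∀ a ∈ (vert E E' f y)ᗮ, ∀ b ∈ (vert E E' f y)ᗮ,
    inner ℝ (mfderiv 𝓘(ℝ, E') 𝓘(ℝ, E) f y a) (mfderiv 𝓘(ℝ, E') 𝓘(ℝ, E) f y b) = inner ℝ a b

variable (E) in
/-- The integrability tensor `I(a, b) = -(the component in ker df of [A, B])` of the horizontal
distribution `(ker df)ᗮ`, where `A` and `B` are horizontal vector fields which extend the
horizontal vectors `a` and `b`. -/
def integrabilityTensor {M : Type*} [TopologicalSpace M] [ChartedSpace E M] (f : N → M) (y : N)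
    (a b : TangentSpace 𝓘(ℝ, E') y) : TangentSpace 𝓘(ℝ, E') y :=
  - (vert E E' f y).starProjection
      (VectorField.mlieBracket 𝓘(ℝ, E')
        (fun y' ↦ (vert E E' f y')ᗮ.starProjection (FiberBundle.extend E' a y'))
        (fun y' ↦ (vert E E' f y')ᗮ.starProjection (FiberBundle.extend E' b y')) y)

end Riemannian

/-! ## Complex manifolds -/

section ComplexManifold

variable {F : Type*} [NormedAddCommGroup F] [NormedSpace ℂ F]
  {Z : Type*} [TopologicalSpace Z] [ChartedSpace F Z]

/-- A complex manifold is a smooth real manifold, with the same charts. -/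
instance isManifold_real_of_complex [IsManifold 𝓘(ℂ, F) ω Z] : IsManifold 𝓘(ℝ, F) ∞ Z := by
  apply isManifold_of_contDiffOn
  intro e e' he he'
  have h : ContDiffOn ℂ ω (𝓘(ℂ, F) ∘ (e.symm ≫ₕ e') ∘ 𝓘(ℂ, F).symm)
      (𝓘(ℂ, F).symm ⁻¹' (e.symm ≫ₕ e').source ∩ Set.range 𝓘(ℂ, F)) :=
    (mem_groupoid_of_pregroupoid.mp
      (StructureGroupoid.compatible (contDiffGroupoid ω 𝓘(ℂ, F)) he he')).1
  exact (h.restrict_scalars ℝ).of_le (by simp)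

/-- The complex structure of the (real) tangent spaces of a complex manifold: multiplication by the
imaginary unit in the chart at the point. -/
def mulI (z : Z) : TangentSpace 𝓘(ℝ, F) z →L[ℝ] TangentSpace 𝓘(ℝ, F) z :=
  (show F →L[ℝ] F from (Complex.I • ContinuousLinearMap.id ℂ F).restrictScalars ℝ)

/-- The antiholomorphic tangent space `T^{0,1}_z Z`: the eigenspace of `-I` in the complexified
tangent space. -/
def T01 (z : Z) : Submodule ℂ (ℂ ⊗[ℝ] TangentSpace 𝓘(ℝ, F) z) :=
  LinearMap.ker ((mulI z).toLinearMap.baseChange ℂ + Complex.I • LinearMap.id)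

variable (F) in
/-- A conjugation of a complex manifold: an involutive antiholomorphic diffeomorphism. -/
structure IsConjugation (c : Z → Z) : Prop where
  smooth : ContMDiff 𝓘(ℝ, F) 𝓘(ℝ, F) ∞ c
  involutive : Function.Involutive c
  antiholomorphic : ∀ (z : Z) (u : TangentSpace 𝓘(ℝ, F) z),
    mfderiv 𝓘(ℝ, F) 𝓘(ℝ, F) c z (mulI z u) = - mulI (c z) (mfderiv 𝓘(ℝ, F) 𝓘(ℝ, F) c z u)

/-- The Riemannian metric of the complex manifold `Z`, with Levi-Civita connection `cov`, is Kähler: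
it is Hermitian, and the complex structure is parallel. -/
structure IsKahler [FiniteDimensional ℂ F] [IsManifold 𝓘(ℂ, F) ω Z]
    [RiemannianBundle (fun z : Z ↦ TangentSpace 𝓘(ℝ, F) z)]
    (cov : AffineConnection F Z) : Prop where
  hermitian : ∀ (z : Z) (u v : TangentSpace 𝓘(ℝ, F) z), inner ℝ (mulI z u) (mulI z v) = inner ℝ u v
  parallel : ∀ (z : Z) (X : Π z : Z, TangentSpace 𝓘(ℝ, F) z) (u : TangentSpace 𝓘(ℝ, F) z),
    SmoothSecAt (E := F) (E' := F) id X z → cov (fun z' ↦ mulI z' (X z')) z u = mulI z (cov X z u)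

end ComplexManifold

/-! ## Riemannian twistorial structures on `E = TM` -/

section Twistorial

variable {E : Type*} [NormedAddCommGroup E] [NormedSpace ℝ E] [FiniteDimensional ℝ E]
  {M : Type*} [TopologicalSpace M] [ChartedSpace E M] [IsManifold 𝓘(ℝ, E) ∞ M]
  [RiemannianBundle (fun x : M ↦ TangentSpace 𝓘(ℝ, E) x)]
  [IsContMDiffRiemannianBundle 𝓘(ℝ, E) ∞ E (fun x : M ↦ TangentSpace 𝓘(ℝ, E) x)]
  {E' : Type*} [NormedAddCommGroup E'] [NormedSpace ℝ E'] [FiniteDimensional ℝ E']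
  {Y : Type*} [TopologicalSpace Y] [ChartedSpace E' Y] [IsManifold 𝓘(ℝ, E') ∞ Y]

variable (E M) in
/-- The points of the Grassmann bundle `Gr(T^ℂ M)`: a point `x` of `M` and a complex subspace of the
complexification of `T_x M`. -/
abbrev Gr : Type _ := Σ x : M, Submodule ℂ (ℂ ⊗[ℝ] TangentSpace 𝓘(ℝ, E) x)

/-- `s` is, near `y`, a section of the bundle `⊔_y σ(y) ⊆ p^* T^ℂ M` over `Y`, smooth at `y`. -/
structure IsLocalSection {p : Y → M}
    (σ : Π y : Y, Submodule ℂ (ℂ ⊗[ℝ] TangentSpace 𝓘(ℝ, E) (p y)))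
    (s : Π y : Y, ℂ ⊗[ℝ] TangentSpace 𝓘(ℝ, E) (p y)) (y : Y) : Prop where
  smooth_re : SmoothSecAt (E' := E') p (fun y' ↦ rePart _ (s y')) y
  smooth_im : SmoothSecAt (E' := E') p (fun y' ↦ imPart _ (s y')) y
  mem : ∀ᶠ y' in 𝓝 y, s y' ∈ σ y'

/-- The vectors `A` in the complexification of `T_y Y` such that `(p^*∇)_A s ∈ σ(y)` for every
local section `s` of `σ`. In other words, the kernel of the complex linear extension of the
covariant differential `T_y Y → Hom(σ(y), T^ℂ M / σ(y))` of `σ`. On vectors tangent to the fibre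
`Y_x` this is the differential at `y` of the map `σ : Y_x → Gr(T_x^ℂ M)`. -/
def kerNabla (cov : AffineConnection E M) {p : Y → M}
    (σ : Π y : Y, Submodule ℂ (ℂ ⊗[ℝ] TangentSpace 𝓘(ℝ, E) (p y))) (y : Y) :
    Submodule ℂ (ℂ ⊗[ℝ] TangentSpace 𝓘(ℝ, E') y) :=
  ⨅ (s : Π y : Y, ℂ ⊗[ℝ] TangentSpace 𝓘(ℝ, E) (p y)) (_ : IsLocalSection (E' := E') σ s y),
    (σ y).comap (pullbackCovC cov p s y)

/-- The distribution `ℋ ⊆ TY` induced by the connection `∇`: the directions in which `σ` is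
parallel. -/
def horiz (cov : AffineConnection E M) {p : Y → M}
    (σ : Π y : Y, Submodule ℂ (ℂ ⊗[ℝ] TangentSpace 𝓘(ℝ, E) (p y))) (y : Y) :
    Submodule ℝ (TangentSpace 𝓘(ℝ, E') y) :=
  ((kerNabla (E' := E') cov σ y).restrictScalars ℝ).comap (incl _)

/-- The antiholomorphic tangent space `(ker dp)^{0,1}` of the fibre of `p` through `y`, where the
fibre `Y_x` has the complex structure for which `σ : Y_x → Gr(T_x^ℂ M)` is holomorphic: the
complexified vertical vectors which are killed by the complex linear extension of the differential
of this map. -/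
def vert01 (cov : AffineConnection E M) {p : Y → M}
    (σ : Π y : Y, Submodule ℂ (ℂ ⊗[ℝ] TangentSpace 𝓘(ℝ, E) (p y))) (y : Y) :
    Submodule ℂ (ℂ ⊗[ℝ] TangentSpace 𝓘(ℝ, E') y) :=
  (vert E E' p y).baseChange ℂ ⊓ kerNabla (E' := E') cov σ y

/-- The almost co-CR structure `𝒞 = ℬ ⊕ (ker dp)^{0,1}` of `Y`, where `ℬ` is the part of the
complexification of `ℋ` over `σ`: `ℬ ⊆ ℋ^ℂ` and `dp(ℬ_y) = σ(y)`. -/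
def coCR (cov : AffineConnection E M) {p : Y → M}
    (σ : Π y : Y, Submodule ℂ (ℂ ⊗[ℝ] TangentSpace 𝓘(ℝ, E) (p y))) (y : Y) :
    Submodule ℂ (ℂ ⊗[ℝ] TangentSpace 𝓘(ℝ, E') y) :=
  ((horiz (E' := E') cov σ y).baseChange ℂ ⊓
      (σ y).comap ((mfderiv 𝓘(ℝ, E') 𝓘(ℝ, E) p y).toLinearMap.baseChange ℂ)) ⊔
    vert01 (E' := E') cov σ y

/-- `(TM, Id, σ, ∇)` is a Riemannian almost twistorial structure on `M`: the manifold `Y` is, through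
`y ↦ (p y, σ y)`, a subbundle of the Grassmann bundle `Gr(T^ℂ M)` whose fibres are Euclidean
twistorial structures on the tangent spaces of `M`, and `∇` is a metric connection on `M`, with
totally antisymmetric torsion, which induces a connection on `Y`. The map `conjY` is the
conjugation of the fibres of `Y`. -/
structure IsAlmostTwistorial (cov : AffineConnection E M) (p : Y → M)
    (σ : Π y : Y, Submodule ℂ (ℂ ⊗[ℝ] TangentSpace 𝓘(ℝ, E) (p y))) (conjY : Y → Y) : Prop where
  /-- `∇` is a smooth metric connection. -/
  smooth_cov : CovariantDerivative.ContMDiffCovariantDerivative cov ∞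
  metric : IsMetric cov
  skewTorsion : HasSkewTorsion cov
  /-- `p` is a proper surjective submersion; in particular, its fibres are compact. -/
  submersion : IsSurjSubmersion E E' p
  proper : IsProperMap p
  /-- `σ` is smooth: it has local frames formed of smooth sections. -/
  smooth : ∀ y : Y, ∃ (k : ℕ) (s : Fin k → Π y : Y, ℂ ⊗[ℝ] TangentSpace 𝓘(ℝ, E) (p y)),
    (∀ i, IsLocalSection (E' := E') σ (s i) y) ∧
    ∀ᶠ y' in 𝓝 y, LinearIndependent ℂ (fun i ↦ s i y') ∧
      Submodule.span ℂ (Set.range fun i ↦ s i y') = σ y'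
  /-- On each fibre of `p`, the subspaces have the same dimension. -/
  rank : ∀ y y' : Y, p y = p y' → Module.finrank ℂ (σ y) = Module.finrank ℂ (σ y')
  coisotropic : ∀ y : Y, IsCoisotropic (σ y)
  /-- `Y` is contained in `Gr(T^ℂ M)`. -/
  injective : Function.Injective (fun y : Y ↦ (⟨p y, σ y⟩ : Gr E M))
  /-- The tangent spaces of the fibres of `Y` are complex subspaces of the tangent spaces of the
  Grassmannians. Hence, by the next condition, the fibres are complex submanifolds. -/
  complex_fibre : ∀ y : Y, ∀ v ∈ vert E E' p y, ∃ w ∈ vert E E' p y,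
    incl _ w - inclI _ v ∈ kerNabla (E' := E') cov σ y
  /-- `ℋ` is a connection on `Y`, that is, `TY = ℋ ⊕ ker dp`; in particular, the differentials of
  the maps from the fibres to the Grassmannians are injective. -/
  connection : ∀ y : Y, IsCompl (horiz (E' := E') cov σ y) (vert E E' p y)
  /-- `σ` intertwines the conjugations. -/
  conj : ∀ y : Y, (⟨p (conjY y), σ (conjY y)⟩ : Gr E M) = ⟨p y, (σ y).comap (conjC _)⟩

variable
  [RiemannianBundle (fun y : Y ↦ TangentSpace 𝓘(ℝ, E') y)]
  [IsContMDiffRiemannianBundle 𝓘(ℝ, E') ∞ E' (fun y : Y ↦ TangentSpace 𝓘(ℝ, E') y)]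
  {F : Type*} [NormedAddCommGroup F] [NormedSpace ℂ F] [FiniteDimensional ℂ F]
  {Z : Type*} [TopologicalSpace Z] [ChartedSpace F Z] [IsManifold 𝓘(ℂ, F) ω Z]

/-- The Riemannian metric of `Y` induces on the fibres of `p` the metrics given by the embeddings in
the Grassmannians. The Kähler metric of the Grassmannian at a subspace `S` is the Hilbert-Schmidt
metric of its tangent space `Hom(S, T^ℂ / S)`, up to the choice of a normalizing constant `c`. Thus,
if the sections `s_i` of `σ` form at `y` a unitary basis of `σ(y)` and the derivatives `∇_v s_i` are
Hermitian orthogonal to `σ(y)` then the square of the norm of `v` is `c ∑ |∇_v s_i|²`. -/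
def HasGrassmannFibreMetric (cov : AffineConnection E M) (p : Y → M)
    (σ : Π y : Y, Submodule ℂ (ℂ ⊗[ℝ] TangentSpace 𝓘(ℝ, E) (p y))) (c : ℝ) : Prop :=
  ∀ (y : Y), ∀ v ∈ vert E E' p y, ∀ (k : ℕ)
    (s : Fin k → Π y : Y, ℂ ⊗[ℝ] TangentSpace 𝓘(ℝ, E) (p y)),
    (∀ i, IsLocalSection (E' := E') σ (s i) y) →
    (∀ i j, hermC (s i y) (s j y) = if i = j then 1 else 0) →
    Submodule.span ℂ (Set.range fun i ↦ s i y) = σ y →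
    (∀ i, ∀ b ∈ σ y, hermC b (pullbackCovC cov p (s i) y (incl _ v)) = 0) →
    inner ℝ v v = c * ∑ i, (hermC (pullbackCovC cov p (s i) y (incl _ v))
      (pullbackCovC cov p (s i) y (incl _ v))).re

/-- The Riemannian twistorial structure `(TM, Id, σ, ∇)` on `M` is given by the submersions
`φ : Y → Z` and `p : Y → M`, where `Z` is a complex manifold with the conjugation `conjZ`, and
`covY` is the Levi-Civita connection of the Riemannian manifold `Y`. The integrability and the
coisotropy of `𝒞`, and `(ker dφ)^ℂ = 𝒞 ∩ conj 𝒞`, are consequences of these conditions, and so is the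
fact that `φ` restricts to holomorphic immersions of the fibres of `p`. -/
structure IsGivenBy (cov : AffineConnection E M) (p : Y → M)
    (σ : Π y : Y, Submodule ℂ (ℂ ⊗[ℝ] TangentSpace 𝓘(ℝ, E) (p y))) (conjY : Y → Y)
    (covY : AffineConnection E' Y) (φ : Y → Z) (conjZ : Z → Z) : Prop where
  almost : IsAlmostTwistorial (E' := E') cov p σ conjY
  /-- `ℋ` is the orthogonal complement of `ker dp`. -/
  horiz_eq : ∀ y : Y, horiz (E' := E') cov σ y = (vert E E' p y)ᗮ
  riemannian : IsRiemannianSubmersion (E := E) (E' := E') p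
  totallyGeodesic : HasTotallyGeodesicFibres E covY p
  fibreMetric : ∃ c : ℝ, 0 < c ∧ HasGrassmannFibreMetric (E' := E') cov p σ c
  submersion : IsSurjSubmersion F E' φ
  /-- `𝒞` is the preimage by `dφ` of `T^{0,1} Z`. -/
  coCR_eq : ∀ y : Y, coCR (E' := E') cov σ y =
    (T01 (φ y)).comap ((mfderiv 𝓘(ℝ, E') 𝓘(ℝ, F) φ y).toLinearMap.baseChange ℂ)
  /-- `φ` is injective on the fibres of `p`. -/
  fibre_injective : ∀ y y' : Y, p y = p y' → φ y = φ y' → y = y'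
  isConj : IsConjugation F conjZ
  /-- `φ` intertwines the conjugations. -/
  conj : ∀ y : Y, φ (conjY y) = conjZ (φ y)

/-- `φ` pulls back (locally defined) holomorphic functions on `Z` to harmonic functions on `Y`;
`covY` is the Levi-Civita connection of `Y`. -/
def PullsBackHolomorphicToHarmonic (F : Type*) [NormedAddCommGroup F] [NormedSpace ℂ F]
    {Z : Type*} [TopologicalSpace Z] [ChartedSpace F Z]
    (covY : AffineConnection E' Y) (φ : Y → Z) : Prop :=
  ∀ (W : Set Z) (f : Z → ℂ), IsOpen W → MDifferentiableOn 𝓘(ℂ, F) 𝓘(ℂ, ℂ) f W →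
    ∀ y ∈ φ ⁻¹' W, laplacian covY (f ∘ φ) y = 0

/-- The orthogonal complex structure `J` of `𝒦 = (ker dφ)ᗮ` for which `dφ` is complex linear. -/
def complexStr {Z : Type*} [TopologicalSpace Z] [ChartedSpace F Z] (φ : Y → Z) (y : Y)
    (a : TangentSpace 𝓘(ℝ, E') y) : TangentSpace 𝓘(ℝ, E') y :=
  horizontalLift (E := F) φ y (mulI (φ y) (mfderiv 𝓘(ℝ, E') 𝓘(ℝ, F) φ y a))

/-- The section `T` of `ℋ ⊗ Λ²ℋ^*` which corresponds to the torsion of `∇`. -/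
def torsionH (cov : AffineConnection E M) (p : Y → M) (y : Y)
    (a b : TangentSpace 𝓘(ℝ, E') y) : TangentSpace 𝓘(ℝ, E') y :=
  horizontalLift (E := E) p y (cov.torsion (p y) (mfderiv 𝓘(ℝ, E') 𝓘(ℝ, E) p y a)
    (mfderiv 𝓘(ℝ, E') 𝓘(ℝ, E) p y b))

/-- The distribution `ℋ ∩ 𝒦` of `Y`. -/
def horizK (E F : Type*) [NormedAddCommGroup E] [NormedSpace ℝ E]
    [NormedAddCommGroup F] [NormedSpace ℂ F]
    {M : Type*} [TopologicalSpace M] [ChartedSpace E M]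
    {Z : Type*} [TopologicalSpace Z] [ChartedSpace F Z]
    (p : Y → M) (φ : Y → Z) (y : Y) : Submodule ℝ (TangentSpace 𝓘(ℝ, E') y) :=
  (vert E E' p y)ᗮ ⊓ (vert F E' φ y)ᗮ

variable (F) in
/-- The condition `trace_ω (I^ℋ + P_{ℋ ∩ 𝒦} T) = 0`, where `ω` is the Kähler form of
`(ℋ ∩ 𝒦, J)`. The trace with respect to `ω` of a vector valued 2-form `Θ` is `∑ Θ(e_i, J e_i)`, where
`(e_i)` is an orthonormal basis of `ℋ ∩ 𝒦`. -/
def TraceCondition {Z : Type*} [TopologicalSpace Z] [ChartedSpace F Z]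
    (cov : AffineConnection E M) (p : Y → M) (φ : Y → Z) : Prop :=
  ∀ y : Y, let e := stdOrthonormalBasis ℝ (horizK (E' := E') E F p φ y)
    ∑ i, (integrabilityTensor E p y (e i : TangentSpace 𝓘(ℝ, E') y)
          (complexStr (F := F) φ y (e i)) +
        (horizK (E' := E') E F p φ y).starProjection
          (torsionH cov p y (e i) (complexStr (F := F) φ y (e i)))) = 0

end Twistorial

end RTwist

end

open Bundle Filter Topology
open scoped Manifold ContDiff TensorProduct

set_option linter.unusedSectionVars false

/-! Write `V = ker dp` and `L = ker dφ`. Since `L ⊆ ℋ` (`IsTwistorial.ker_le`), `TY` is the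
orthogonal sum of `L`, `ℋ ∩ 𝒦` and `V`, and the proof computes the Levi-Civita connection `D` of `Y`
on these pieces.

For horizontal fields `A`, `B`, the vertical part of `D_A B` is half that of `[A, B]`, because `p`
is a Riemannian submersion (`cov_add_cov_mem_orthogonal`). Its horizontal part is the lift of
`(p^*∇)_A (dp B) - T(A, B)/2`, because for a metric `∇` with skew torsion `∇ - T/2` is the
Levi-Civita connection of `M` (`mfderiv_cov_horizontal`). On the other hand `σ` is parallel along
`ℋ`, and for horizontal `X`, `X'` the relation `dφ X' = i dφ X` means that `X + iX'` is a section of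
`ℬ`. Hence, if `N_a X` denotes the lift of `(p^*∇)_a (dp X)`, then `dφ(N_a X') = i dφ(N_a X)` for
`a` in `ℋ` (`IsGivenBy.mfderiv_lift_pullbackCov`).

Fibres. If `X` is a section of `L`, the pair `(X, X)` is admissible, so `dφ(N_a X)` is fixed by `i`
and vanishes. For `A`, `X` in `L` the bracket lies in `L ⊆ ℋ` and equals `N_A X - N_X A - T(A, X)`;
hence `dφ T(A, X) = 0`, and `D_A X` lies in `L`.

Tension. If `dφ X' = i dφ X` and `f` is holomorphic, the Hessian of `f ∘ φ` on `(X, X)` plus its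
value on `(X', X')` is `df` of `i dφ[X', X] - dφ(D_X X + D_X' X')`. The second fundamental form of
`φ` for a Kähler metric of `Z` obeys the same formula without `df`. This vector is zero on `L`, by
the first part, and on `V`, because the fibres of `p` are totally geodesic and Kähler. On `ℋ ∩ 𝒦`
the derivatives `N` cancel and `i dφ(I^ℋ + T)(X, JX)` remains (`IsGivenBy.tension_horizontal`). As
`J` is orthogonal on `ℋ ∩ 𝒦` (by coisotropy, `IsTwistorial.inner_complex`) and on `V`, the full
trace is half the sum over pairs `(X, JX)`, so the Laplacian of `f ∘ φ` is `df(i dφ(τ))/2` with `τ`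
the vector of the trace condition (`IsGivenBy.sum_bilin`). Finally `τ` lies in `𝒦`, where `dφ` is
injective, and local holomorphic functions have arbitrary differentials at a point.

The Kähler property of the fibres is a matrix computation (`IsGivenBy.tension_vertical`). In a frame
pulled back from `M`, let `P` be the matrix of the Hermitian projection onto `σ`. Vertical vectors
become self-adjoint matrices `Q = QP + PQ`, the complex structure becomes `Q ↦ i(QP - PQ)`, the
metric a multiple of `Re tr(Q Q')`, and `D` the second derivative of `P` paired with tangent
matrices.

Both descriptions of Levi-Civita connections rest on Koszul's uniqueness argument, isolated in
`eq_zero_of_symm_of_skew`. -/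

namespace RTwist

/-! ### Lie brackets and second derivatives in charts -/

section Calculus

variable {E : Type*} [NormedAddCommGroup E] [NormedSpace ℝ E] [FiniteDimensional ℝ E]
  {M : Type*} [TopologicalSpace M] [ChartedSpace E M] [IsManifold 𝓘(ℝ, E) ∞ M]
  {E' : Type*} [NormedAddCommGroup E'] [NormedSpace ℝ E'] [FiniteDimensional ℝ E']
  {N : Type*} [TopologicalSpace N] [ChartedSpace E' N] [IsManifold 𝓘(ℝ, E') ∞ N]
  {G : Type*} [NormedAddCommGroup G] [NormedSpace ℝ G]

/-- A vector field on `N` which is smooth at `y`. -/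
abbrev SmoothFieldAt (X : Π y : N, TangentSpace 𝓘(ℝ, E') y) (y : N) : Prop :=
  ContMDiffAt 𝓘(ℝ, E') 𝓘(ℝ, E').tangent ∞ (fun y' ↦ (⟨y', X y'⟩ : TangentBundle 𝓘(ℝ, E') N)) y

/-- A vector field on `N` which is differentiable at `y`. -/
abbrev DiffFieldAt (X : Π y : N, TangentSpace 𝓘(ℝ, E') y) (y : N) : Prop :=
  MDifferentiableAt 𝓘(ℝ, E') 𝓘(ℝ, E').tangent
    (fun y' ↦ (⟨y', X y'⟩ : TangentBundle 𝓘(ℝ, E') N)) y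

theorem SmoothFieldAt.diff {X : Π y : N, TangentSpace 𝓘(ℝ, E') y} {y : N}
    (h : SmoothFieldAt X y) : DiffFieldAt X y :=
  ContMDiffAt.mdifferentiableAt h (by simp)

theorem trivializationAt_snd_eq_mvfderiv {x z : M} (hz : z ∈ (chartAt E x).source)
    (v : TangentSpace 𝓘(ℝ, E) z) :
    (trivializationAt E (TangentSpace 𝓘(ℝ, E) : M → Type _) x ⟨z, v⟩).2 =
      mvfderiv 𝓘(ℝ, E) (extChartAt 𝓘(ℝ, E) x) z v := by
  have h := TangentBundle.continuousLinearMapAt_trivializationAt (I := 𝓘(ℝ, E)) hz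
  have h2 := congrArg (fun L : TangentSpace 𝓘(ℝ, E) z →L[ℝ] E ↦ L v) h
  have h3 := congrFun (Trivialization.coe_linearMapAt_of_mem (R := ℝ)
    (trivializationAt E (TangentSpace 𝓘(ℝ, E) : M → Type _) x) (b := z) hz) v
  exact h3.symm.trans h2

theorem trivializationAt_model_snd (w z : G) (v : TangentSpace 𝓘(ℝ, G) z) :
    (trivializationAt G (TangentSpace 𝓘(ℝ, G) : G → Type _) w ⟨z, v⟩).2 = v := by
  have h := TangentBundle.continuousLinearMapAt_model_space (𝕜 := ℝ) (F := G) w z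
  have h2 := congrArg (fun L : G →L[ℝ] G ↦ L v) h
  have h3 := congrFun (Trivialization.coe_linearMapAt_of_mem (R := ℝ)
    (trivializationAt G (TangentSpace 𝓘(ℝ, G) : G → Type _) w) (b := z) (Set.mem_univ _)) v
  exact h3.symm.trans h2

theorem contMDiffAt_mvfderiv_apply {g : N → G} {y : N}
    (hg : ContMDiffAt 𝓘(ℝ, E') 𝓘(ℝ, G) ∞ g y) {X : Π y : N, TangentSpace 𝓘(ℝ, E') y}
    (hX : SmoothFieldAt X y) :
    ContMDiffAt 𝓘(ℝ, E') 𝓘(ℝ, G) ∞ (fun y' ↦ mvfderiv 𝓘(ℝ, E') g y' (X y')) y := by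
  have h1 : ContMDiffAt 𝓘(ℝ, E') 𝓘(ℝ, E' →L[ℝ] G) ∞
      (inTangentCoordinates 𝓘(ℝ, E') 𝓘(ℝ, G) id g (mfderiv 𝓘(ℝ, E') 𝓘(ℝ, G) g) y) y :=
    ContMDiffAt.mfderiv_const hg (by simp)
  have h2 := ContMDiffAt.clm_apply_of_inCoordinates h1 hX hg
  rw [contMDiffAt_totalSpace] at h2
  refine h2.2.congr_of_eventuallyEq ?_
  filter_upwards with z
  exact (trivializationAt_model_snd (g y) (g z) _).symm

theorem mdifferentiableAt_mvfderiv_apply {g : N → G} {y : N}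
    (hg : ContMDiffAt 𝓘(ℝ, E') 𝓘(ℝ, G) ∞ g y) {X : Π y : N, TangentSpace 𝓘(ℝ, E') y}
    (hX : DiffFieldAt X y) :
    MDifferentiableAt 𝓘(ℝ, E') 𝓘(ℝ, G) (fun y' ↦ mvfderiv 𝓘(ℝ, E') g y' (X y')) y := by
  have h1 : ContMDiffAt 𝓘(ℝ, E') 𝓘(ℝ, E' →L[ℝ] G) ∞
      (inTangentCoordinates 𝓘(ℝ, E') 𝓘(ℝ, G) id g (mfderiv 𝓘(ℝ, E') 𝓘(ℝ, G) g) y) y :=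
    ContMDiffAt.mfderiv_const hg (by simp)
  have h2 := MDifferentiableAt.clm_apply_of_inCoordinates (h1.mdifferentiableAt (by simp)) hX
    (hg.mdifferentiableAt (by simp))
  rw [mdifferentiableAt_totalSpace] at h2
  refine h2.2.congr_of_eventuallyEq ?_
  filter_upwards with z
  exact (trivializationAt_model_snd (g y) (g z) _).symm

theorem eventually_mvfderiv_extChartAt_extend (x : M) (v : TangentSpace 𝓘(ℝ, E) x) :
    ∀ᶠ z in 𝓝 x, mvfderiv 𝓘(ℝ, E) (extChartAt 𝓘(ℝ, E) x) z (FiberBundle.extend E v z) =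
      mvfderiv 𝓘(ℝ, E) (extChartAt 𝓘(ℝ, E) x) x v := by
  filter_upwards [(chartAt E x).open_source.mem_nhds (mem_chart_source E x)] with z hz
  rw [← trivializationAt_snd_eq_mvfderiv hz, ← trivializationAt_snd_eq_mvfderiv (mem_chart_source E x)]
  rw [FiberBundle.extend, Trivialization.apply_mk_symm _ hz]

/-- In the chart at `x` the canonical extensions have constant components, and constant fields
commute. -/
theorem mlieBracket_extend (x : M) (v w : TangentSpace 𝓘(ℝ, E) x) :
    VectorField.mlieBracket 𝓘(ℝ, E) (FiberBundle.extend E v) (FiberBundle.extend E w) x = 0 := by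
  rw [← VectorField.mlieBracketWithin_univ, VectorField.mlieBracketWithin_apply]
  have key : ∀ v : TangentSpace 𝓘(ℝ, E) x, 
    (VectorField.mpullbackWithin 𝓘(ℝ, E) 𝓘(ℝ, E) (extChartAt 𝓘(ℝ, E) x).symm
       (FiberBundle.extend E v : Π z : M, TangentSpace 𝓘(ℝ, E) z) (Set.range 𝓘(ℝ, E)))
      =ᶠ[𝓝 (extChartAt 𝓘(ℝ, E) x x)] fun _ ↦ mvfderiv 𝓘(ℝ, E) (extChartAt 𝓘(ℝ, E) x) x v := by
    intro v
    have h1 : ∀ᶠ w in 𝓝 (extChartAt 𝓘(ℝ, E) x x),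
        mvfderiv 𝓘(ℝ, E) (extChartAt 𝓘(ℝ, E) x) ((extChartAt 𝓘(ℝ, E) x).symm w)
          (FiberBundle.extend E v ((extChartAt 𝓘(ℝ, E) x).symm w)) =
        mvfderiv 𝓘(ℝ, E) (extChartAt 𝓘(ℝ, E) x) x v := by
      have hc := continuousAt_extChartAt_symm (I := 𝓘(ℝ, E)) x
      rw [ContinuousAt, extChartAt_to_inv] at hc
      exact hc.eventually (eventually_mvfderiv_extChartAt_extend x v)
    filter_upwards [h1, extChartAt_target_mem_nhds (I := 𝓘(ℝ, E)) x] with w hw hw'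
    rw [← hw, VectorField.mpullbackWithin_apply]
    rw [ContinuousLinearMap.inverse_eq
      (mfderivWithin_extChartAt_symm_comp_mfderiv_extChartAt hw')
      (mfderiv_extChartAt_comp_mfderivWithin_extChartAt_symm hw')]
    rfl
  have h2 := (key v).lieBracketWithin_vectorField_eq_nhds (key w) (𝕜 := ℝ)
    (s := (extChartAt 𝓘(ℝ, E) x).symm ⁻¹' Set.univ ∩ Set.range 𝓘(ℝ, E))
  rw [h2]
  simp only [VectorField.lieBracketWithin_eq, fderivWithin_fun_const, Pi.zero_apply,
    zero_apply, sub_zero]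
  exact map_zero _

theorem mvfderiv_comp_chart {g : N → G} {y : N}
    (hg : ContMDiffAt 𝓘(ℝ, E') 𝓘(ℝ, G) ∞ g y) :
    ∃ h : E' → G, ContDiffAt ℝ 2 h (extChartAt 𝓘(ℝ, E') y y) ∧
      (∀ᶠ z in 𝓝 y, mvfderiv 𝓘(ℝ, E') g z =
        (fderiv ℝ h (extChartAt 𝓘(ℝ, E') y z)).comp
          (mvfderiv 𝓘(ℝ, E') (extChartAt 𝓘(ℝ, E') y) z)) := by
  have hg2 : ContMDiffAt 𝓘(ℝ, E') 𝓘(ℝ, G) 2 g y := hg.of_le (WithTop.coe_le_coe.2 (le_top : (2 : ℕ∞) ≤ ⊤))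
  have hc : ContDiffAt ℝ 2 (g ∘ (extChartAt 𝓘(ℝ, E') y).symm) (extChartAt 𝓘(ℝ, E') y y) := by
    have := (contMDiffAt_iff.1 hg2).2
    simpa [contDiffWithinAt_univ, Function.comp_def, chartAt_self_eq] using this
  refine ⟨g ∘ (extChartAt 𝓘(ℝ, E') y).symm, hc, ?_⟩
  have hd : ∀ᶠ z in 𝓝 y, DifferentiableAt ℝ (g ∘ (extChartAt 𝓘(ℝ, E') y).symm)
      (extChartAt 𝓘(ℝ, E') y z) := by
    have := hc.eventually (by simp)
    exact ((continuousAt_extChartAt (I := 𝓘(ℝ, E')) y).eventually this).mono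
      fun z hz ↦ hz.differentiableAt (by simp)
  have hs : ∀ᶠ z in 𝓝 y, z ∈ (chartAt E' y).source :=
    (chartAt E' y).open_source.mem_nhds (mem_chart_source E' y)
  filter_upwards [hd, hs, hs.eventually_nhds] with z hz hzs hze
  have he : g =ᶠ[𝓝 z] (g ∘ (extChartAt 𝓘(ℝ, E') y).symm) ∘ (extChartAt 𝓘(ℝ, E') y) := by
    filter_upwards [hze] with w hw
    simp only [Function.comp]
    rw [(extChartAt 𝓘(ℝ, E') y).left_inv (by simpa using hw)]
  have h1 : MDifferentiableAt 𝓘(ℝ, E') 𝓘(ℝ, E') (extChartAt 𝓘(ℝ, E') y) z :=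
    mdifferentiableAt_extChartAt hzs
  ext v
  rw [mvfderiv, he.mfderiv_eq, mfderiv_comp z hz.mdifferentiableAt h1, mfderiv_eq_fderiv]
  rfl

/-- On fields with constant components in the chart at `y`, the iterated derivative is the second
derivative of the coordinate expression of `g`, which is symmetric. -/
theorem mvfderiv_mvfderiv_extend {g : N → G} {y : N}
    (hg : ContMDiffAt 𝓘(ℝ, E') 𝓘(ℝ, G) ∞ g y) (a b : TangentSpace 𝓘(ℝ, E') y) :
    mvfderiv 𝓘(ℝ, E') (fun z ↦ mvfderiv 𝓘(ℝ, E') g z (FiberBundle.extend E' b z)) y a =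
    mvfderiv 𝓘(ℝ, E') (fun z ↦ mvfderiv 𝓘(ℝ, E') g z (FiberBundle.extend E' a z)) y b := by
  obtain ⟨h, hh, he⟩ := mvfderiv_comp_chart hg
  set φ := extChartAt 𝓘(ℝ, E') y
  have h1 : MDifferentiableAt 𝓘(ℝ, E') 𝓘(ℝ, E') φ y :=
    mdifferentiableAt_extChartAt (mem_chart_source E' y)
  have hd : DifferentiableAt ℝ (fderiv ℝ h) (φ y) :=
    (hh.fderiv_right (m := 1) (by norm_num)).differentiableAt (by simp)
  have key : ∀ a b : TangentSpace 𝓘(ℝ, E') y,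
      mvfderiv 𝓘(ℝ, E') (fun z ↦ mvfderiv 𝓘(ℝ, E') g z (FiberBundle.extend E' b z)) y a =
      fderiv ℝ (fderiv ℝ h) (φ y) (mvfderiv 𝓘(ℝ, E') φ y a) (mvfderiv 𝓘(ℝ, E') φ y b) := by
    intro a b
    have e1 : (fun z ↦ mvfderiv 𝓘(ℝ, E') g z (FiberBundle.extend E' b z)) =ᶠ[𝓝 y]
        (fun w ↦ fderiv ℝ h w (mvfderiv 𝓘(ℝ, E') φ y b)) ∘ φ := by
      filter_upwards [he, eventually_mvfderiv_extChartAt_extend y b] with z hz hz'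
      rw [hz]
      exact congrArg (fderiv ℝ h (φ z)) hz'
    have hd2 : HasFDerivAt (fun w ↦ fderiv ℝ h w (mvfderiv 𝓘(ℝ, E') φ y b))
        ((fderiv ℝ (fderiv ℝ h) (φ y)).flip (mvfderiv 𝓘(ℝ, E') φ y b)) (φ y) := by
      exact ((ContinuousLinearMap.apply ℝ G (mvfderiv 𝓘(ℝ, E') φ y b)).hasFDerivAt).comp _
        hd.hasFDerivAt
    rw [mvfderiv, e1.mfderiv_eq, mfderiv_comp y hd2.differentiableAt.mdifferentiableAt h1,
      mfderiv_eq_fderiv, hd2.fderiv]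
    rfl
  rw [key, key]
  exact (hh.isSymmSndFDerivAt (by simp)).eq _ _

/-- The defect `Φ` of this identity is tensorial in both fields, so it can be evaluated on canonical
extensions. There the bracket vanishes and the second derivatives commute. -/
theorem mvfderiv_mlieBracket {g : N → G} {y : N}
    (hg : ContMDiffAt 𝓘(ℝ, E') 𝓘(ℝ, G) ∞ g y) {A B : Π y : N, TangentSpace 𝓘(ℝ, E') y}
    (hA : DiffFieldAt A y) (hB : DiffFieldAt B y) :
    mvfderiv 𝓘(ℝ, E') g y (VectorField.mlieBracket 𝓘(ℝ, E') A B y) =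
      mvfderiv 𝓘(ℝ, E') (fun z ↦ mvfderiv 𝓘(ℝ, E') g z (B z)) y (A y) -
      mvfderiv 𝓘(ℝ, E') (fun z ↦ mvfderiv 𝓘(ℝ, E') g z (A z)) y (B y) := by
  let Φ : (Π y : N, TangentSpace 𝓘(ℝ, E') y) → (Π y : N, TangentSpace 𝓘(ℝ, E') y) → G :=
    fun A B ↦ mvfderiv 𝓘(ℝ, E') (fun z ↦ mvfderiv 𝓘(ℝ, E') g z (B z)) y (A y) -
      mvfderiv 𝓘(ℝ, E') (fun z ↦ mvfderiv 𝓘(ℝ, E') g z (A z)) y (B y) -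
      mvfderiv 𝓘(ℝ, E') g y (VectorField.mlieBracket 𝓘(ℝ, E') A B y)
  have hsw : ∀ A B, Φ A B = - Φ B A := by
    intro A B
    simp only [Φ]
    rw [VectorField.mlieBracket_swap_apply, map_neg]
    abel
  have h2 : ∀ A, DiffFieldAt A y → TensorialAt 𝓘(ℝ, E') E' (Φ A ·) y := by
    intro A hA
    constructor
    · intro f σ hf hσ
      have e1 : (fun z ↦ mvfderiv 𝓘(ℝ, E') g z ((f • σ) z)) =
          f • fun z ↦ mvfderiv 𝓘(ℝ, E') g z (σ z) := by
        ext z; simp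
      simp only [Φ]
      rw [e1, mvfderiv_smul hf (mdifferentiableAt_mvfderiv_apply hg hσ),
        VectorField.mlieBracket_smul_right hf hσ]
      simp
      module
    · intro σ σ' hσ hσ'
      have e1 : (fun z ↦ mvfderiv 𝓘(ℝ, E') g z ((σ + σ') z)) =
          (fun z ↦ mvfderiv 𝓘(ℝ, E') g z (σ z)) + fun z ↦ mvfderiv 𝓘(ℝ, E') g z (σ' z) := by
        ext z; simp
      simp only [Φ]
      rw [e1, mvfderiv_add (mdifferentiableAt_mvfderiv_apply hg hσ)
        (mdifferentiableAt_mvfderiv_apply hg hσ'),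
        VectorField.mlieBracket_add_right hσ hσ']
      simp
      abel
  have h1 : ∀ B, DiffFieldAt B y → TensorialAt 𝓘(ℝ, E') E' (Φ · B) y := by
    intro B hB
    have := h2 B hB
    constructor
    · intro f σ hf hσ
      rw [hsw, this.smul hf hσ, hsw σ B, smul_neg]
    · intro σ σ' hσ hσ'
      rw [hsw, this.add hσ hσ', hsw σ B, hsw σ' B, neg_add]
  have hΦ : Φ A B = Φ (FiberBundle.extend E' (A y)) (FiberBundle.extend E' (B y)) :=
    TensorialAt.pointwise₂ h1 h2 hA (FiberBundle.mdifferentiableAt_extend ..) hB (FiberBundle.mdifferentiableAt_extend ..)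
      (by simp) (by simp)
  have hz : Φ A B = 0 := by
    rw [hΦ]
    simp only [Φ]
    rw [mlieBracket_extend, mvfderiv_mvfderiv_extend hg]
    simp
  exact (sub_eq_zero.1 hz).symm

end Calculus

/-! ### Components of sections in a trivialization -/

section Coordinates

variable {E : Type*} [NormedAddCommGroup E] [NormedSpace ℝ E]
  {M : Type*} [TopologicalSpace M] [ChartedSpace E M] [IsManifold 𝓘(ℝ, E) ∞ M]
  {N : Type*} [TopologicalSpace N]

theorem eventually_mem_baseSet {f : N → M} {y : N} (h : ContinuousAt f y) :
    ∀ᶠ y' in 𝓝 y, f y' ∈ (trivializationAt E (TangentSpace 𝓘(ℝ, E) : M → Type _) (f y)).baseSet :=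
  h.eventually ((trivializationAt E (TangentSpace 𝓘(ℝ, E) : M → Type _) (f y)).open_baseSet.mem_nhds
    (FiberBundle.mem_baseSet_trivializationAt' _))

theorem eventually_coord_add {f : N → M} {y : N} (hf : ContinuousAt f y)
    (s s' : Π y : N, TangentSpace 𝓘(ℝ, E) (f y)) :
    ∀ᶠ y' in 𝓝 y, ((trivializationAt E (TangentSpace 𝓘(ℝ, E) : M → Type _) (f y))
      ⟨f y', s y' + s' y'⟩ : M × E).2 = ((trivializationAt E (TangentSpace 𝓘(ℝ, E) : M → Type _) (f y))
      ⟨f y', s y'⟩ : M × E).2 + ((trivializationAt E (TangentSpace 𝓘(ℝ, E) : M → Type _) (f y))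
      ⟨f y', s' y'⟩ : M × E).2 := by
  filter_upwards [eventually_mem_baseSet (E := E) hf] with z hz
  exact ((trivializationAt E (TangentSpace 𝓘(ℝ, E) : M → Type _) (f y)).linear ℝ hz).map_add _ _

theorem eventually_coord_smul {f : N → M} {y : N} (hf : ContinuousAt f y) (c : N → ℝ)
    (s : Π y : N, TangentSpace 𝓘(ℝ, E) (f y)) :
    ∀ᶠ y' in 𝓝 y, ((trivializationAt E (TangentSpace 𝓘(ℝ, E) : M → Type _) (f y))
      ⟨f y', c y' • s y'⟩ : M × E).2 =
      c y' • ((trivializationAt E (TangentSpace 𝓘(ℝ, E) : M → Type _) (f y))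
      ⟨f y', s y'⟩ : M × E).2 := by
  filter_upwards [eventually_mem_baseSet (E := E) hf] with z hz
  exact ((trivializationAt E (TangentSpace 𝓘(ℝ, E) : M → Type _) (f y)).linear ℝ hz).map_smul _ _

theorem extend_eq_symmL {x : M} (v : TangentSpace 𝓘(ℝ, E) x) {z : M}
    (hz : z ∈ (trivializationAt E (TangentSpace 𝓘(ℝ, E) : M → Type _) x).baseSet) :
    FiberBundle.extend E v z =
      (trivializationAt E (TangentSpace 𝓘(ℝ, E) : M → Type _) x).symmL ℝ z
        ((trivializationAt E (TangentSpace 𝓘(ℝ, E) : M → Type _) x).continuousLinearMapAt ℝ x v) := by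
  rw [FiberBundle.extend, Trivialization.continuousLinearMapAt_apply,
    Trivialization.coe_linearMapAt_of_mem _ (FiberBundle.mem_baseSet_trivializationAt' x),
    Trivialization.symmL_apply _ hz]

theorem extend_add {x : M} (v w : TangentSpace 𝓘(ℝ, E) x) :
    ∀ᶠ z in 𝓝 x, (FiberBundle.extend E (v + w) z : TangentSpace 𝓘(ℝ, E) z) =
      FiberBundle.extend E v z + FiberBundle.extend E w z := by
  filter_upwards [eventually_mem_baseSet (E := E) (f := (id : M → M)) continuousAt_id] with z hz
  simp only [id] at hz
  rw [extend_eq_symmL _ hz, extend_eq_symmL _ hz, extend_eq_symmL _ hz,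
    map_add, map_add]

theorem extend_smul {x : M} (c : ℝ) (v : TangentSpace 𝓘(ℝ, E) x) :
    ∀ᶠ z in 𝓝 x, (FiberBundle.extend E (c • v) z : TangentSpace 𝓘(ℝ, E) z) =
      c • FiberBundle.extend E v z := by
  filter_upwards [eventually_mem_baseSet (E := E) (f := (id : M → M)) continuousAt_id] with z hz
  simp only [id] at hz
  rw [extend_eq_symmL _ hz, extend_eq_symmL _ hz, map_smul, map_smul]

end Coordinates

/-! ### The pullback connection: Leibniz rule and chain rule -/

section PullbackConnection

variable {E : Type*} [NormedAddCommGroup E] [NormedSpace ℝ E] [FiniteDimensional ℝ E]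
  {M : Type*} [TopologicalSpace M] [ChartedSpace E M] [IsManifold 𝓘(ℝ, E) ∞ M]
  {E' : Type*} [NormedAddCommGroup E'] [NormedSpace ℝ E'] [FiniteDimensional ℝ E']
  {N : Type*} [TopologicalSpace N] [ChartedSpace E' N] [IsManifold 𝓘(ℝ, E') ∞ N]

/-- A section of `f^*TM` which is differentiable at `y`. -/
def DiffSecAt (f : N → M) (s : Π y : N, TangentSpace 𝓘(ℝ, E) (f y)) (y : N) : Prop :=
  MDifferentiableAt 𝓘(ℝ, E') 𝓘(ℝ, E).tangent
    (fun y' ↦ (⟨f y', s y'⟩ : TangentBundle 𝓘(ℝ, E) M)) y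

theorem SmoothSecAt.diff {f : N → M} {s : Π y : N, TangentSpace 𝓘(ℝ, E) (f y)} {y : N}
    (h : SmoothSecAt (E' := E') f s y) : DiffSecAt (E' := E') f s y :=
  ContMDiffAt.mdifferentiableAt h (by simp)

theorem DiffSecAt.base {f : N → M} {s : Π y : N, TangentSpace 𝓘(ℝ, E) (f y)} {y : N}
    (h : DiffSecAt (E' := E') f s y) : MDifferentiableAt 𝓘(ℝ, E') 𝓘(ℝ, E) f y :=
  ((mdifferentiableAt_totalSpace _ _).1 h).1

theorem SmoothSecAt.base {f : N → M} {s : Π y : N, TangentSpace 𝓘(ℝ, E) (f y)} {y : N}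
    (h : SmoothSecAt (E' := E') f s y) : ContMDiffAt 𝓘(ℝ, E') 𝓘(ℝ, E) ∞ f y :=
  (contMDiffAt_totalSpace.1 h).1

theorem DiffSecAt.coord {f : N → M} {s : Π y : N, TangentSpace 𝓘(ℝ, E) (f y)} {y : N}
    (h : DiffSecAt (E' := E') f s y) : MDifferentiableAt 𝓘(ℝ, E') 𝓘(ℝ, E)
    (fun y' ↦ ((trivializationAt E (TangentSpace 𝓘(ℝ, E) : M → Type _) (f y))
      ⟨f y', s y'⟩ : M × E).2) y :=
  ((mdifferentiableAt_totalSpace _ _).1 h).2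

theorem mvfderiv_congr {G : Type*} [NormedAddCommGroup G] [NormedSpace ℝ G] {g h : N → G} {y : N}
    (e : g =ᶠ[𝓝 y] h) : mvfderiv 𝓘(ℝ, E') g y = mvfderiv 𝓘(ℝ, E') h y := by
  ext a
  simp only [mvfderiv]
  rw [e.mfderiv_eq]
  rfl

theorem pullbackCov_congr (cov : AffineConnection E M) {f : N → M}
    {s s' : Π y : N, TangentSpace 𝓘(ℝ, E) (f y)} {y : N} (h : ∀ᶠ y' in 𝓝 y, s y' = s' y') :
    pullbackCov (E' := E') cov f s y = pullbackCov cov f s' y := by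
  have e : (fun y' ↦ ((trivializationAt E (TangentSpace 𝓘(ℝ, E) : M → Type _) (f y))
      ⟨f y', s y'⟩ : M × E).2) =ᶠ[𝓝 y] (fun y' ↦ ((trivializationAt E
        (TangentSpace 𝓘(ℝ, E) : M → Type _) (f y)) ⟨f y', s' y'⟩ : M × E).2) := by
    filter_upwards [h] with z hz
    rw [hz]
  simp only [pullbackCov]
  rw [mvfderiv_congr e, h.self_of_nhds]

theorem cov_extend_add (cov : AffineConnection E M) {x : M} (v w : TangentSpace 𝓘(ℝ, E) x) :
    cov (FiberBundle.extend E (v + w)) x =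
      cov (FiberBundle.extend E v) x + cov (FiberBundle.extend E w) x := by
  have hv := FiberBundle.mdifferentiableAt_extend 𝓘(ℝ, E) E v
  have hw := FiberBundle.mdifferentiableAt_extend 𝓘(ℝ, E) E w
  rw [← cov.isCovariantDerivativeOnUniv.add hv hw]
  exact cov.isCovariantDerivativeOnUniv.congr_of_eventuallyEq
    (FiberBundle.mdifferentiableAt_extend 𝓘(ℝ, E) E _) (mdifferentiableAt_add_section hv hw)
    Filter.univ_mem (extend_add v w)

theorem cov_extend_smul (cov : AffineConnection E M) {x : M} (c : ℝ) (v : TangentSpace 𝓘(ℝ, E) x) :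
    cov (FiberBundle.extend E (c • v)) x = c • cov (FiberBundle.extend E v) x := by
  have hv := FiberBundle.mdifferentiableAt_extend 𝓘(ℝ, E) E v
  rw [← cov.isCovariantDerivativeOnUniv.smul_const c hv]
  exact cov.isCovariantDerivativeOnUniv.congr_of_eventuallyEq
    (FiberBundle.mdifferentiableAt_extend 𝓘(ℝ, E) E _) (mdifferentiableAt_const.smul_section hv)
    Filter.univ_mem (extend_smul c v)

theorem pullbackCov_add (cov : AffineConnection E M) {f : N → M}
    {s s' : Π y : N, TangentSpace 𝓘(ℝ, E) (f y)} {y : N}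
    (hs : DiffSecAt (E' := E') f s y) (hs' : DiffSecAt (E' := E') f s' y) :
    pullbackCov (E' := E') cov f (fun y ↦ s y + s' y) y =
      pullbackCov cov f s y + pullbackCov cov f s' y := by
  have e := eventually_coord_add hs.base.continuousAt s s'
  ext a
  simp only [pullbackCov]
  rw [cov_extend_add]
  rw [mvfderiv_congr e, mvfderiv_fun_add hs.coord hs'.coord]
  simp
  abel

theorem pullbackCov_smul (cov : AffineConnection E M) {f : N → M}
    {s : Π y : N, TangentSpace 𝓘(ℝ, E) (f y)} {c : N → ℝ} {y : N}
    (hc : MDifferentiableAt 𝓘(ℝ, E') 𝓘(ℝ, ℝ) c y) (hs : DiffSecAt (E' := E') f s y)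
    (a : TangentSpace 𝓘(ℝ, E') y) :
    pullbackCov (E' := E') cov f (fun y ↦ c y • s y) y a =
      c y • pullbackCov cov f s y a + mvfderiv 𝓘(ℝ, E') c y a • s y := by
  have e := eventually_coord_smul hs.base.continuousAt c s
  simp only [pullbackCov]
  rw [cov_extend_smul, mvfderiv_congr e, mvfderiv_fun_smul hc hs.coord]
  have h := (trivializationAt E (TangentSpace 𝓘(ℝ, E) : M → Type _) (f y)).symmL_continuousLinearMapAt
    (R := ℝ) (FiberBundle.mem_baseSet_trivializationAt' (f y)) (s y)
  rw [Trivialization.continuousLinearMapAt_apply, Trivialization.coe_linearMapAt_of_mem _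
    (FiberBundle.mem_baseSet_trivializationAt' (f y))] at h
  simp only [add_apply, ContinuousLinearMap.comp_apply, smul_apply, map_add, map_smul,
    ContinuousLinearMap.smulRight_apply, smul_add]
  rw [h]
  abel

/-- The difference between a connection and the coordinate derivative is tensorial, so it can be
computed on the canonical extension of `X x`, whose components are constant near `x`. This ties the
formula defining `pullbackCov` to the connection itself. -/
theorem cov_eq_coord (cov : AffineConnection E M) {X : Π x : M, TangentSpace 𝓘(ℝ, E) x} {x : M}
    (hX : DiffFieldAt X x) (w : TangentSpace 𝓘(ℝ, E) x) :
    cov X x w = (trivializationAt E (TangentSpace 𝓘(ℝ, E) : M → Type _) x).symmL ℝ x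
      (mvfderiv 𝓘(ℝ, E) (fun x' ↦ ((trivializationAt E (TangentSpace 𝓘(ℝ, E) : M → Type _) x)
        ⟨x', X x'⟩ : M × E).2) x w) + cov (FiberBundle.extend E (X x)) x w := by
  let t := trivializationAt E (TangentSpace 𝓘(ℝ, E) : M → Type _) x
  let Φ : (Π x : M, TangentSpace 𝓘(ℝ, E) x) → TangentSpace 𝓘(ℝ, E) x := fun X ↦
    cov X x w - t.symmL ℝ x (mvfderiv 𝓘(ℝ, E) (fun x' ↦ (t ⟨x', X x'⟩ : M × E).2) x w)
  have hΦ : TensorialAt 𝓘(ℝ, E) E Φ x := by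
    constructor
    · intro c σ hc hσ
      have hσc := DiffSecAt.coord (f := (id : M → M)) (E' := E) hσ
      simp only [id] at hσc
      have h := t.symmL_continuousLinearMapAt
        (R := ℝ) (FiberBundle.mem_baseSet_trivializationAt' x) (σ x)
      rw [Trivialization.continuousLinearMapAt_apply, Trivialization.coe_linearMapAt_of_mem _
        (FiberBundle.mem_baseSet_trivializationAt' x)] at h
      have e := eventually_coord_smul (f := (id : M → M)) (y := x) continuousAt_id c σ
      have e2 := mvfderiv_congr (E' := E) e
      simp only [id] at e2
      simp only [Φ, Pi.smul_apply', t]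
      rw [e2, mvfderiv_fun_smul hc hσc, cov.isCovariantDerivativeOnUniv.leibniz hσ hc]
      simp only [add_apply, smul_apply, map_add, map_smul,
        ContinuousLinearMap.smulRight_apply]
      rw [h]
      module
    · intro σ τ hσ hτ
      have hσc := DiffSecAt.coord (f := (id : M → M)) (E' := E) hσ
      simp only [id] at hσc
      have hτc := DiffSecAt.coord (f := (id : M → M)) (E' := E) hτ
      simp only [id] at hτc
      have e := eventually_coord_add (f := (id : M → M)) (y := x) continuousAt_id σ τ
      have e2 := mvfderiv_congr (E' := E) e
      simp only [id] at e2
      simp only [Φ, Pi.add_apply, t]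
      rw [e2, mvfderiv_fun_add hσc hτc, cov.isCovariantDerivativeOnUniv.add hσ hτ]
      simp only [add_apply, map_add]
      abel
  have h1 : Φ X = Φ (FiberBundle.extend E (X x)) :=
    hΦ.pointwise hX (FiberBundle.mdifferentiableAt_extend ..) (by simp)
  have h2 : (fun x' ↦ (t ⟨x', FiberBundle.extend E (X x) x'⟩ : M × E).2) =ᶠ[𝓝 x]
      fun _ ↦ (t ⟨x, X x⟩).2 := by
    filter_upwards [t.open_baseSet.mem_nhds (FiberBundle.mem_baseSet_trivializationAt' x)] with z hz
    rw [FiberBundle.extend, Trivialization.apply_mk_symm _ hz]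
  have h3 : Φ (FiberBundle.extend E (X x)) = cov (FiberBundle.extend E (X x)) x w := by
    simp only [Φ]
    rw [mvfderiv_congr h2, mvfderiv_const]
    simp
  rw [← h3, ← h1]
  simp [Φ, t]

/-- By `cov_eq_coord` this is the chain rule for the components of `X`. Together with the Leibniz
rule it determines the derivative of every smooth section, by expansion in a frame of `TM`. -/
theorem pullbackCov_comp (cov : AffineConnection E M) {f : N → M}
    {X : Π x : M, TangentSpace 𝓘(ℝ, E) x} {y : N} (hX : DiffFieldAt X (f y))
    (hf : MDifferentiableAt 𝓘(ℝ, E') 𝓘(ℝ, E) f y) (a : TangentSpace 𝓘(ℝ, E') y) :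
    pullbackCov (E' := E') cov f (fun y ↦ X (f y)) y a =
      cov X (f y) (mfderiv 𝓘(ℝ, E') 𝓘(ℝ, E) f y a) := by
  rw [cov_eq_coord cov hX]
  have h1 := ((mdifferentiableAt_totalSpace _ _).1 hX).2
  have h2 := mfderiv_comp_apply y (g := fun x' ↦ ((trivializationAt E
    (TangentSpace 𝓘(ℝ, E) : M → Type _) (f y)) ⟨x', X x'⟩ : M × E).2) (f := f) h1 hf a
  simp only [pullbackCov, add_apply, ContinuousLinearMap.comp_apply]
  congr 1
  refine congrArg ((trivializationAt E (TangentSpace 𝓘(ℝ, E) : M → Type _) (f y)).symmL ℝ (f y)) ?_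
  exact h2

end PullbackConnection

/-! ### Local frames, smooth sections, torsion of the pullback connection -/

section Frames

variable {E : Type*} [NormedAddCommGroup E] [NormedSpace ℝ E] [FiniteDimensional ℝ E]
  {M : Type*} [TopologicalSpace M] [ChartedSpace E M] [IsManifold 𝓘(ℝ, E) ∞ M]

/-- The local frame of `TM` given by the chart at `x₀` and a basis of the model space. -/
noncomputable def frameAt (x₀ : M) (j : Fin (Module.finrank ℝ E)) (x : M) : TangentSpace 𝓘(ℝ, E) x :=
  (trivializationAt E (TangentSpace 𝓘(ℝ, E) : M → Type _) x₀).symmL ℝ x (Module.finBasis ℝ E j)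

/-- The coefficients of tangent vectors with respect to the local frame `frameAt x₀`. -/
noncomputable def coefAt (x₀ : M) (j : Fin (Module.finrank ℝ E)) (x : M) : TangentSpace 𝓘(ℝ, E) x →L[ℝ] ℝ :=
  ((Module.finBasis ℝ E).coord j).toContinuousLinearMap ∘L
    (trivializationAt E (TangentSpace 𝓘(ℝ, E) : M → Type _) x₀).continuousLinearMapAt ℝ x

theorem sum_coefAt_smul_frameAt {x₀ x : M} (hx : x ∈ (chartAt E x₀).source)
    (v : TangentSpace 𝓘(ℝ, E) x) : ∑ j, coefAt x₀ j x v • frameAt x₀ j x = v := by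
  simp only [coefAt, frameAt, ContinuousLinearMap.comp_apply]
  simp only [← map_smul, ← map_sum]
  refine Eq.trans ?_ ((trivializationAt E (TangentSpace 𝓘(ℝ, E) : M → Type _)
    x₀).symmL_continuousLinearMapAt (R := ℝ) hx v)
  congr 1
  exact (Module.finBasis ℝ E).sum_repr _

theorem coefAt_frameAt {x₀ x : M} (hx : x ∈ (chartAt E x₀).source)
    (i j : Fin (Module.finrank ℝ E)) :
    coefAt x₀ i x (frameAt x₀ j x) = if i = j then 1 else 0 := by
  have h := (trivializationAt E (TangentSpace 𝓘(ℝ, E) : M → Type _)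
    x₀).continuousLinearMapAt_symmL (R := ℝ) hx (Module.finBasis ℝ E j)
  simp only [coefAt, frameAt, ContinuousLinearMap.comp_apply]
  rw [h]
  simp [Finsupp.single_apply, eq_comm]

variable {E' : Type*} [NormedAddCommGroup E'] [NormedSpace ℝ E'] [FiniteDimensional ℝ E']
  {N : Type*} [TopologicalSpace N] [ChartedSpace E' N] [IsManifold 𝓘(ℝ, E') ∞ N]

theorem smoothSecAt_iff {f : N → M} {s : Π y : N, TangentSpace 𝓘(ℝ, E) (f y)} {y : N} {x₀ : M}
    (hx : f y ∈ (chartAt E x₀).source) : SmoothSecAt (E' := E') f s y ↔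
      ContMDiffAt 𝓘(ℝ, E') 𝓘(ℝ, E) ∞ f y ∧ ContMDiffAt 𝓘(ℝ, E') 𝓘(ℝ, E) ∞
        (fun z ↦ (trivializationAt E (TangentSpace 𝓘(ℝ, E) : M → Type _) x₀).continuousLinearMapAt ℝ
          (f z) (s z)) y := by
  rw [SmoothSecAt, Trivialization.contMDiffAt_iff
    (e := trivializationAt E (TangentSpace 𝓘(ℝ, E) : M → Type _) x₀) (by simpa using hx)]
  refine and_congr_right fun hf ↦ ?_
  refine Filter.EventuallyEq.contMDiffAt_iff ?_
  filter_upwards [hf.continuousAt.eventually ((chartAt E x₀).open_source.mem_nhds hx)] with z hz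
  rw [Trivialization.continuousLinearMapAt_apply, Trivialization.coe_linearMapAt_of_mem _ hz]

theorem SmoothSecAt.congr {f : N → M} {s s' : Π y : N, TangentSpace 𝓘(ℝ, E) (f y)} {y : N}
    (hs : SmoothSecAt (E' := E') f s y) (h : ∀ᶠ z in 𝓝 y, s' z = s z) :
    SmoothSecAt (E' := E') f s' y :=
  ContMDiffAt.congr_of_eventuallyEq hs (by filter_upwards [h] with z hz; rw [hz])

theorem SmoothSecAt.add {f : N → M} {s s' : Π y : N, TangentSpace 𝓘(ℝ, E) (f y)} {y : N}
    (hs : SmoothSecAt (E' := E') f s y) (hs' : SmoothSecAt (E' := E') f s' y) :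
    SmoothSecAt (E' := E') f (fun z ↦ s z + s' z) y := by
  have hx := mem_chart_source E (f y)
  rw [smoothSecAt_iff hx] at hs hs' ⊢
  refine ⟨hs.1, ?_⟩
  simp only [map_add]
  exact hs.2.add hs'.2

theorem SmoothSecAt.smul {f : N → M} {s : Π y : N, TangentSpace 𝓘(ℝ, E) (f y)} {c : N → ℝ} {y : N}
    (hc : ContMDiffAt 𝓘(ℝ, E') 𝓘(ℝ, ℝ) ∞ c y) (hs : SmoothSecAt (E' := E') f s y)  :
    SmoothSecAt (E' := E') f (fun z ↦ c z • s z) y := by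
  have hx := mem_chart_source E (f y)
  rw [smoothSecAt_iff hx] at hs ⊢
  refine ⟨hs.1, ?_⟩
  simp only [map_smul]
  exact hc.smul hs.2

theorem SmoothSecAt.neg {f : N → M} {s : Π y : N, TangentSpace 𝓘(ℝ, E) (f y)} {y : N}
    (hs : SmoothSecAt (E' := E') f s y)  :
    SmoothSecAt (E' := E') f (fun z ↦ - s z) y := by
  simpa using hs.smul (c := fun _ ↦ -1) contMDiffAt_const

theorem SmoothSecAt.sub {f : N → M} {s s' : Π y : N, TangentSpace 𝓘(ℝ, E) (f y)} {y : N}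
    (hs : SmoothSecAt (E' := E') f s y) (hs' : SmoothSecAt (E' := E') f s' y) :
    SmoothSecAt (E' := E') f (fun z ↦ s z - s' z) y := by
  simpa [sub_eq_add_neg] using hs.add hs'.neg

theorem SmoothSecAt.zero {f : N → M} {y : N} (hf : ContMDiffAt 𝓘(ℝ, E') 𝓘(ℝ, E) ∞ f y) :
    SmoothSecAt (E' := E') f (fun z ↦ (0 : TangentSpace 𝓘(ℝ, E) (f z))) y := by
  rw [smoothSecAt_iff (mem_chart_source E (f y))]
  refine ⟨hf, ?_⟩
  simp only [map_zero]
  exact contMDiffAt_const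

theorem SmoothSecAt.sum {ι : Type*} (t : Finset ι) {f : N → M}
    {s : ι → Π y : N, TangentSpace 𝓘(ℝ, E) (f y)} {y : N}
    (hf : ContMDiffAt 𝓘(ℝ, E') 𝓘(ℝ, E) ∞ f y)
    (hs : ∀ i ∈ t, SmoothSecAt (E' := E') f (s i) y) :
    SmoothSecAt (E' := E') f (fun z ↦ ∑ i ∈ t, s i z) y := by
  classical
  induction t using Finset.induction_on with
  | empty => simpa using SmoothSecAt.zero hf
  | insert i t hi ih =>
    simp only [Finset.sum_insert hi]
    exact (hs i (by simp)).add (ih fun j hj ↦ hs j (by simp [hj]))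

theorem pullbackCov_sum (cov : AffineConnection E M) {ι : Type*} (t : Finset ι) {f : N → M}
    {s : ι → Π y : N, TangentSpace 𝓘(ℝ, E) (f y)} {y : N}
    (hf : ContMDiffAt 𝓘(ℝ, E') 𝓘(ℝ, E) ∞ f y)
    (hs : ∀ i ∈ t, SmoothSecAt (E' := E') f (s i) y) :
    pullbackCov (E' := E') cov f (fun z ↦ ∑ i ∈ t, s i z) y = ∑ i ∈ t, pullbackCov cov f (s i) y := by
  classical
  induction t using Finset.induction_on with
  | empty =>
    have h0 := (SmoothSecAt.zero hf).diff
    have := pullbackCov_add cov h0 h0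
    simpa using this
  | insert i t hi ih =>
    simp only [Finset.sum_insert hi]
    rw [pullbackCov_add cov (hs i (by simp)).diff
      (SmoothSecAt.sum t hf fun j hj ↦ hs j (by simp [hj])).diff,
      ih fun j hj ↦ hs j (by simp [hj])]

theorem smoothFieldAt_frameAt {x₀ x : M} (hx : x ∈ (chartAt E x₀).source)
    (j : Fin (Module.finrank ℝ E)) : SmoothFieldAt (frameAt x₀ j) x := by
  refine (smoothSecAt_iff (f := (id : M → M)) (E' := E) (s := frameAt x₀ j) hx).2
    ⟨contMDiffAt_id, ?_⟩
  refine (contMDiffAt_const (c := Module.finBasis ℝ E j)).congr_of_eventuallyEq ?_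
  filter_upwards [(chartAt E x₀).open_source.mem_nhds hx] with z hz
  exact (trivializationAt E (TangentSpace 𝓘(ℝ, E) : M → Type _)
    x₀).continuousLinearMapAt_symmL (R := ℝ) hz (Module.finBasis ℝ E j)

theorem SmoothFieldAt.comp {X : Π x : M, TangentSpace 𝓘(ℝ, E) x} {f : N → M} {y : N}
    (hX : SmoothFieldAt X (f y)) (hf : ContMDiffAt 𝓘(ℝ, E') 𝓘(ℝ, E) ∞ f y) :
    SmoothSecAt (E' := E') f (fun z ↦ X (f z)) y :=
  ContMDiffAt.comp y hX hf

theorem SmoothSecAt.coefAt {f : N → M} {s : Π y : N, TangentSpace 𝓘(ℝ, E) (f y)} {y : N} {x₀ : M}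
    (hs : SmoothSecAt (E' := E') f s y) (hx : f y ∈ (chartAt E x₀).source)
    (j : Fin (Module.finrank ℝ E)) :
    ContMDiffAt 𝓘(ℝ, E') 𝓘(ℝ, ℝ) ∞ (fun z ↦ coefAt x₀ j (f z) (s z)) y := by
  rw [smoothSecAt_iff hx] at hs
  exact (ContinuousLinearMap.contMDiff (n := ∞)
    ((Module.finBasis ℝ E).coord j).toContinuousLinearMap).contMDiffAt.comp y hs.2

theorem SmoothSecAt.eventually_eq_sum {f : N → M} {s : Π y : N, TangentSpace 𝓘(ℝ, E) (f y)} {y : N}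
    {x₀ : M} (hs : SmoothSecAt (E' := E') f s y) (hx : f y ∈ (chartAt E x₀).source) :
    ∀ᶠ z in 𝓝 y, s z = ∑ j, RTwist.coefAt x₀ j (f z) (s z) • frameAt x₀ j (f z) := by
  filter_upwards [hs.base.continuousAt.eventually ((chartAt E x₀).open_source.mem_nhds hx)] with z hz
  rw [sum_coefAt_smul_frameAt hz]

theorem pullbackCov_eq_sum (cov : AffineConnection E M) {f : N → M}
    {s : Π y : N, TangentSpace 𝓘(ℝ, E) (f y)} {y : N}
    {x₀ : M} (hs : SmoothSecAt (E' := E') f s y) (hx : f y ∈ (chartAt E x₀).source)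
    (a : TangentSpace 𝓘(ℝ, E') y) :
    pullbackCov cov f s y a = ∑ j, (coefAt x₀ j (f y) (s y) •
        cov (frameAt x₀ j) (f y) (mfderiv 𝓘(ℝ, E') 𝓘(ℝ, E) f y a) +
      mvfderiv 𝓘(ℝ, E') (fun z ↦ coefAt x₀ j (f z) (s z)) y a • frameAt x₀ j (f y)) := by
  have h1 : ∀ j, SmoothSecAt (E' := E') f (fun z ↦ frameAt x₀ j (f z)) y := fun j ↦
    (smoothFieldAt_frameAt hx j).comp hs.base
  have h2 := fun j ↦ (hs.coefAt hx j)
  rw [pullbackCov_congr cov (hs.eventually_eq_sum hx), pullbackCov_sum cov _ hs.base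
    (fun j _ ↦ (h1 j).smul (h2 j))]
  rw [sum_apply]
  refine Finset.sum_congr rfl fun j _ ↦ ?_
  rw [pullbackCov_smul cov ((h2 j).mdifferentiableAt (by simp)) (h1 j).diff,
    pullbackCov_comp cov (smoothFieldAt_frameAt hx j).diff (hs.base.mdifferentiableAt (by simp))]

/-- The derivative of a section of `f^*TM` along a vector tangent to the fibre of `f`. -/
theorem pullbackCov_vert (cov : AffineConnection E M) {f : N → M}
    {s : Π y : N, TangentSpace 𝓘(ℝ, E) (f y)} {y : N}
    {x₀ : M} (hs : SmoothSecAt (E' := E') f s y) (hx : f y ∈ (chartAt E x₀).source)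
    {a : TangentSpace 𝓘(ℝ, E') y} (ha : a ∈ vert E E' f y) :
    pullbackCov cov f s y a = ∑ j,
      mvfderiv 𝓘(ℝ, E') (fun z ↦ coefAt x₀ j (f z) (s z)) y a • frameAt x₀ j (f y) := by
  rw [pullbackCov_eq_sum cov hs hx]
  have : mfderiv 𝓘(ℝ, E') 𝓘(ℝ, E) f y a = 0 := ha
  simp [this]

theorem SmoothFieldAt.mfderiv_apply {f : N → M} {X : Π y : N, TangentSpace 𝓘(ℝ, E') y} {y : N}
    (hf : ContMDiffAt 𝓘(ℝ, E') 𝓘(ℝ, E) ∞ f y) (hX : SmoothFieldAt X y) :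
    SmoothSecAt (E' := E') f (fun z ↦ mfderiv 𝓘(ℝ, E') 𝓘(ℝ, E) f z (X z)) y := by
  have h1 : ContMDiffAt 𝓘(ℝ, E') 𝓘(ℝ, E' →L[ℝ] E) ∞
      (inTangentCoordinates 𝓘(ℝ, E') 𝓘(ℝ, E) id f (mfderiv 𝓘(ℝ, E') 𝓘(ℝ, E) f) y) y :=
    ContMDiffAt.mfderiv_const hf (by simp)
  exact ContMDiffAt.clm_apply_of_inCoordinates h1 hX hf

/-- The torsion of the pullback connection. -/
theorem pullbackCov_sub_eq_torsion (cov : AffineConnection E M) {f : N → M} {y : N}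
    (hf : ContMDiffAt 𝓘(ℝ, E') 𝓘(ℝ, E) ∞ f y) {A B : Π y : N, TangentSpace 𝓘(ℝ, E') y}
    (hA : DiffFieldAt A y) (hB : DiffFieldAt B y) :
    pullbackCov cov f (fun z ↦ mfderiv 𝓘(ℝ, E') 𝓘(ℝ, E) f z (B z)) y (A y) -
      pullbackCov cov f (fun z ↦ mfderiv 𝓘(ℝ, E') 𝓘(ℝ, E) f z (A z)) y (B y) =
    mfderiv 𝓘(ℝ, E') 𝓘(ℝ, E) f y (VectorField.mlieBracket 𝓘(ℝ, E') A B y) +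
      cov.torsion (f y) (mfderiv 𝓘(ℝ, E') 𝓘(ℝ, E) f y (A y))
        (mfderiv 𝓘(ℝ, E') 𝓘(ℝ, E) f y (B y)) := by
  set t := trivializationAt E (TangentSpace 𝓘(ℝ, E) : M → Type _) (f y) with ht
  set φ := extChartAt 𝓘(ℝ, E) (f y) with hφ
  have hφd : ∀ x ∈ (chartAt E (f y)).source, MDifferentiableAt 𝓘(ℝ, E) 𝓘(ℝ, E) φ x := fun x hx ↦
    mdifferentiableAt_extChartAt hx
  have hg : ContMDiffAt 𝓘(ℝ, E') 𝓘(ℝ, E) ∞ (φ ∘ f) y :=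
    (contMDiffAt_extChartAt (I := 𝓘(ℝ, E)) (n := ∞) (x := f y)).comp y hf
  have hfd : ∀ᶠ z in 𝓝 y, MDifferentiableAt 𝓘(ℝ, E') 𝓘(ℝ, E) f z := by
    have h1 : ContMDiffAt 𝓘(ℝ, E') 𝓘(ℝ, E) 1 f y :=
      hf.of_le (WithTop.coe_le_coe.2 (le_top : (1 : ℕ∞) ≤ ⊤))
    exact ((contMDiffAt_iff_contMDiffAt_nhds (by simp)).1 h1).mono
      fun z hz ↦ hz.mdifferentiableAt (by simp)
  -- In the chart at `f y` the components of `df(C)` are the derivative of the vector valued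
  -- function `φ ∘ f` along `C`, so their antisymmetrized derivatives are given by
  -- `mvfderiv_mlieBracket`.
  have key : ∀ C : Π y : N, TangentSpace 𝓘(ℝ, E') y, ∀ᶠ z in 𝓝 y,
      (t ⟨f z, mfderiv 𝓘(ℝ, E') 𝓘(ℝ, E) f z (C z)⟩ : M × E).2 =
        mvfderiv 𝓘(ℝ, E') (φ ∘ f) z (C z) := by
    intro C
    filter_upwards [hfd, hf.continuousAt.eventually
      ((chartAt E (f y)).open_source.mem_nhds (mem_chart_source E (f y)))] with z hz hz'
    rw [ht, trivializationAt_snd_eq_mvfderiv hz']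
    exact (mfderiv_comp_apply z (hφd _ hz') hz (C z)).symm
  have hbr := mvfderiv_mlieBracket hg hA hB
  have hT := cov.torsion_apply_eq_extend (mfderiv 𝓘(ℝ, E') 𝓘(ℝ, E) f y (A y))
    (mfderiv 𝓘(ℝ, E') 𝓘(ℝ, E) f y (B y))
  -- The canonical extensions commute, so the torsion is exactly the antisymmetrization of the
  -- second summand in the definition of `pullbackCov`.
  rw [mlieBracket_extend, FiberBundle.extend_apply_self, FiberBundle.extend_apply_self] at hT
  have h2 : t.symmL ℝ (f y) (mvfderiv 𝓘(ℝ, E') (φ ∘ f) y (VectorField.mlieBracket 𝓘(ℝ, E') A B y)) =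
      mfderiv 𝓘(ℝ, E') 𝓘(ℝ, E) f y (VectorField.mlieBracket 𝓘(ℝ, E') A B y) := by
    have := (key (VectorField.mlieBracket 𝓘(ℝ, E') A B)).self_of_nhds
    rw [← this]
    have h := t.symmL_continuousLinearMapAt (R := ℝ) (FiberBundle.mem_baseSet_trivializationAt' (f y))
      (mfderiv 𝓘(ℝ, E') 𝓘(ℝ, E) f y (VectorField.mlieBracket 𝓘(ℝ, E') A B y))
    rw [Trivialization.continuousLinearMapAt_apply, Trivialization.coe_linearMapAt_of_mem _
        (FiberBundle.mem_baseSet_trivializationAt' (f y))] at h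
    exact h
  rw [hT, ← h2, hbr, map_sub]
  simp only [pullbackCov, add_apply, ContinuousLinearMap.comp_apply]
  rw [mvfderiv_congr (key A), mvfderiv_congr (key B)]
  simp only [← ht]
  module

end Frames

/-! ### Metric connections along maps -/

section Metric

variable {E : Type*} [NormedAddCommGroup E] [NormedSpace ℝ E] [FiniteDimensional ℝ E]
  {M : Type*} [TopologicalSpace M] [ChartedSpace E M] [IsManifold 𝓘(ℝ, E) ∞ M]
  [RiemannianBundle (fun x : M ↦ TangentSpace 𝓘(ℝ, E) x)]
  [IsContMDiffRiemannianBundle 𝓘(ℝ, E) ∞ E (fun x : M ↦ TangentSpace 𝓘(ℝ, E) x)]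
  {E' : Type*} [NormedAddCommGroup E'] [NormedSpace ℝ E'] [FiniteDimensional ℝ E']
  {N : Type*} [TopologicalSpace N] [ChartedSpace E' N] [IsManifold 𝓘(ℝ, E') ∞ N]

theorem SmoothSecAt.inner {f : N → M} {s s' : Π y : N, TangentSpace 𝓘(ℝ, E) (f y)} {y : N}
    (hs : SmoothSecAt (E' := E') f s y) (hs' : SmoothSecAt (E' := E') f s' y) :
    ContMDiffAt 𝓘(ℝ, E') 𝓘(ℝ, ℝ) ∞ (fun z ↦ inner ℝ (s z) (s' z)) y :=
  ContMDiffAt.inner_bundle (IB := 𝓘(ℝ, E)) hs hs'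

theorem mvfderiv_sum {G : Type*} [NormedAddCommGroup G] [NormedSpace ℝ G] {ι : Type*} (t : Finset ι)
    {g : ι → N → G} {y : N} (h : ∀ i ∈ t, MDifferentiableAt 𝓘(ℝ, E') 𝓘(ℝ, G) (g i) y) :
    MDifferentiableAt 𝓘(ℝ, E') 𝓘(ℝ, G) (fun z ↦ ∑ i ∈ t, g i z) y ∧
    mvfderiv 𝓘(ℝ, E') (fun z ↦ ∑ i ∈ t, g i z) y = ∑ i ∈ t, mvfderiv 𝓘(ℝ, E') (g i) y := by
  classical
  induction t using Finset.induction_on with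
  | empty => simpa using ⟨mdifferentiableAt_const, mvfderiv_const (0 : G)⟩
  | insert i t hi ih =>
    have ih := ih fun j hj ↦ h j (by simp [hj])
    simp only [Finset.sum_insert hi]
    refine ⟨(h i (by simp)).add ih.1, ?_⟩
    rw [mvfderiv_fun_add (h i (by simp)) ih.1, ih.2]

/-- Both sides obey the same Leibniz rule in `s`, so the formula for all `s` follows from the one
for fields restricted from `M`, applied to a local frame. -/
theorem mvfderiv_inner_aux (cov : AffineConnection E M) {f : N → M}
    {s s' : Π y : N, TangentSpace 𝓘(ℝ, E) (f y)} {y : N} (a : TangentSpace 𝓘(ℝ, E') y)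
    (hs : SmoothSecAt (E' := E') f s y) (hs' : SmoothSecAt (E' := E') f s' y)
    (h : ∀ X : Π x : M, TangentSpace 𝓘(ℝ, E) x, SmoothFieldAt X (f y) →
      mvfderiv 𝓘(ℝ, E') (fun z ↦ inner ℝ (X (f z)) (s' z)) y a =
        inner ℝ (pullbackCov cov f (fun z ↦ X (f z)) y a) (s' y) +
        inner ℝ (X (f y)) (pullbackCov cov f s' y a)) :
    mvfderiv 𝓘(ℝ, E') (fun z ↦ inner ℝ (s z) (s' z)) y a =
      inner ℝ (pullbackCov cov f s y a) (s' y) + inner ℝ (s y) (pullbackCov cov f s' y a) := by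
  have hx := mem_chart_source E (f y)
  have h1 : ∀ j, SmoothSecAt (E' := E') f (fun z ↦ frameAt (f y) j (f z)) y := fun j ↦
    (smoothFieldAt_frameAt hx j).comp hs.base
  have h2 := fun j ↦ (hs.coefAt hx j)
  have e : (fun z ↦ inner ℝ (s z) (s' z)) =ᶠ[𝓝 y] fun z ↦ ∑ j,
      coefAt (f y) j (f z) (s z) * inner ℝ (frameAt (f y) j (f z)) (s' z) := by
    filter_upwards [hs.eventually_eq_sum hx] with z hz
    conv_lhs => rw [hz]
    simp [sum_inner, inner_smul_left]
  have h3 : ∀ j, MDifferentiableAt 𝓘(ℝ, E') 𝓘(ℝ, ℝ)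
      (fun z ↦ inner ℝ (frameAt (f y) j (f z)) (s' z)) y := fun j ↦
    ((h1 j).inner hs').mdifferentiableAt (by simp)
  have h4 := fun j ↦ (h2 j).mdifferentiableAt (n := ∞) (by simp)
  rw [mvfderiv_congr e, (mvfderiv_sum (g := fun j z ↦ coefAt (f y) j (f z) (s z) *
      inner ℝ (frameAt (f y) j (f z)) (s' z)) _ fun j _ ↦ (h4 j).mul (h3 j)).2,
    pullbackCov_congr cov (hs.eventually_eq_sum hx), pullbackCov_sum cov _ hs.base
    (fun j _ ↦ (h1 j).smul (h2 j)), sum_apply, sum_apply, sum_inner]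
  conv_rhs => rw [← sum_coefAt_smul_frameAt hx (s y), sum_inner]
  rw [← Finset.sum_add_distrib]
  refine Finset.sum_congr rfl fun j _ ↦ ?_
  rw [mvfderiv_fun_mul (h4 j) (h3 j), pullbackCov_smul cov (h4 j) (h1 j).diff]
  simp only [add_apply, smul_apply, smul_eq_mul, inner_add_left, inner_smul_left]
  rw [h (frameAt (f y) j) (smoothFieldAt_frameAt hx j)]
  simp
  ring

/-- The previous reduction is applied to the two arguments in turn. For two fields restricted from
`M`, the chain rule leaves the metric condition on `cov`. -/
theorem mvfderiv_inner_pullback {cov : AffineConnection E M} (hcov : IsMetric cov) {f : N → M}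
    {s s' : Π y : N, TangentSpace 𝓘(ℝ, E) (f y)} {y : N} (a : TangentSpace 𝓘(ℝ, E') y)
    (hs : SmoothSecAt (E' := E') f s y) (hs' : SmoothSecAt (E' := E') f s' y) :
    mvfderiv 𝓘(ℝ, E') (fun z ↦ inner ℝ (s z) (s' z)) y a =
      inner ℝ (pullbackCov cov f s y a) (s' y) + inner ℝ (s y) (pullbackCov cov f s' y a) := by
  refine mvfderiv_inner_aux cov a hs hs' fun X hX ↦ ?_
  have hXf := hX.comp hs.base
  have key := mvfderiv_inner_aux cov a hs' hXf fun X' hX' ↦ ?_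
  · have e : (fun z ↦ inner ℝ (X (f z)) (s' z)) = fun z ↦ inner ℝ (s' z) (X (f z)) :=
      funext fun z ↦ real_inner_comm _ _
    rw [e, key, add_comm]
    exact congrArg₂ (· + ·) (real_inner_comm _ _) (real_inner_comm _ _)
  · have hfd := hs.base.mdifferentiableAt (n := ∞) (by simp)
    rw [pullbackCov_comp cov hX.diff hfd, pullbackCov_comp cov hX'.diff hfd,
      ← hcov (f y) X' X _ hX'.diff hX.diff]
    have hi : MDifferentiableAt 𝓘(ℝ, E) 𝓘(ℝ, ℝ) (fun x ↦ inner ℝ (X' x) (X x)) (f y) :=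
      (SmoothSecAt.inner (f := (id : M → M)) hX' hX).mdifferentiableAt (by simp)
    exact mfderiv_comp_apply y hi hfd a

end Metric

/-! ### Holomorphic functions of several variables are smooth -/

section Holomorphic

variable {F : Type*} [NormedAddCommGroup F] [NormedSpace ℂ F] [FiniteDimensional ℂ F]

open Metric MeasureTheory in
/-- The directional derivatives of a holomorphic function of several variables are holomorphic. -/
theorem differentiableOn_fderiv_apply {f : F → ℂ} {U : Set F} (hU : IsOpen U)
    (hf : DifferentiableOn ℂ f U) (v : F) : DifferentiableOn ℂ (fun x ↦ fderiv ℂ f x v) U := by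
  intro x₀ hx₀
  refine DifferentiableAt.differentiableWithinAt ?_
  have hcont : ContinuousAt f x₀ := (hf x₀ hx₀).continuousWithinAt.continuousAt (hU.mem_nhds hx₀)
  -- Continuity makes `f` bounded near `x₀`, as Cauchy's estimate requires. Of the radius `R' = 3R`,
  -- the points of differentiation use `R`, the arguments in the integral `2R`, and the balls for
  -- Cauchy's estimate `3R`.
  obtain ⟨R', hR', hRU⟩ := Metric.mem_nhds_iff.1 (Filter.inter_mem (hU.mem_nhds hx₀)
    (hcont (Metric.ball_mem_nhds (f x₀) one_pos)))
  obtain ⟨R, hR, hR3⟩ : ∃ R : ℝ, 0 < R ∧ 3 * R = R' := ⟨R' / 3, by positivity, by ring⟩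
  subst hR3
  have hsub : ball x₀ (3 * R) ⊆ U := fun x hx ↦ (hRU hx).1
  have hbd : ∀ x ∈ ball x₀ (3 * R), dist (f x) (f x₀) < 1 := fun x hx ↦ (hRU hx).2
  have hd : ∀ x ∈ U, DifferentiableAt ℂ f x := fun x hx ↦ (hf x hx).differentiableAt (hU.mem_nhds hx)
  -- Cauchy's estimate: `f` maps the ball of radius `R` about `x` into a ball of radius `2`.
  have hfd : ∀ x ∈ ball x₀ (2 * R), ‖fderiv ℂ f x‖ ≤ 2 / R := by
    intro x hx
    have hb : ball x R ⊆ ball x₀ (3 * R) := by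
      refine ball_subset_ball' ?_
      have := mem_ball.1 hx
      linarith
    refine Complex.norm_fderiv_le_div_of_mapsTo_ball (hf.mono (hb.trans hsub)) (fun z hz ↦ ?_) hR
    have h1 := hbd z (hb hz)
    have h2 := hbd x (hb (mem_ball_self hR))
    have := dist_triangle_right (f z) (f x) (f x₀)
    exact mem_closedBall.2 (by linarith)
  have hlip : ∀ x ∈ ball x₀ (2 * R), ∀ z ∈ ball x₀ (2 * R), ‖f z - f x‖ ≤ 2 / R * ‖z - x‖ := by
    intro x hx z hz
    refine (convex_ball x₀ (2 * R)).norm_image_sub_le_of_norm_fderiv_le (𝕜 := ℂ)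
      (fun w hw ↦ hd w (hsub (ball_subset_ball (by linarith) hw))) hfd hx hz
  obtain ⟨r, hr, hrv⟩ : ∃ r : ℝ, 0 < r ∧ r * ‖v‖ < R := by
    refine ⟨R / (‖v‖ + 1), by positivity, ?_⟩
    rw [div_mul_eq_mul_div, div_lt_iff₀ (by positivity)]
    nlinarith [norm_nonneg v]
  have hmem : ∀ x ∈ ball x₀ R, ∀ ζ ∈ closedBall (0 : ℂ) r, x + ζ • v ∈ ball x₀ (2 * R) := by
    intro x hx ζ hζ
    rw [mem_ball, dist_eq_norm] at hx ⊢
    have h1 : ‖ζ • v‖ ≤ r * ‖v‖ := by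
      rw [norm_smul]
      exact mul_le_mul_of_nonneg_right (by simpa using hζ) (norm_nonneg v)
    calc ‖x + ζ • v - x₀‖ = ‖(x - x₀) + ζ • v‖ := by congr 1; abel
      _ ≤ ‖x - x₀‖ + ‖ζ • v‖ := norm_add_le _ _
      _ < 2 * R := by linarith
  -- Cauchy's formula for the derivative at `0` of `ζ ↦ f (x + ζ v)`. The integrand no longer
  -- contains a derivative of `f`, so the integral can be differentiated in `x`.
  have hcauchy : ∀ x ∈ ball x₀ R, fderiv ℂ f x v = (2 * Real.pi * Complex.I : ℂ)⁻¹ •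
      ∮ w in C(0, r), ((w - 0) ^ 2)⁻¹ • f (x + w • v) := by
    intro x hx
    have hxd : DifferentiableAt ℂ f x := hd x (hsub (ball_subset_ball (by linarith) hx))
    have e : deriv (fun ζ : ℂ ↦ f (x + ζ • v)) 0 = fderiv ℂ f x v := by
      have h1 : HasDerivAt (fun ζ : ℂ ↦ x + ζ • v) v 0 := by
        simpa using ((hasDerivAt_id (0 : ℂ)).smul_const v).const_add x
      have h2 : HasFDerivAt f (fderiv ℂ f x) (x + (0 : ℂ) • v) := by simpa using hxd.hasFDerivAt
      exact (h2.comp_hasDerivAt 0 h1).deriv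
    rw [← e, ← Complex.cderiv_eq_deriv (U := (fun ζ : ℂ ↦ x + ζ • v) ⁻¹' U)
      (hU.preimage (by fun_prop)) (fun ζ hζ ↦ ?_) hr fun ζ hζ ↦ ?_]
    · rfl
    · exact ((hd _ hζ).comp ζ (by fun_prop)).differentiableWithinAt
    · exact hsub (ball_subset_ball (by linarith) (hmem x hx ζ hζ))
  have hev : (fun x ↦ fderiv ℂ f x v) =ᶠ[𝓝 x₀] fun x ↦ (2 * Real.pi * Complex.I : ℂ)⁻¹ •
      ∮ w in C(0, r), ((w - 0) ^ 2)⁻¹ • f (x + w • v) := by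
    filter_upwards [ball_mem_nhds x₀ hR] with x hx using hcauchy x hx
  refine DifferentiableAt.congr_of_eventuallyEq ?_ hev
  suffices h : DifferentiableAt ℂ
      (fun x ↦ ∮ w in C(0, r), ((w - 0) ^ 2)⁻¹ • f (x + w • v)) x₀ from
    h.const_smul ((2 * Real.pi * Complex.I : ℂ)⁻¹)
  simp only [circleIntegral, intervalIntegral.integral_of_le Real.two_pi_pos.le]
  set c : ℝ → ℂ := fun θ ↦ deriv (circleMap 0 r) θ * ((circleMap 0 r θ - 0) ^ 2)⁻¹ with hc
  have hcc : Continuous c := by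
    have hne : ∀ θ, (circleMap 0 r θ - 0) ^ 2 ≠ 0 := fun θ ↦
      pow_ne_zero _ (sub_ne_zero.2 (circleMap_ne_center hr.ne'))
    simp only [hc, deriv_circleMap]
    exact ((continuous_circleMap 0 r).mul continuous_const).mul
      ((((continuous_circleMap 0 r).sub continuous_const).pow 2).inv₀ hne)
  have hcirc : ∀ θ, circleMap 0 r θ ∈ closedBall (0 : ℂ) r := fun θ ↦
    circleMap_mem_closedBall 0 hr.le θ
  have hFc : ∀ x ∈ ball x₀ R, Continuous fun θ ↦ deriv (circleMap 0 r) θ •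
      ((circleMap 0 r θ - 0) ^ 2)⁻¹ • f (x + circleMap 0 r θ • v) := by
    intro x hx
    have h1 : Continuous fun θ ↦ f (x + circleMap 0 r θ • v) := by
      refine continuous_iff_continuousAt.2 fun θ ↦ ?_
      refine ContinuousAt.comp (g := f) (hd _ (hsub (ball_subset_ball (by linarith)
        (hmem x hx _ (hcirc θ))))).continuousAt (Continuous.continuousAt ?_)
      exact continuous_const.add ((continuous_circleMap 0 r).smul continuous_const)
    simp only [smul_smul]
    exact hcc.smul h1
  borelize F
  -- With a Lipschitz bound, the derivative of the integrand is needed at `x₀` only, and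
  -- measurability of `fderiv ℂ f` suffices; its continuity is not yet known.
  have key := hasFDerivAt_integral_of_dominated_loc_of_lip (𝕜 := ℂ)
    (μ := volume.restrict (Set.Ioc 0 (2 * Real.pi))) (x₀ := x₀) (s := ball x₀ R)
    (F := fun x θ ↦ deriv (circleMap 0 r) θ •
      ((circleMap 0 r θ - 0) ^ 2)⁻¹ • f (x + circleMap 0 r θ • v))
    (F' := fun θ ↦ c θ • fderiv ℂ f (x₀ + circleMap 0 r θ • v)) (bound := fun θ ↦ ‖c θ‖ * (2 / R))
    (ball_mem_nhds x₀ hR) ?_ ?_ ?_ ?_ ?_ ?_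
  · exact key.2.differentiableAt
  · filter_upwards [ball_mem_nhds x₀ hR] with x hx using (hFc x hx).aestronglyMeasurable
  · exact (hFc x₀ (mem_ball_self hR)).integrableOn_Ioc
  · refine (hcc.aestronglyMeasurable).smul ?_
    refine Measurable.aestronglyMeasurable ?_
    refine (measurable_fderiv ℂ f).comp (Continuous.measurable ?_)
    exact continuous_const.add ((continuous_circleMap 0 r).smul continuous_const)
  · refine ae_of_all _ fun θ ↦ ?_
    refine LipschitzOnWith.of_dist_le_mul fun x hx z hz ↦ ?_
    have := hlip _ (hmem z hz _ (hcirc θ)) _ (hmem x hx _ (hcirc θ))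
    have e : x + circleMap 0 r θ • v - (z + circleMap 0 r θ • v) = x - z := by abel
    rw [e] at this
    rw [dist_eq_norm, dist_eq_norm, smul_smul, smul_smul, ← smul_sub, norm_smul,
      Real.coe_nnabs, abs_of_nonneg (by positivity)]
    calc _ ≤ ‖c θ‖ * (2 / R * ‖x - z‖) := mul_le_mul_of_nonneg_left this (norm_nonneg _)
      _ = _ := by ring
  · exact (hcc.norm.mul continuous_const).integrableOn_Ioc
  · refine ae_of_all _ fun θ ↦ ?_
    have h1 : HasFDerivAt f (fderiv ℂ f (x₀ + circleMap 0 r θ • v)) (x₀ + circleMap 0 r θ • v) :=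
      (hd _ (hsub (ball_subset_ball (by linarith)
        (hmem x₀ (mem_ball_self hR) _ (hcirc θ))))).hasFDerivAt
    have h2 : HasFDerivAt (fun x ↦ f (x + circleMap 0 r θ • v))
        (fderiv ℂ f (x₀ + circleMap 0 r θ • v)) x₀ := by
      exact h1.comp x₀ ((hasFDerivAt_id x₀).add_const (circleMap 0 r θ • v))
    simp only [smul_smul]
    exact h2.const_smul (c θ)

/-- A holomorphic function of several variables is smooth. -/
theorem contDiffOn_of_differentiableOn_complex {U : Set F} (hU : IsOpen U) (n : ℕ) :
    ∀ {f : F → ℂ}, DifferentiableOn ℂ f U → ContDiffOn ℂ n f U := by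
  induction n with
  | zero => exact fun hf ↦ contDiffOn_zero.2 hf.continuousOn
  | succ n ih =>
    intro f hf
    rw [Nat.cast_succ, contDiffOn_succ_iff_fderiv_of_isOpen hU]
    refine ⟨hf, by simp, contDiffOn_clm_apply.2 fun v ↦ ih (differentiableOn_fderiv_apply hU hf v)⟩

end Holomorphic

/-! ### Smooth matrix valued functions -/

section SmoothMatrix

variable {E' : Type*} [NormedAddCommGroup E'] [NormedSpace ℝ E']
  {N : Type*} [TopologicalSpace N] [ChartedSpace E' N] {𝕜 : Type*} [RCLike 𝕜]
  {n : Type*} [Fintype n] [DecidableEq n]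

theorem contDiff_det : ContDiff ℝ ∞ (fun A : n → n → 𝕜 ↦ (Matrix.of A).det) := by
  simp only [Matrix.det_apply, Units.smul_def, Matrix.of_apply]
  refine ContDiff.sum fun g _ ↦ ContDiff.const_smul _ ?_
  exact contDiff_prod fun i _ ↦ contDiff_apply_apply ℝ 𝕜 (g i) i

theorem contMDiffAt_fun_mul {f g : N → 𝕜} {y : N} (hf : ContMDiffAt 𝓘(ℝ, E') 𝓘(ℝ, 𝕜) ∞ f y)
    (hg : ContMDiffAt 𝓘(ℝ, E') 𝓘(ℝ, 𝕜) ∞ g y) :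
    ContMDiffAt 𝓘(ℝ, E') 𝓘(ℝ, 𝕜) ∞ (fun z ↦ f z * g z) y :=
  (contDiff_mul (𝕜 := ℝ) (𝔸 := 𝕜) (n := ∞)).contMDiff.contMDiffAt.comp y (hf.prodMk_space hg)

theorem contMDiffAt_fun_sum {G : Type*} [NormedAddCommGroup G] [NormedSpace ℝ G] {ι : Type*}
    {t : Finset ι} {g : ι → N → G} {y : N}
    (hg : ∀ i ∈ t, ContMDiffAt 𝓘(ℝ, E') 𝓘(ℝ, G) ∞ (g i) y) :
    ContMDiffAt 𝓘(ℝ, E') 𝓘(ℝ, G) ∞ (fun z ↦ ∑ i ∈ t, g i z) y :=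
  contMDiffAt_finsetSum hg

theorem contMDiffAt_det {A : N → Matrix n n 𝕜} {y : N}
    (hA : ∀ i j, ContMDiffAt 𝓘(ℝ, E') 𝓘(ℝ, 𝕜) ∞ (fun z ↦ A z i j) y) :
    ContMDiffAt 𝓘(ℝ, E') 𝓘(ℝ, 𝕜) ∞ (fun z ↦ (A z).det) y :=
  (contDiff_det (𝕜 := 𝕜) (n := n)).contMDiff.contMDiffAt.comp y
    (contMDiffAt_pi_space.2 fun i ↦ contMDiffAt_pi_space.2 fun j ↦ hA i j)

theorem contMDiffAt_matrix_inv {A : N → Matrix n n 𝕜} {y : N}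
    (hA : ∀ i j, ContMDiffAt 𝓘(ℝ, E') 𝓘(ℝ, 𝕜) ∞ (fun z ↦ A z i j) y) (h : (A y).det ≠ 0) (i j : n) :
    ContMDiffAt 𝓘(ℝ, E') 𝓘(ℝ, 𝕜) ∞ (fun z ↦ (A z)⁻¹ i j) y := by
  simp only [Matrix.inv_def, Matrix.smul_apply, smul_eq_mul, Ring.inverse_eq_inv,
    Matrix.adjugate_apply]
  refine contMDiffAt_fun_mul ?_ (contMDiffAt_det fun k l ↦ ?_)
  · exact ((contDiffAt_inv ℝ h).contMDiffAt (n := ∞)).comp y (contMDiffAt_det hA)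
  · by_cases hk : k = j
    · subst hk
      simp only [Matrix.updateRow_self]
      exact contMDiffAt_const
    · simp only [Matrix.updateRow_ne hk]
      exact hA k l

theorem eventually_det_ne_zero {A : N → Matrix n n 𝕜} {y : N}
    (hA : ∀ i j, ContMDiffAt 𝓘(ℝ, E') 𝓘(ℝ, 𝕜) ∞ (fun z ↦ A z i j) y) (h : (A y).det ≠ 0) :
    ∀ᶠ z in 𝓝 y, (A z).det ≠ 0 :=
  (contMDiffAt_det hA).continuousAt.eventually_ne h

end SmoothMatrix

/-! ### The complex structure of `Z` in charts, and holomorphic functions -/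

section ComplexManifold

variable {F : Type*} [NormedAddCommGroup F] [NormedSpace ℂ F] [FiniteDimensional ℂ F]
  {Z : Type*} [TopologicalSpace Z] [ChartedSpace F Z] [IsManifold 𝓘(ℂ, F) ω Z]

theorem differentiableAt_coordChange {x z : Z} (hz : z ∈ (chartAt F x).source) :
    DifferentiableAt ℂ ((chartAt F x) ∘ (chartAt F z).symm) (chartAt F z z) := by
  have h := contDiffWithinAt_ext_coord_change (I := 𝓘(ℂ, F)) (n := ω) x z
    (y := extChartAt 𝓘(ℂ, F) z z) (by simp [hz])
  simp only [mfld_simps, contDiffWithinAt_univ] at h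
  exact h.differentiableAt (by simp)

/-- `mulI z` is defined by the chart at `z` alone. The transition maps are holomorphic, so it is
multiplication by `I` in every chart; this is what makes `mulI` preserve smoothness of sections. -/
theorem continuousLinearMapAt_mulI {x z : Z} (hz : z ∈ (chartAt F x).source)
    (v : TangentSpace 𝓘(ℝ, F) z) :
    (trivializationAt F (TangentSpace 𝓘(ℝ, F) : Z → Type _) x).continuousLinearMapAt ℝ z (mulI z v) =
      Complex.I • (trivializationAt F (TangentSpace 𝓘(ℝ, F) : Z → Type _) x).continuousLinearMapAt
        ℝ z v := by
  rw [TangentBundle.continuousLinearMapAt_trivializationAt_eq_core hz]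
  have e : ((tangentBundleCore 𝓘(ℝ, F) Z).coordChange (achart F z) (achart F x) z : F →L[ℝ] F) =
      (fderiv ℂ ((chartAt F x) ∘ (chartAt F z).symm) (chartAt F z z)).restrictScalars ℝ := by
    rw [tangentBundleCore_coordChange, ← (differentiableAt_coordChange hz).fderiv_restrictScalars ℝ]
    simp
  rw [e]
  exact (fderiv ℂ ((chartAt F x) ∘ (chartAt F z).symm) (chartAt F z z)).map_smul Complex.I (v : F)

variable {E' : Type*} [NormedAddCommGroup E'] [NormedSpace ℝ E'] [FiniteDimensional ℝ E']
  {N : Type*} [TopologicalSpace N] [ChartedSpace E' N] [IsManifold 𝓘(ℝ, E') ∞ N]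

theorem SmoothSecAt.mulI {φ : N → Z} {s : Π y : N, TangentSpace 𝓘(ℝ, F) (φ y)} {y : N}
    (hs : SmoothSecAt (E' := E') φ s y) :
    SmoothSecAt (E' := E') φ (fun z ↦ mulI (φ z) (s z)) y := by
  have : FiniteDimensional ℝ F := FiniteDimensional.complexToReal F
  have hx := mem_chart_source F (φ y)
  have hb := hs.base
  rw [smoothSecAt_iff hx] at hs ⊢
  refine ⟨hs.1, ?_⟩
  have h := (contDiff_const_smul (𝕜 := ℝ) (n := ∞) (F := F) Complex.I).contMDiff.contMDiffAt.comp y hs.2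
  refine h.congr_of_eventuallyEq ?_
  filter_upwards [hb.continuousAt.eventually ((chartAt F (φ y)).open_source.mem_nhds hx)] with z hz
  exact continuousLinearMapAt_mulI hz (s z)

/-- Parallelism of the complex structure is given for vector fields on `Z`; expansion in a frame of
`TZ` carries it over to sections along `φ`. -/
theorem pullbackCov_mulI [RiemannianBundle (fun z : Z ↦ TangentSpace 𝓘(ℝ, F) z)]
    {cov : AffineConnection F Z} (hcov : IsKahler cov)
    {φ : N → Z} {s : Π y : N, TangentSpace 𝓘(ℝ, F) (φ y)} {y : N}
    (hs : SmoothSecAt (E' := E') φ s y) (a : TangentSpace 𝓘(ℝ, E') y) :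
    pullbackCov cov φ (fun z ↦ mulI (φ z) (s z)) y a = mulI (φ y) (pullbackCov cov φ s y a) := by
  have : FiniteDimensional ℝ F := FiniteDimensional.complexToReal F
  have hx := mem_chart_source F (φ y)
  have h1 : ∀ j, SmoothFieldAt (frameAt (φ y) j) (φ y) := smoothFieldAt_frameAt hx
  have h1I : ∀ j, SmoothFieldAt (fun z ↦ mulI z (frameAt (φ y) j z)) (φ y) := fun j ↦
    SmoothSecAt.mulI (φ := (id : Z → Z)) (h1 j)
  have h2 := fun j ↦ hs.coefAt hx j
  have h2d := fun j ↦ (h2 j).mdifferentiableAt (n := ∞) (by simp)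
  have hfd := hs.base.mdifferentiableAt (n := ∞) (by simp)
  have e : ∀ᶠ z in 𝓝 y, mulI (φ z) (s z) = ∑ j, coefAt (φ y) j (φ z) (s z) •
      mulI (φ z) (frameAt (φ y) j (φ z)) := by
    filter_upwards [hs.eventually_eq_sum hx] with z hz
    conv_lhs => rw [hz]
    simp
  rw [pullbackCov_congr cov e, pullbackCov_sum cov _ hs.base
    (fun j _ ↦ ((h1I j).comp hs.base).smul (h2 j)), pullbackCov_eq_sum cov hs hx, sum_apply, map_sum]
  refine Finset.sum_congr rfl fun j _ ↦ ?_
  rw [pullbackCov_smul cov (h2d j) ((h1I j).comp hs.base).diff, pullbackCov_comp cov (h1I j).diff hfd,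
    hcov.parallel _ _ _ (h1 j)]
  simp

end ComplexManifold

section HolomorphicFunction

variable {F : Type*} [NormedAddCommGroup F] [NormedSpace ℂ F] [FiniteDimensional ℂ F]
  {Z : Type*} [TopologicalSpace Z] [ChartedSpace F Z] [IsManifold 𝓘(ℂ, F) ω Z]

theorem holomorphic_chart {W : Set Z} (hW : IsOpen W) {f : Z → ℂ}
    (hf : MDifferentiableOn 𝓘(ℂ, F) 𝓘(ℂ, ℂ) f W) {z : Z} (hz : z ∈ W) :
    DifferentiableAt ℂ (f ∘ (chartAt F z).symm) (chartAt F z z) ∧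
      ContDiffAt ℝ ∞ (f ∘ (chartAt F z).symm) (chartAt F z z) := by
  set U := (chartAt F z).target ∩ (chartAt F z).symm ⁻¹' W with hUdef
  have hU : IsOpen U := (chartAt F z).isOpen_inter_preimage_symm hW
  have hzU : chartAt F z z ∈ U := ⟨mem_chart_target F z, by simpa using hz⟩
  have hd : DifferentiableOn ℂ (f ∘ (chartAt F z).symm) U := fun u hu ↦ by
    refine DifferentiableAt.differentiableWithinAt ?_
    rw [← mdifferentiableAt_iff_differentiableAt]
    refine MDifferentiableAt.comp u (hf.mdifferentiableAt (hW.mem_nhds hu.2)) ?_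
    have := (contMDiffOn_chart_symm (I := 𝓘(ℂ, F)) (n := ω) (x := z)).mdifferentiableOn (by simp)
    exact this.mdifferentiableAt ((chartAt F z).open_target.mem_nhds hu.1)
  refine ⟨hd.differentiableAt (hU.mem_nhds hzU), contDiffAt_infty.2 fun n ↦ ?_⟩
  exact ((contDiffOn_of_differentiableOn_complex hU n hd).contDiffAt (hU.mem_nhds hzU)).restrict_scalars ℝ

theorem contMDiffAt_of_holomorphic {W : Set Z} (hW : IsOpen W) {f : Z → ℂ}
    (hf : MDifferentiableOn 𝓘(ℂ, F) 𝓘(ℂ, ℂ) f W) {z : Z} (hz : z ∈ W) :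
    ContMDiffAt 𝓘(ℝ, F) 𝓘(ℝ, ℂ) ∞ f z := by
  have h := (holomorphic_chart hW hf hz).2.contMDiffAt.comp z
    (contMDiffAt_extChartAt (I := 𝓘(ℝ, F)) (n := ∞) (x := z))
  refine h.congr_of_eventuallyEq ?_
  filter_upwards [(chartAt F z).open_source.mem_nhds (mem_chart_source F z)] with u hu
  simp [hu]

theorem mvfderiv_mulI_of_holomorphic {W : Set Z} (hW : IsOpen W) {f : Z → ℂ}
    (hf : MDifferentiableOn 𝓘(ℂ, F) 𝓘(ℂ, ℂ) f W) {z : Z} (hz : z ∈ W)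
    (u : TangentSpace 𝓘(ℝ, F) z) :
    mvfderiv 𝓘(ℝ, F) f z (mulI z u) = Complex.I * mvfderiv 𝓘(ℝ, F) f z u := by
  have e : ∀ v : TangentSpace 𝓘(ℝ, F) z, mvfderiv 𝓘(ℝ, F) f z v =
      fderiv ℂ (f ∘ (chartAt F z).symm) (chartAt F z z) v := by
    intro v
    have h1 := (contMDiffAt_of_holomorphic hW hf hz).mdifferentiableAt (by simp)
    have h2 := (holomorphic_chart hW hf hz).1.fderiv_restrictScalars ℝ
    have h3 : mvfderiv 𝓘(ℝ, F) f z v = fderiv ℝ (f ∘ (chartAt F z).symm) (chartAt F z z) v := by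
      simp only [mvfderiv, mfderiv, h1]
      simp
      rfl
    rw [h3, h2]
    rfl
  rw [e, e]
  exact (fderiv ℂ (f ∘ (chartAt F z).symm) (chartAt F z z)).map_smul Complex.I (u : F)

end HolomorphicFunction

/-! ### Smoothness of horizontal lifts -/

section HorizontalLift

variable {E : Type*} [NormedAddCommGroup E] [NormedSpace ℝ E] [FiniteDimensional ℝ E]
  {M : Type*} [TopologicalSpace M] [ChartedSpace E M] [IsManifold 𝓘(ℝ, E) ∞ M]
  {E' : Type*} [NormedAddCommGroup E'] [NormedSpace ℝ E'] [FiniteDimensional ℝ E']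
  {N : Type*} [TopologicalSpace N] [ChartedSpace E' N] [IsManifold 𝓘(ℝ, E') ∞ N]
  [RiemannianBundle (fun y : N ↦ TangentSpace 𝓘(ℝ, E') y)]
  [IsContMDiffRiemannianBundle 𝓘(ℝ, E') ∞ E' (fun y : N ↦ TangentSpace 𝓘(ℝ, E') y)]

theorem linearIndependent_frameAt {x₀ x : M} (hx : x ∈ (chartAt E x₀).source) :
    LinearIndependent ℝ (fun j ↦ frameAt (E := E) x₀ j x) := by
  refine Fintype.linearIndependent_iff.2 fun c hc i ↦ ?_
  have := congrArg (coefAt x₀ i x) hc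
  simpa [coefAt_frameAt hx] using this

theorem det_gram_ne_zero {V : Type*} [NormedAddCommGroup V] [InnerProductSpace ℝ V] {n : Type*}
    [Fintype n] [DecidableEq n] {v : n → V} (hv : LinearIndependent ℝ v) :
    (Matrix.of fun i j ↦ inner ℝ (v i) (v j)).det ≠ 0 :=
  (Matrix.posDef_gram_of_linearIndependent hv).det_pos.ne'

/-- A vector field is smooth if its inner products with the fields of a local frame are smooth. -/
theorem smoothFieldAt_of_inner {X : Π y : N, TangentSpace 𝓘(ℝ, E') y} {y : N}
    (h : ∀ j, ContMDiffAt 𝓘(ℝ, E') 𝓘(ℝ, ℝ) ∞ (fun z ↦ inner ℝ (frameAt y j z) (X z)) y) :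
    SmoothFieldAt X y := by
  have hx := mem_chart_source E' y
  set A : N → Matrix (Fin (Module.finrank ℝ E')) (Fin (Module.finrank ℝ E')) ℝ := fun z ↦
    Matrix.of fun i j ↦ inner ℝ (frameAt y i z) (frameAt y j z) with hAdef
  have hA : ∀ i j, ContMDiffAt 𝓘(ℝ, E') 𝓘(ℝ, ℝ) ∞ (fun z ↦ A z i j) y := fun i j ↦
    SmoothSecAt.inner (f := (id : N → N)) (smoothFieldAt_frameAt hx i) (smoothFieldAt_frameAt hx j)
  have hdet : ∀ z ∈ (chartAt E' y).source, (A z).det ≠ 0 := fun z hz ↦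
    det_gram_ne_zero (linearIndependent_frameAt hz)
  -- The components of `X` are recovered from its inner products with the frame through the inverse
  -- Gram matrix, which is smooth by Cramer's rule.
  have hs : SmoothFieldAt (fun z ↦ ∑ i, (∑ j, (A z)⁻¹ i j * inner ℝ (frameAt y j z) (X z)) •
      frameAt y i z) y := by
    refine SmoothSecAt.sum (f := (id : N → N)) _ contMDiffAt_id fun i _ ↦
      SmoothSecAt.smul (f := (id : N → N)) ?_ (smoothFieldAt_frameAt hx i)
    exact contMDiffAt_fun_sum fun j _ ↦
      contMDiffAt_fun_mul (contMDiffAt_matrix_inv hA (hdet y hx) i j) (h j)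
  refine SmoothSecAt.congr (f := (id : N → N)) hs ?_
  filter_upwards [(chartAt E' y).open_source.mem_nhds hx] with z hz
  conv_lhs => rw [← sum_coefAt_smul_frameAt hz (X z)]
  refine Finset.sum_congr rfl fun i _ ↦ ?_
  congr 1
  have e : (fun j ↦ inner ℝ (frameAt y j z) (X z)) = (A z).mulVec fun i ↦ coefAt y i z (X z) := by
    funext j
    conv_lhs => rw [← sum_coefAt_smul_frameAt hz (X z), inner_sum]
    simp only [Matrix.mulVec, dotProduct, hAdef, Matrix.of_apply, inner_smul_right]
    exact Finset.sum_congr rfl fun i _ ↦ mul_comm _ _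
  have e2 : ∑ j, (A z)⁻¹ i j * inner ℝ (frameAt y j z) (X z) =
      ((A z)⁻¹.mulVec ((A z).mulVec fun i ↦ coefAt y i z (X z))) i := by
    rw [← e]
    rfl
  rw [e2, Matrix.mulVec_mulVec, Matrix.nonsing_inv_mul _ (hdet z hz).isUnit, Matrix.one_mulVec]

variable {f : N → M}

theorem horizontalLift_spec {y : N} (hf : Function.Surjective (mfderiv 𝓘(ℝ, E') 𝓘(ℝ, E) f y))
    (w : TangentSpace 𝓘(ℝ, E) (f y)) :
    horizontalLift (E' := E') f y w ∈ (vert E E' f y)ᗮ ∧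
      mfderiv 𝓘(ℝ, E') 𝓘(ℝ, E) f y (horizontalLift (E' := E') f y w) = w := by
  have h : ∃ u ∈ (vert E E' f y)ᗮ, mfderiv 𝓘(ℝ, E') 𝓘(ℝ, E) f y u = w := by
    obtain ⟨u, hu⟩ := hf w
    refine ⟨u - (vert E E' f y).starProjection u, Submodule.sub_starProjection_mem_orthogonal u, ?_⟩
    have : mfderiv 𝓘(ℝ, E') 𝓘(ℝ, E) f y ((vert E E' f y).starProjection u) = 0 :=
      Submodule.starProjection_apply_mem (vert E E' f y) u
    rw [map_sub, this, sub_zero, hu]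
  rw [horizontalLift, dif_pos h]
  exact h.choose_spec

theorem eq_horizontalLift {y : N} {u : TangentSpace 𝓘(ℝ, E') y} (hu : u ∈ (vert E E' f y)ᗮ) 
    {w : TangentSpace 𝓘(ℝ, E) (f y)} (h : mfderiv 𝓘(ℝ, E') 𝓘(ℝ, E) f y u = w) :
    u = horizontalLift (E' := E') f y w := by
  have h' : ∃ u ∈ (vert E E' f y)ᗮ, mfderiv 𝓘(ℝ, E') 𝓘(ℝ, E) f y u = w := ⟨u, hu, h⟩
  have hs : horizontalLift (E' := E') f y w ∈ (vert E E' f y)ᗮ ∧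
      mfderiv 𝓘(ℝ, E') 𝓘(ℝ, E) f y (horizontalLift (E' := E') f y w) = w := by
    rw [horizontalLift, dif_pos h']
    exact h'.choose_spec
  have h1 : u - horizontalLift (E' := E') f y w ∈ vert E E' f y := by
    have : mfderiv 𝓘(ℝ, E') 𝓘(ℝ, E) f y (u - horizontalLift (E' := E') f y w) = 0 := by
      rw [map_sub, h, hs.2, sub_self]
    exact this
  have h2 := Submodule.sub_mem _ hu hs.1
  exact sub_eq_zero.1 (inner_self_eq_zero.1 (Submodule.inner_right_of_mem_orthogonal h1 h2))

/-- The horizontal lift of a smooth section is smooth. -/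
theorem smoothFieldAt_horizontalLift {w : Π y : N, TangentSpace 𝓘(ℝ, E) (f y)} {y : N}
    (hf : ∀ y, Function.Surjective (mfderiv 𝓘(ℝ, E') 𝓘(ℝ, E) f y))
    (hw : SmoothSecAt (E' := E') f w y) :
    SmoothFieldAt (fun z ↦ horizontalLift (E' := E') f z (w z)) y := by
  have hx := mem_chart_source E (f y)
  have hx' := mem_chart_source E' y
  have hcomp : ∀ z : N, CompleteSpace (TangentSpace 𝓘(ℝ, E') z) := fun z ↦
    FiniteDimensional.complete ℝ _
  set α : Fin (Module.finrank ℝ E) → Π z : N, TangentSpace 𝓘(ℝ, E') z →L[ℝ] ℝ := fun k z ↦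
    coefAt (f y) k (f z) ∘L mfderiv 𝓘(ℝ, E') 𝓘(ℝ, E) f z with hα
  -- The fields `g k` represent the components of `df` through the metric. They are orthogonal to
  -- the fibres and independent at `y`, so near `y` the lift is the combination of them whose
  -- coefficients come from the inverse Gram matrix.
  set g : Fin (Module.finrank ℝ E) → Π z : N, TangentSpace 𝓘(ℝ, E') z := fun k z ↦
    (InnerProductSpace.toDual ℝ (TangentSpace 𝓘(ℝ, E') z)).symm (α k z) with hg
  have hgα : ∀ k z (u : TangentSpace 𝓘(ℝ, E') z), inner ℝ (g k z) u = α k z u := fun k z u ↦ by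
    simp [hg]
  have hgs : ∀ k, SmoothFieldAt (g k) y := by
    intro k
    refine smoothFieldAt_of_inner fun j ↦ ?_
    have := ((smoothFieldAt_frameAt hx' j).mfderiv_apply hw.base).coefAt hx k
    refine this.congr_of_eventuallyEq (Eventually.of_forall fun z ↦ ?_)
    exact (real_inner_comm _ _).trans (hgα k z _)
  have hgo : ∀ k z, g k z ∈ (vert E E' f z)ᗮ := by
    intro k z
    refine (Submodule.mem_orthogonal' _ _).2 fun u hu ↦ ?_
    have : mfderiv 𝓘(ℝ, E') 𝓘(ℝ, E) f z u = 0 := hu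
    rw [hgα, hα]
    simp [this]
  have hgi : LinearIndependent ℝ (fun k ↦ g k y) := by
    refine Fintype.linearIndependent_iff.2 fun c hc i ↦ ?_
    obtain ⟨u, hu⟩ := hf y (frameAt (f y) i (f y))
    have h1 := congrArg (fun v ↦ inner ℝ v u) hc
    simp only [sum_inner, inner_smul_left, hgα, hα, ContinuousLinearMap.comp_apply, hu,
      coefAt_frameAt hx] at h1
    simpa using h1
  set A : N → Matrix (Fin (Module.finrank ℝ E)) (Fin (Module.finrank ℝ E)) ℝ := fun z ↦
    Matrix.of fun i j ↦ inner ℝ (g i z) (g j z) with hAdef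
  have hA : ∀ i j, ContMDiffAt 𝓘(ℝ, E') 𝓘(ℝ, ℝ) ∞ (fun z ↦ A z i j) y := fun i j ↦
    SmoothSecAt.inner (f := (id : N → N)) (hgs i) (hgs j)
  have hdet : (A y).det ≠ 0 := det_gram_ne_zero hgi
  have hs : SmoothFieldAt (fun z ↦ ∑ i, (∑ j, (A z)⁻¹ i j * coefAt (f y) j (f z) (w z)) •
      g i z) y := by
    refine SmoothSecAt.sum (f := (id : N → N)) _ contMDiffAt_id fun i _ ↦
      SmoothSecAt.smul (f := (id : N → N)) ?_ (hgs i)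
    exact contMDiffAt_fun_sum fun j _ ↦
      contMDiffAt_fun_mul (contMDiffAt_matrix_inv hA hdet i j) (hw.coefAt hx j)
  refine SmoothSecAt.congr (f := (id : N → N)) hs ?_
  filter_upwards [eventually_det_ne_zero hA hdet,
    hw.base.continuousAt.eventually ((chartAt E (f y)).open_source.mem_nhds hx)] with z hz hz'
  symm
  refine eq_horizontalLift (Submodule.sum_mem _ fun i _ ↦ Submodule.smul_mem _ _ (hgo i z)) ?_
  refine Eq.trans (Eq.symm (sum_coefAt_smul_frameAt hz' _)) (Eq.trans ?_
    (sum_coefAt_smul_frameAt hz' (w z)))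
  refine Finset.sum_congr rfl fun l _ ↦ ?_
  congr 1
  have e : ∀ u : TangentSpace 𝓘(ℝ, E') z, coefAt (f y) l (f z)
      (mfderiv 𝓘(ℝ, E') 𝓘(ℝ, E) f z u) = inner ℝ (g l z) u := fun u ↦ (hgα l z u).symm
  rw [e, inner_sum]
  have e2 : ∑ i, inner ℝ (g l z) ((∑ j, (A z)⁻¹ i j * coefAt (f y) j (f z) (w z)) • g i z) =
      ((A z).mulVec ((A z)⁻¹.mulVec fun j ↦ coefAt (f y) j (f z) (w z))) l := by
    simp only [Matrix.mulVec, dotProduct, hAdef, Matrix.of_apply, inner_smul_right]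
    exact Finset.sum_congr rfl fun i _ ↦ mul_comm _ _
  rw [e2, Matrix.mulVec_mulVec, Matrix.mul_nonsing_inv _ hz.isUnit, Matrix.one_mulVec]

end HorizontalLift

/-! ### Real and imaginary parts in a complexification -/

section Complexification

variable {V : Type*} [AddCommGroup V] [Module ℝ V] {U : Type*} [AddCommGroup U] [Module ℝ U]

@[simp] theorem rePart_incl (u : V) : rePart V (incl V u) = u := by simp [rePart, incl]

@[simp] theorem imPart_incl (u : V) : imPart V (incl V u) = 0 := by simp [imPart, incl]

@[simp] theorem rePart_inclI (u : V) : rePart V (inclI V u) = 0 := by simp [rePart, inclI]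

@[simp] theorem imPart_inclI (u : V) : imPart V (inclI V u) = u := by simp [imPart, inclI]

theorem I_smul_incl (u : V) : Complex.I • incl V u = inclI V u := by
  simp [incl, inclI, TensorProduct.smul_tmul']

theorem I_smul_inclI (u : V) : Complex.I • inclI V u = - incl V u := by
  simp [incl, inclI, TensorProduct.smul_tmul', TensorProduct.neg_tmul]

theorem incl_rePart_add_inclI_imPart (a : ℂ ⊗[ℝ] V) :
    incl V (rePart V a) + inclI V (imPart V a) = a := by
  induction a using TensorProduct.induction_on with
  | zero => simp
  | tmul z v =>
    simp only [rePart, imPart, incl, inclI, LinearMap.comp_apply, LinearMap.rTensor_tmul,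
      LinearEquiv.coe_coe, TensorProduct.lid_tmul, TensorProduct.mk_apply, TensorProduct.tmul_smul,
      TensorProduct.smul_tmul', ← TensorProduct.add_tmul]
    congr 1
    apply Complex.ext <;> simp
  | add a b ha hb =>
    conv_rhs => rw [← ha, ← hb]
    simp only [map_add]
    abel

theorem smul_incl_add_inclI (z : ℂ) (u v : V) : z • (incl V u + inclI V v) =
    incl V (z.re • u - z.im • v) + inclI V (z.re • v + z.im • u) := by
  have hz : ∀ w : ℂ ⊗[ℝ] V, z • w = z.re • w + z.im • (Complex.I • w) := fun w ↦ by
    conv_lhs => rw [← Complex.re_add_im z, add_smul, mul_smul]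
    rw [Complex.coe_smul, Complex.coe_smul]
    rfl
  rw [hz, smul_add Complex.I, I_smul_incl, I_smul_inclI]
  simp only [map_sub, map_add, map_smul, smul_add, smul_neg]
  abel

theorem mem_baseChange_iff {S : Submodule ℝ V} {a : ℂ ⊗[ℝ] V} :
    a ∈ S.baseChange ℂ ↔ rePart V a ∈ S ∧ imPart V a ∈ S := by
  constructor
  · intro ha
    rw [Submodule.baseChange_eq_span] at ha
    induction ha using Submodule.span_induction with
    | mem x hx =>
      obtain ⟨s, hs, rfl⟩ := hx
      exact ⟨by simpa [rePart] using hs, by simp [imPart]⟩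
    | zero => simp
    | add x y _ _ hx hy => simpa using ⟨S.add_mem hx.1 hy.1, S.add_mem hx.2 hy.2⟩
    | smul z x _ hx =>
      rw [← incl_rePart_add_inclI_imPart x, smul_incl_add_inclI]
      simpa using ⟨S.sub_mem (S.smul_mem _ hx.1) (S.smul_mem _ hx.2),
        S.add_mem (S.smul_mem _ hx.2) (S.smul_mem _ hx.1)⟩
  · intro h
    rw [← incl_rePart_add_inclI_imPart a]
    exact Submodule.add_mem _ (Submodule.tmul_mem_baseChange_of_mem _ h.1)
      (Submodule.tmul_mem_baseChange_of_mem _ h.2)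

@[simp] theorem baseChange_incl (f : V →ₗ[ℝ] U) (u : V) :
    f.baseChange ℂ (incl V u) = incl U (f u) := by simp [incl]

@[simp] theorem baseChange_inclI (f : V →ₗ[ℝ] U) (u : V) :
    f.baseChange ℂ (inclI V u) = inclI U (f u) := by simp [inclI]

end Complexification

/-! ### Linear algebra of a twistorial structure on one tangent space -/

theorem bilC_incl_add_inclI {V : Type*} [NormedAddCommGroup V] [InnerProductSpace ℝ V]
    (a b c d : V) : bilC (incl V a + inclI V b) (incl V c + inclI V d) =
      ((inner ℝ a c - inner ℝ b d : ℝ) : ℂ) + Complex.I * ((inner ℝ a d + inner ℝ b c : ℝ) : ℂ) := by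
  simp only [bilC, incl, inclI, TensorProduct.mk_apply, map_add, LinearMap.add_apply,
    LinearMap.BilinForm.baseChange_tmul, innerₗ_apply_apply]
  push_cast
  simp only [Algebra.smul_def, Complex.coe_algebraMap]
  linear_combination (-(inner ℝ b d : ℂ)) * (- Complex.I_mul_I)

/-- The data which a Riemannian twistorial structure, given by submersions `Y → M` and `Y → Z`,
induces on the tangent spaces: `A` and `φ` are the differentials of the submersions. -/
structure IsTwistorial {T U G : Type*} [NormedAddCommGroup T] [InnerProductSpace ℝ T]
    [NormedAddCommGroup U] [InnerProductSpace ℝ U] [AddCommGroup G] [Module ℝ G]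
    (A : T →ₗ[ℝ] U) (φ : T →ₗ[ℝ] G) (I : G →ₗ[ℝ] G) (σ : Submodule ℂ (ℂ ⊗[ℝ] U))
    (κ : Submodule ℂ (ℂ ⊗[ℝ] T)) : Prop where
  surj_left : Function.Surjective A
  surj_right : Function.Surjective φ
  isometric : ∀ a ∈ (LinearMap.ker A)ᗮ, ∀ b ∈ (LinearMap.ker A)ᗮ, inner ℝ (A a) (A b) = inner ℝ a b
  sq : ∀ g, I (I g) = - g
  mem_horiz : ∀ u, incl T u ∈ κ ↔ u ∈ (LinearMap.ker A)ᗮ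
  mem_coCR : ∀ u v, φ v = I (φ u) ↔ incl T u + inclI T v ∈
    ((LinearMap.ker A)ᗮ.baseChange ℂ ⊓ σ.comap (A.baseChange ℂ)) ⊔ ((LinearMap.ker A).baseChange ℂ ⊓ κ)
  complex_fibre : ∀ v ∈ LinearMap.ker A, ∃ w ∈ LinearMap.ker A, incl T w - inclI T v ∈ κ
  coisotropic : IsCoisotropic σ

namespace IsTwistorial

variable {T U G : Type*} [NormedAddCommGroup T] [InnerProductSpace ℝ T] [FiniteDimensional ℝ T]
    [NormedAddCommGroup U] [InnerProductSpace ℝ U] [AddCommGroup G] [Module ℝ G]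
    {A : T →ₗ[ℝ] U} {φ : T →ₗ[ℝ] G} {I : G →ₗ[ℝ] G} {σ : Submodule ℂ (ℂ ⊗[ℝ] U)}
    {κ : Submodule ℂ (ℂ ⊗[ℝ] T)}

theorem eq_zero_of_mem {u : T} (h1 : u ∈ LinearMap.ker A) (h2 : u ∈ (LinearMap.ker A)ᗮ) : u = 0 :=
  inner_self_eq_zero.1 (Submodule.inner_right_of_mem_orthogonal h1 h2)

/-- The two components of `u + iv` in `𝒞 = ℬ ⊕ (ker A)^{0,1}`, expressed through real vectors: `v₁ +
i v₂` is the vertical one. -/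
theorem exists_decomp (h : IsTwistorial A φ I σ κ) {u v : T} (huv : φ v = I (φ u)) :
    ∃ v₁ ∈ LinearMap.ker A, ∃ v₂ ∈ LinearMap.ker A, incl T v₁ + inclI T v₂ ∈ κ ∧
      u - v₁ ∈ (LinearMap.ker A)ᗮ ∧ v - v₂ ∈ (LinearMap.ker A)ᗮ ∧
      incl U (A (u - v₁)) + inclI U (A (v - v₂)) ∈ σ := by
  obtain ⟨b, hb, w, hw, hbw⟩ := Submodule.mem_sup.1 ((h.mem_coCR u v).1 huv)
  obtain ⟨hb1, hb2⟩ := hb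
  obtain ⟨hw1, hw2⟩ := hw
  have hb1 := mem_baseChange_iff.1 hb1
  have hw1 := mem_baseChange_iff.1 hw1
  have e : incl T (u - rePart T w) + inclI T (v - imPart T w) = b := by
    rw [map_sub, map_sub, ← add_sub_add_comm, incl_rePart_add_inclI_imPart, ← hbw, add_sub_cancel_right]
  rw [← e] at hb1 hb2
  simp only [map_add, rePart_incl, rePart_inclI, imPart_incl, imPart_inclI, add_zero, zero_add] at hb1
  refine ⟨rePart T w, hw1.1, imPart T w, hw1.2, ?_, hb1.1, hb1.2, ?_⟩
  · rwa [incl_rePart_add_inclI_imPart]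
  · simpa only [SetLike.mem_coe, Submodule.mem_comap, map_add, baseChange_incl, baseChange_inclI]
      using hb2

/-- For horizontal `u`, `v` the vertical component in `exists_decomp` vanishes. With the converse
`apply_eq_of_mem`, this translates between complex linearity of `φ` and membership in `σ`. -/
theorem mem_of_horiz (h : IsTwistorial A φ I σ κ) {u v : T} (hu : u ∈ (LinearMap.ker A)ᗮ)
    (hv : v ∈ (LinearMap.ker A)ᗮ) (huv : φ v = I (φ u)) : incl U (A u) + inclI U (A v) ∈ σ := by
  obtain ⟨v₁, h1, v₂, h2, -, h3, h4, h5⟩ := h.exists_decomp huv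
  have e1 : v₁ = 0 := eq_zero_of_mem h1 (by simpa using Submodule.sub_mem _ hu h3)
  have e2 : v₂ = 0 := eq_zero_of_mem h2 (by simpa using Submodule.sub_mem _ hv h4)
  simpa [e1, e2] using h5

theorem apply_eq_of_mem (h : IsTwistorial A φ I σ κ) {u v : T} (hu : u ∈ (LinearMap.ker A)ᗮ)
    (hv : v ∈ (LinearMap.ker A)ᗮ) (huv : incl U (A u) + inclI U (A v) ∈ σ) : φ v = I (φ u) := by
  rw [h.mem_coCR]
  refine Submodule.mem_sup_left ⟨mem_baseChange_iff.2 ?_, ?_⟩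
  · simpa using ⟨hu, hv⟩
  · simpa using huv

theorem eq_zero_of_mem_of_incl (h : IsTwistorial A φ I σ κ) {u : T} (h1 : u ∈ LinearMap.ker A)
    (h2 : incl T u ∈ κ) : u = 0 :=
  eq_zero_of_mem h1 ((h.mem_horiz u).1 h2)

/-- For `u` in `ker φ` the vector `u + i0` lies in `𝒞`. Its vertical component has no imaginary
part, so it is a real vertical vector in `κ`, hence also horizontal, hence zero. -/
theorem ker_le (h : IsTwistorial A φ I σ κ) : LinearMap.ker φ ≤ (LinearMap.ker A)ᗮ := by
  intro u hu
  have hu : φ u = 0 := hu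
  obtain ⟨v₁, h1, v₂, h2, h6, h3, h4, h5⟩ := h.exists_decomp (u := u) (v := 0) (by simp [hu])
  have e2 : v₂ = 0 := eq_zero_of_mem h2 (by simpa using h4)
  have e1 : v₁ = 0 := h.eq_zero_of_mem_of_incl h1 (by simpa [e2] using h6)
  simpa [e1] using h3

theorem ker_left_le (h : IsTwistorial A φ I σ κ) : LinearMap.ker A ≤ (LinearMap.ker φ)ᗮ := by
  intro v hv
  exact (Submodule.mem_orthogonal _ _).2 fun u hu ↦
    Submodule.inner_left_of_mem_orthogonal hv (h.ker_le hu)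

theorem injOn (u v : T) (hu : u ∈ (LinearMap.ker φ)ᗮ) (hv : v ∈ (LinearMap.ker φ)ᗮ)
    (huv : φ u = φ v) : u = v := by
  have h1 : u - v ∈ LinearMap.ker φ := by simp [huv]
  exact sub_eq_zero.1 (inner_self_eq_zero.1
    (Submodule.inner_right_of_mem_orthogonal h1 (Submodule.sub_mem _ hu hv)))

/-- The complex structure of the fibre, provided by `complex_fibre`, and the one induced by `φ`
coincide: `v + iw'` in `κ` lies in `𝒞`, which gives `φ w' = I (φ v)`, and `φ` is injective on `(ker
φ)ᗮ ⊇ ker A`. -/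
theorem vert_complex (h : IsTwistorial A φ I σ κ) {v w : T} (hv : v ∈ LinearMap.ker A)
    (hw : w ∈ (LinearMap.ker φ)ᗮ) (hvw : φ w = I (φ v)) :
    w ∈ LinearMap.ker A ∧ incl T v + inclI T w ∈ κ := by
  obtain ⟨w', hw', hκ⟩ := h.complex_fibre v hv
  have h1 : incl T v + inclI T w' ∈ κ := by
    have := κ.smul_mem Complex.I hκ
    rwa [smul_sub, I_smul_incl, I_smul_inclI, sub_neg_eq_add, add_comm] at this
  have h2 : φ w' = I (φ v) := by
    rw [h.mem_coCR]
    refine Submodule.mem_sup_right ⟨mem_baseChange_iff.2 ?_, h1⟩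
    simpa using ⟨hv, hw'⟩
  have e : w = w' := injOn w w' hw (h.ker_left_le hw') (hvw.trans h2.symm)
  subst e
  exact ⟨hw', h1⟩

/-- As `u` is horizontal, the vertical component of `u + iw` is purely imaginary; multiplied by `i`
it is a real vertical vector in `κ`, hence zero. -/
theorem horiz_of_horiz (h : IsTwistorial A φ I σ κ) {u w : T} (hu : u ∈ (LinearMap.ker A)ᗮ)
    (huw : φ w = I (φ u)) : w ∈ (LinearMap.ker A)ᗮ := by
  obtain ⟨v₁, h1, v₂, h2, h6, h3, h4, h5⟩ := h.exists_decomp huw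
  have e1 : v₁ = 0 := eq_zero_of_mem h1 (by simpa using Submodule.sub_mem _ hu h3)
  have e2 : v₂ = 0 := by
    refine h.eq_zero_of_mem_of_incl h2 ?_
    have := κ.smul_mem Complex.I h6
    rw [e1, map_zero, zero_add, I_smul_inclI] at this
    simpa using κ.neg_mem this
  simpa [e2] using h4

theorem exists_complex (h : IsTwistorial A φ I σ κ) (u : T) :
    ∃ w ∈ (LinearMap.ker φ)ᗮ, φ w = I (φ u) := by
  obtain ⟨w, hw⟩ := h.surj_right (I (φ u))
  refine ⟨w - (LinearMap.ker φ).starProjection w, Submodule.sub_starProjection_mem_orthogonal w, ?_⟩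
  have : φ ((LinearMap.ker φ).starProjection w) = 0 :=
    Submodule.starProjection_apply_mem (LinearMap.ker φ) w
  rw [map_sub, this, sub_zero, hw]

/-- Coisotropy makes `J` orthogonal on `W = ℋ ∩ 𝒦`. For `w = Ju`, let `x` be the projection to `W`
of `J^* w`. Then `Ax + iAw` is bilinearly orthogonal to `σ`, so it belongs to `σ`; thus `w = Jx` and
`x = u`, which says that `J^* J` is the identity on `W`. -/
theorem inner_complex (h : IsTwistorial A φ I σ κ) {u u' w w' : T}
    (hu : u ∈ (LinearMap.ker A)ᗮ) (huK : u ∈ (LinearMap.ker φ)ᗮ)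
    (hu' : u' ∈ (LinearMap.ker A)ᗮ) (huK' : u' ∈ (LinearMap.ker φ)ᗮ)
    (hw : w ∈ (LinearMap.ker φ)ᗮ) (hw' : w' ∈ (LinearMap.ker φ)ᗮ)
    (huw : φ w = I (φ u)) (huw' : φ w' = I (φ u')) : inner ℝ w w' = inner ℝ u u' := by
  choose J hJK hJ using h.exists_complex
  have hJadd : ∀ a b, J (a + b) = J a + J b := fun a b ↦
    injOn _ _ (hJK _) (Submodule.add_mem _ (hJK a) (hJK b)) (by simp [hJ])
  have hJsmul : ∀ (c : ℝ) a, J (c • a) = c • J a := fun c a ↦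
    injOn _ _ (hJK _) (Submodule.smul_mem _ c (hJK a)) (by simp [hJ])
  let Jl : T →ₗ[ℝ] T := { toFun := J, map_add' := hJadd, map_smul' := hJsmul }
  set W : Submodule ℝ T := (LinearMap.ker A)ᗮ ⊓ (LinearMap.ker φ)ᗮ with hW
  have hwW : w ∈ W := ⟨h.horiz_of_horiz hu huw, hw⟩
  set x : T := W.starProjection (LinearMap.adjoint Jl w) with hx
  have hxW : x ∈ W := Submodule.starProjection_apply_mem _ _
  have hxin : ∀ a ∈ W, inner ℝ x a = inner ℝ w (J a) := by
    intro a ha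
    rw [hx, Submodule.inner_starProjection_left_eq_right, Submodule.starProjection_eq_self_iff.2 ha,
      LinearMap.adjoint_inner_left]
    rfl
  have hJW : ∀ a ∈ W, J a ∈ W := fun a ha ↦ ⟨h.horiz_of_horiz ha.1 (hJ a), hJK a⟩
  have hJJ : ∀ a ∈ W, J (J a) = - a := fun a ha ↦
    injOn _ _ (hJK _) (Submodule.neg_mem _ ha.2) (by simp [hJ, h.sq])
  have hmem : incl U (A x) + inclI U (A w) ∈ σ := by
    refine h.coisotropic _ fun b hb ↦ ?_
    have hlift : ∀ c : U, ∃ a ∈ (LinearMap.ker A)ᗮ, A a = c := by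
      intro c
      obtain ⟨a, ha⟩ := h.surj_left c
      refine ⟨a - (LinearMap.ker A).starProjection a,
        Submodule.sub_starProjection_mem_orthogonal a, ?_⟩
      have : A ((LinearMap.ker A).starProjection a) = 0 :=
        Submodule.starProjection_apply_mem (LinearMap.ker A) a
      rw [map_sub, this, sub_zero, ha]
    obtain ⟨u₁, hu₁, e1⟩ := hlift (rePart U b)
    obtain ⟨u₂, hu₂, e2⟩ := hlift (imPart U b)
    rw [← incl_rePart_add_inclI_imPart b, ← e1, ← e2] at hb ⊢
    have h12 := h.apply_eq_of_mem hu₁ hu₂ hb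
    -- Only the components in `W` matter in the pairing with `x` and `w`. For an element of `σ`,
    -- lifted to `u₁ + i u₂`, these are `w₁` and `J w₁`, and the real and imaginary parts of the
    -- pairing cancel by `J² = -1`.
    have hdec : ∀ a ∈ (LinearMap.ker A)ᗮ, ∃ c ∈ W, φ c = φ a ∧ ∀ d ∈ W, inner ℝ d a = inner ℝ d c := by
      intro a ha
      have hl : (LinearMap.ker φ).starProjection a ∈ LinearMap.ker φ :=
        Submodule.starProjection_apply_mem _ _
      have hl0 : φ ((LinearMap.ker φ).starProjection a) = 0 := hl
      refine ⟨a - (LinearMap.ker φ).starProjection a, ⟨Submodule.sub_mem _ ha (h.ker_le hl),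
        Submodule.sub_starProjection_mem_orthogonal a⟩, by rw [map_sub, hl0, sub_zero], fun d hd ↦ ?_⟩
      rw [inner_sub_right, Submodule.inner_left_of_mem_orthogonal hl hd.2, sub_zero]
    obtain ⟨w₁, hw₁, e3, i1⟩ := hdec u₁ hu₁
    obtain ⟨w₂, hw₂, e4, i2⟩ := hdec u₂ hu₂
    have e5 : w₂ = J w₁ := injOn _ _ hw₂.2 (hJK _) (by rw [e4, hJ, h12, e3])
    rw [bilC_incl_add_inclI, h.isometric _ hxW.1 _ hu₁, h.isometric _ hwW.1 _ hu₂,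
      h.isometric _ hxW.1 _ hu₂, h.isometric _ hwW.1 _ hu₁, i1 _ hxW, i1 _ hwW, i2 _ hxW, i2 _ hwW,
      e5, hxin _ hw₁, hxin _ (hJW _ hw₁), hJJ _ hw₁, inner_neg_right]
    simp
  have hxw := h.apply_eq_of_mem hxW.1 hwW.1 hmem
  have hinj : ∀ a b, I (φ a) = I (φ b) → φ a = φ b := fun a b hab ↦ by
    have := congrArg I hab
    rw [h.sq, h.sq] at this
    exact neg_injective this
  have exu : x = u := injOn _ _ hxW.2 huK (hinj _ _ (hxw.symm.trans huw))
  have e6 : w' = J u' := injOn _ _ hw' (hJK _) (by rw [huw', hJ])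
  rw [e6, ← hxin u' ⟨hu', huK'⟩, exu]

end IsTwistorial

/-! ### Brackets of vertical fields; horizontal and vertical extensions of vectors -/

section Bracket

variable {E : Type*} [NormedAddCommGroup E] [NormedSpace ℝ E] [FiniteDimensional ℝ E]
  {M : Type*} [TopologicalSpace M] [ChartedSpace E M] [IsManifold 𝓘(ℝ, E) ∞ M]
  {E' : Type*} [NormedAddCommGroup E'] [NormedSpace ℝ E'] [FiniteDimensional ℝ E']
  {N : Type*} [TopologicalSpace N] [ChartedSpace E' N] [IsManifold 𝓘(ℝ, E') ∞ N]

/-- The bracket of vector fields tangent to the fibres is tangent to the fibres. -/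
theorem mlieBracket_mem_vert {f : N → M} {y : N} (hf : ContMDiffAt 𝓘(ℝ, E') 𝓘(ℝ, E) ∞ f y)
    {A B : Π y : N, TangentSpace 𝓘(ℝ, E') y} (hA : DiffFieldAt A y) (hB : DiffFieldAt B y)
    (hA0 : ∀ᶠ z in 𝓝 y, A z ∈ vert E E' f z) (hB0 : ∀ᶠ z in 𝓝 y, B z ∈ vert E E' f z) :
    VectorField.mlieBracket 𝓘(ℝ, E') A B y ∈ vert E E' f y := by
  set φ := extChartAt 𝓘(ℝ, E) (f y) with hφ
  have hφd : ∀ x ∈ (chartAt E (f y)).source, MDifferentiableAt 𝓘(ℝ, E) 𝓘(ℝ, E) φ x := fun x hx ↦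
    mdifferentiableAt_extChartAt hx
  have hg : ContMDiffAt 𝓘(ℝ, E') 𝓘(ℝ, E) ∞ (φ ∘ f) y :=
    (contMDiffAt_extChartAt (I := 𝓘(ℝ, E)) (n := ∞) (x := f y)).comp y hf
  have hfd : ∀ᶠ z in 𝓝 y, MDifferentiableAt 𝓘(ℝ, E') 𝓘(ℝ, E) f z := by
    have h1 : ContMDiffAt 𝓘(ℝ, E') 𝓘(ℝ, E) 1 f y :=
      hf.of_le (WithTop.coe_le_coe.2 (le_top : (1 : ℕ∞) ≤ ⊤))
    exact ((contMDiffAt_iff_contMDiffAt_nhds (by simp)).1 h1).mono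
      fun z hz ↦ hz.mdifferentiableAt (by simp)
  have key : ∀ C : Π y : N, TangentSpace 𝓘(ℝ, E') y, ∀ᶠ z in 𝓝 y, mvfderiv 𝓘(ℝ, E') (φ ∘ f) z (C z) =
      mvfderiv 𝓘(ℝ, E) φ (f z) (mfderiv 𝓘(ℝ, E') 𝓘(ℝ, E) f z (C z)) := by
    intro C
    filter_upwards [hfd, hf.continuousAt.eventually
      ((chartAt E (f y)).open_source.mem_nhds (mem_chart_source E (f y)))] with z hz hz'
    exact mfderiv_comp_apply z (hφd _ hz') hz (C z)
  have hbr := mvfderiv_mlieBracket hg hA hB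
  have hz : ∀ C : Π y : N, TangentSpace 𝓘(ℝ, E') y, (∀ᶠ z in 𝓝 y, C z ∈ vert E E' f z) →
      (fun z ↦ mvfderiv 𝓘(ℝ, E') (φ ∘ f) z (C z)) =ᶠ[𝓝 y] fun _ ↦ 0 := by
    intro C hC
    filter_upwards [key C, hC] with z hz hz'
    have : mfderiv 𝓘(ℝ, E') 𝓘(ℝ, E) f z (C z) = 0 := hz'
    rw [hz, this, map_zero]
  rw [mvfderiv_congr (hz A hA0), mvfderiv_congr (hz B hB0), mvfderiv_const,
    (key (VectorField.mlieBracket 𝓘(ℝ, E') A B)).self_of_nhds] at hbr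
  have e : ∀ u : TangentSpace 𝓘(ℝ, E) (f y), mvfderiv 𝓘(ℝ, E) φ (f y) u = u := fun u ↦ by
    have := mfderiv_extChartAt_self (I := 𝓘(ℝ, E)) (x := f y)
    exact congrArg (fun L ↦ L u) this
  rw [e] at hbr
  have : mfderiv 𝓘(ℝ, E') 𝓘(ℝ, E) f y (VectorField.mlieBracket 𝓘(ℝ, E') A B y) = 0 := by
    rw [hbr]
    simp
    rfl
  exact this

theorem pullbackCov_eq_zero (cov : AffineConnection E M) {f : N → M} {y : N}
    (hf : ContMDiffAt 𝓘(ℝ, E') 𝓘(ℝ, E) ∞ f y) {s : Π y : N, TangentSpace 𝓘(ℝ, E) (f y)}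
    (hs : ∀ᶠ z in 𝓝 y, s z = 0) : pullbackCov (E' := E') cov f s y = 0 := by
  rw [pullbackCov_congr (s' := fun z ↦ ∑ i ∈ (∅ : Finset ℕ), 0) cov (by simpa using hs),
    pullbackCov_sum (s := fun _ _ ↦ 0) cov ∅ hf (by simp), Finset.sum_empty]

end Bracket

section Fields

variable {E : Type*} [NormedAddCommGroup E] [NormedSpace ℝ E] [FiniteDimensional ℝ E]
  {M : Type*} [TopologicalSpace M] [ChartedSpace E M] [IsManifold 𝓘(ℝ, E) ∞ M]
  {E' : Type*} [NormedAddCommGroup E'] [NormedSpace ℝ E'] [FiniteDimensional ℝ E']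
  {N : Type*} [TopologicalSpace N] [ChartedSpace E' N] [IsManifold 𝓘(ℝ, E') ∞ N]
  [RiemannianBundle (fun y : N ↦ TangentSpace 𝓘(ℝ, E') y)]
  [IsContMDiffRiemannianBundle 𝓘(ℝ, E') ∞ E' (fun y : N ↦ TangentSpace 𝓘(ℝ, E') y)]
  {f : N → M}

theorem smoothFieldAt_extend {y : N} (v : TangentSpace 𝓘(ℝ, E') y) :
    SmoothFieldAt (FiberBundle.extend E' v : Π z : N, TangentSpace 𝓘(ℝ, E') z) y :=
  FiberBundle.contMDiffAt_extend 𝓘(ℝ, E') E' v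

/-- The horizontal part of a tangent vector. -/
noncomputable def horPart (f : N → M) (y : N) (u : TangentSpace 𝓘(ℝ, E') y) :
    TangentSpace 𝓘(ℝ, E') y :=
  horizontalLift (E := E) f y (mfderiv 𝓘(ℝ, E') 𝓘(ℝ, E) f y u)

theorem horPart_mem (hf : IsSurjSubmersion E E' f) (y : N) (u : TangentSpace 𝓘(ℝ, E') y) :
    horPart (E := E) f y u ∈ (vert E E' f y)ᗮ :=
  (horizontalLift_spec (hf.submersion y) _).1

theorem mfderiv_horPart (hf : IsSurjSubmersion E E' f) (y : N) (u : TangentSpace 𝓘(ℝ, E') y) :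
    mfderiv 𝓘(ℝ, E') 𝓘(ℝ, E) f y (horPart (E := E) f y u) = mfderiv 𝓘(ℝ, E') 𝓘(ℝ, E) f y u :=
  (horizontalLift_spec (hf.submersion y) _).2

theorem horPart_eq_self {y : N} {u : TangentSpace 𝓘(ℝ, E') y} (hu : u ∈ (vert E E' f y)ᗮ) :
    horPart (E := E) f y u = u :=
  (eq_horizontalLift hu rfl).symm

theorem sub_horPart_mem (hf : IsSurjSubmersion E E' f) (y : N) (u : TangentSpace 𝓘(ℝ, E') y) :
    u - horPart (E := E) f y u ∈ vert E E' f y := by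
  have : mfderiv 𝓘(ℝ, E') 𝓘(ℝ, E) f y (u - horPart (E := E) f y u) = 0 := by
    rw [map_sub, mfderiv_horPart hf, sub_self]
  exact this

theorem horPart_eq_zero {y : N} {u : TangentSpace 𝓘(ℝ, E') y} (hu : u ∈ vert E E' f y) :
    horPart (E := E) f y u = 0 := by
  have : mfderiv 𝓘(ℝ, E') 𝓘(ℝ, E) f y u = 0 := hu
  rw [horPart, this]
  exact (eq_horizontalLift (Submodule.zero_mem _) (map_zero _)).symm

theorem horPart_eq_starProjection (hf : IsSurjSubmersion E E' f) (y : N)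
    (u : TangentSpace 𝓘(ℝ, E') y) :
    horPart (E := E) f y u = (vert E E' f y)ᗮ.starProjection u := by
  refine (Submodule.eq_starProjection_of_mem_of_inner_eq_zero (horPart_mem hf y u) fun w hw ↦ ?_).symm
  exact Submodule.inner_right_of_mem_orthogonal (sub_horPart_mem hf y u) hw

theorem starProjection_vert (hf : IsSurjSubmersion E E' f) (y : N)
    (u : TangentSpace 𝓘(ℝ, E') y) :
    (vert E E' f y).starProjection u = u - horPart (E := E) f y u := by
  rw [horPart_eq_starProjection hf, Submodule.starProjection_orthogonal_val, sub_sub_cancel]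

theorem SmoothFieldAt.horPart (hf : IsSurjSubmersion E E' f) {y : N}
    {X : Π y : N, TangentSpace 𝓘(ℝ, E') y} (hX : SmoothFieldAt X y) :
    SmoothFieldAt (fun z ↦ RTwist.horPart (E := E) f z (X z)) y :=
  smoothFieldAt_horizontalLift hf.submersion (hX.mfderiv_apply hf.smooth.contMDiffAt)

theorem SmoothFieldAt.sub {y : N} {X X' : Π y : N, TangentSpace 𝓘(ℝ, E') y}
    (hX : SmoothFieldAt X y) (hX' : SmoothFieldAt X' y) : SmoothFieldAt (fun z ↦ X z - X' z) y :=
  SmoothSecAt.sub (f := (id : N → N)) hX hX'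

theorem exists_horizontal_field (hf : IsSurjSubmersion E E' f) {y : N}
    {u : TangentSpace 𝓘(ℝ, E') y} (hu : u ∈ (vert E E' f y)ᗮ) :
    ∃ X : Π z : N, TangentSpace 𝓘(ℝ, E') z, SmoothFieldAt X y ∧
      (∀ z, X z ∈ (vert E E' f z)ᗮ) ∧ X y = u :=
  ⟨fun z ↦ horPart (E := E) f z (FiberBundle.extend E' u z), (smoothFieldAt_extend u).horPart hf,
    fun z ↦ horPart_mem hf z _, by simpa only [FiberBundle.extend_apply_self] using horPart_eq_self hu⟩

theorem exists_vertical_field (hf : IsSurjSubmersion E E' f) {y : N}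
    {u : TangentSpace 𝓘(ℝ, E') y} (hu : u ∈ vert E E' f y) :
    ∃ X : Π z : N, TangentSpace 𝓘(ℝ, E') z, SmoothFieldAt X y ∧
      (∀ z, X z ∈ vert E E' f z) ∧ X y = u :=
  ⟨fun z ↦ FiberBundle.extend E' u z - horPart (E := E) f z (FiberBundle.extend E' u z),
    (smoothFieldAt_extend u).sub ((smoothFieldAt_extend u).horPart hf),
    fun z ↦ sub_horPart_mem hf z _,
    by simp only [FiberBundle.extend_apply_self, horPart_eq_zero hu, sub_zero]⟩

variable {covN : AffineConnection E' N}

theorem IsLeviCivita.sub_eq_mlieBracket (hcov : IsLeviCivita covN) {y : N}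
    {A B : Π y : N, TangentSpace 𝓘(ℝ, E') y} (hA : DiffFieldAt A y) (hB : DiffFieldAt B y) :
    covN B y (A y) - covN A y (B y) = VectorField.mlieBracket 𝓘(ℝ, E') A B y := by
  have h := covN.torsion_apply hA hB
  rw [hcov.2 y] at h
  exact sub_eq_zero.1 h.symm

end Fields

/-- A trilinear form symmetric in the first two arguments and antisymmetric in the last two is
zero. -/
theorem eq_zero_of_symm_of_skew {α : Type*} (S : α → α → α → ℝ) (h1 : ∀ a b c, S a b c = S b a c)
    (h2 : ∀ a b c, S a b c = - S a c b) (a b c : α) : S a b c = 0 := by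
  have := h2 a b c
  have := h1 a c b
  have := h2 c a b
  have := h1 c b a
  have := h2 b c a
  have := h1 b a c
  linarith

/-! ### The Levi-Civita connection of a Riemannian submersion -/

section Submersion

variable {E : Type*} [NormedAddCommGroup E] [NormedSpace ℝ E] [FiniteDimensional ℝ E]
  {M : Type*} [TopologicalSpace M] [ChartedSpace E M] [IsManifold 𝓘(ℝ, E) ∞ M]
  [RiemannianBundle (fun x : M ↦ TangentSpace 𝓘(ℝ, E) x)]
  [IsContMDiffRiemannianBundle 𝓘(ℝ, E) ∞ E (fun x : M ↦ TangentSpace 𝓘(ℝ, E) x)]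
  {E' : Type*} [NormedAddCommGroup E'] [NormedSpace ℝ E'] [FiniteDimensional ℝ E']
  {Y : Type*} [TopologicalSpace Y] [ChartedSpace E' Y] [IsManifold 𝓘(ℝ, E') ∞ Y]
  [RiemannianBundle (fun y : Y ↦ TangentSpace 𝓘(ℝ, E') y)]
  [IsContMDiffRiemannianBundle 𝓘(ℝ, E') ∞ E' (fun y : Y ↦ TangentSpace 𝓘(ℝ, E') y)]
  {cov : AffineConnection E M} {covY : AffineConnection E' Y} {p : Y → M}

theorem inner_mfderiv (hp : IsRiemannianSubmersion (E := E) (E' := E') p) {y : Y}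
    {b : TangentSpace 𝓘(ℝ, E') y} (hb : b ∈ (vert E E' p y)ᗮ) (u : TangentSpace 𝓘(ℝ, E') y) :
    inner ℝ (mfderiv 𝓘(ℝ, E') 𝓘(ℝ, E) p y b) (mfderiv 𝓘(ℝ, E') 𝓘(ℝ, E) p y u) = inner ℝ b u := by
  rw [← mfderiv_horPart hp.1 y u, hp.2 y b hb _ (horPart_mem hp.1 y u), ← sub_eq_zero,
    ← inner_sub_right, ← neg_eq_zero, ← inner_neg_right, neg_sub]
  exact Submodule.inner_left_of_mem_orthogonal (sub_horPart_mem hp.1 y u) hb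

/-- The vertical part of `∇_A B` is antisymmetric in the horizontal fields `A`, `B`. -/
theorem cov_add_cov_mem_orthogonal (hcovY : IsLeviCivita covY) (hcov : IsMetric cov)
    (hp : IsRiemannianSubmersion (E := E) (E' := E') p) {y : Y}
    {A B : Π y : Y, TangentSpace 𝓘(ℝ, E') y} (hA : SmoothFieldAt A y) (hB : SmoothFieldAt B y)
    (hAh : ∀ᶠ z in 𝓝 y, A z ∈ (vert E E' p z)ᗮ) (hBh : ∀ᶠ z in 𝓝 y, B z ∈ (vert E E' p z)ᗮ) :
    covY B y (A y) + covY A y (B y) ∈ (vert E E' p y)ᗮ := by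
  refine (Submodule.mem_orthogonal' _ _).2 fun c hc ↦ ?_
  obtain ⟨C, hC, hCv, rfl⟩ := exists_vertical_field hp.1 hc
  have hps := hp.1.smooth.contMDiffAt (x := y)
  have hort : ∀ D : Π y : Y, TangentSpace 𝓘(ℝ, E') y, SmoothFieldAt D y →
      (∀ᶠ z in 𝓝 y, D z ∈ (vert E E' p z)ᗮ) → ∀ a, inner ℝ (covY D y a) (C y) = 
        - inner ℝ (D y) (covY C y a) := by
    intro D hD hDh a
    have h1 := hcovY.1 y D C a hD.diff hC.diff
    have e : (fun z ↦ inner ℝ (D z) (C z)) =ᶠ[𝓝 y] fun _ ↦ (0 : ℝ) := by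
      filter_upwards [hDh] with z hz using Submodule.inner_left_of_mem_orthogonal (hCv z) hz
    rw [mvfderiv_congr e, mvfderiv_const] at h1
    simp only [zero_apply] at h1
    linarith
  -- Since `dp C = 0`, the torsion of the pullback connection contributes nothing and only one
  -- derivative survives.
  have hbr : ∀ D : Π y : Y, TangentSpace 𝓘(ℝ, E') y, SmoothFieldAt D y →
      mfderiv 𝓘(ℝ, E') 𝓘(ℝ, E) p y (VectorField.mlieBracket 𝓘(ℝ, E') D C y) =
        - pullbackCov cov p (fun z ↦ mfderiv 𝓘(ℝ, E') 𝓘(ℝ, E) p z (D z)) y (C y) := by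
    intro D hD
    have h1 := pullbackCov_sub_eq_torsion cov hps hD.diff hC.diff
    have e : mfderiv 𝓘(ℝ, E') 𝓘(ℝ, E) p y (C y) = 0 := hCv y
    have e2 : pullbackCov cov p (fun z ↦ mfderiv 𝓘(ℝ, E') 𝓘(ℝ, E) p z (C z)) y = 0 :=
      pullbackCov_eq_zero cov hps (Eventually.of_forall fun z ↦ hCv z)
    rw [e2, e, map_zero, zero_apply, zero_sub, add_zero] at h1
    exact h1.symm
  -- On horizontal vectors the metric of `Y` is pulled back from `M`. The number to be shown zero is
  -- minus the Lie derivative of the metric along the vertical field `C`, evaluated on `A` and `B`.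
  have hmet : mvfderiv 𝓘(ℝ, E') (fun z ↦ inner ℝ (A z) (B z)) y (C y) =
      mvfderiv 𝓘(ℝ, E') (fun z ↦ inner ℝ (mfderiv 𝓘(ℝ, E') 𝓘(ℝ, E) p z (A z))
        (mfderiv 𝓘(ℝ, E') 𝓘(ℝ, E) p z (B z))) y (C y) := by
    rw [mvfderiv_congr]
    filter_upwards [hAh] with z hz using (inner_mfderiv hp hz _).symm
  rw [hcovY.1 y A B (C y) hA.diff hB.diff,
    mvfderiv_inner_pullback hcov (C y) (hA.mfderiv_apply hps) (hB.mfderiv_apply hps)] at hmet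
  have h1 := hcovY.sub_eq_mlieBracket hA.diff hC.diff
  have h2 := hcovY.sub_eq_mlieBracket hB.diff hC.diff
  have h3 := inner_mfderiv hp hBh.self_of_nhds (VectorField.mlieBracket 𝓘(ℝ, E') A C y)
  have h4 := inner_mfderiv hp hAh.self_of_nhds (VectorField.mlieBracket 𝓘(ℝ, E') B C y)
  rw [hbr A hA, ← h1, inner_neg_right, inner_sub_right] at h3
  rw [hbr B hB, ← h2, inner_neg_right, inner_sub_right] at h4
  rw [inner_add_left, hort B hB hBh, hort A hA hAh]
  rw [real_inner_comm] at h3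
  rw [real_inner_comm (B y)] at hmet
  linarith

/-- The horizontal part of `∇_A B`, for horizontal fields `A`, `B`. -/
theorem mfderiv_cov_horizontal (hcovY : IsLeviCivita covY) (hcov : IsMetric cov)
    (hskew : HasSkewTorsion cov)
    (hp : IsRiemannianSubmersion (E := E) (E' := E') p) {y : Y}
    {A B : Π y : Y, TangentSpace 𝓘(ℝ, E') y} (hA : SmoothFieldAt A y) (hB : SmoothFieldAt B y)
    (hAh : ∀ᶠ z in 𝓝 y, A z ∈ (vert E E' p z)ᗮ) (hBh : ∀ᶠ z in 𝓝 y, B z ∈ (vert E E' p z)ᗮ) :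
    mfderiv 𝓘(ℝ, E') 𝓘(ℝ, E) p y (covY B y (A y)) =
      pullbackCov cov p (fun z ↦ mfderiv 𝓘(ℝ, E') 𝓘(ℝ, E) p z (B z)) y (A y) -
      (1 / 2 : ℝ) • cov.torsion (p y) (mfderiv 𝓘(ℝ, E') 𝓘(ℝ, E) p y (A y))
        (mfderiv 𝓘(ℝ, E') 𝓘(ℝ, E) p y (B y)) := by
  have hps := hp.1.smooth.contMDiffAt (x := y)
  let α := {X : Π y : Y, TangentSpace 𝓘(ℝ, E') y // SmoothFieldAt X y ∧
    ∀ᶠ z in 𝓝 y, X z ∈ (vert E E' p z)ᗮ}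
  -- `D` is the difference of the two sides. It is symmetric because the term `T/2` makes both
  -- connections torsion free, and skew because both are metric; skewness of `T` is what keeps the
  -- corrected connection metric.
  let D : α → α → TangentSpace 𝓘(ℝ, E) (p y) := fun A B ↦
    mfderiv 𝓘(ℝ, E') 𝓘(ℝ, E) p y (covY B.1 y (A.1 y)) -
      (pullbackCov cov p (fun z ↦ mfderiv 𝓘(ℝ, E') 𝓘(ℝ, E) p z (B.1 z)) y (A.1 y) -
      (1 / 2 : ℝ) • cov.torsion (p y) (mfderiv 𝓘(ℝ, E') 𝓘(ℝ, E) p y (A.1 y))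
        (mfderiv 𝓘(ℝ, E') 𝓘(ℝ, E) p y (B.1 y)))
  have hsymm : ∀ A B, D A B = D B A := by
    intro A B
    have h1 := pullbackCov_sub_eq_torsion cov hps A.2.1.diff B.2.1.diff
    rw [← hcovY.sub_eq_mlieBracket A.2.1.diff B.2.1.diff, map_sub] at h1
    have h2 := cov.torsion_antisymm (mfderiv 𝓘(ℝ, E') 𝓘(ℝ, E) p y (A.1 y))
      (mfderiv 𝓘(ℝ, E') 𝓘(ℝ, E) p y (B.1 y))
    simp only [D]
    rw [h2] at h1 ⊢
    rw [sub_eq_iff_eq_add] at h1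
    rw [h1]
    module
  have hsk : ∀ A B C : α, inner ℝ (D A B) (mfderiv 𝓘(ℝ, E') 𝓘(ℝ, E) p y (C.1 y)) =
      - inner ℝ (D A C) (mfderiv 𝓘(ℝ, E') 𝓘(ℝ, E) p y (B.1 y)) := by
    intro A B C
    have h1 := hcovY.1 y B.1 C.1 (A.1 y) B.2.1.diff C.2.1.diff
    have h2 := mvfderiv_inner_pullback hcov (A.1 y) (B.2.1.mfderiv_apply hps) (C.2.1.mfderiv_apply hps)
    have e : (fun z ↦ inner ℝ (mfderiv 𝓘(ℝ, E') 𝓘(ℝ, E) p z (B.1 z))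
        (mfderiv 𝓘(ℝ, E') 𝓘(ℝ, E) p z (C.1 z))) =ᶠ[𝓝 y] fun z ↦ inner ℝ (B.1 z) (C.1 z) := by
      filter_upwards [B.2.2] with z hz using inner_mfderiv hp hz _
    have h3 := inner_mfderiv hp C.2.2.self_of_nhds (covY B.1 y (A.1 y))
    have h4 := inner_mfderiv hp B.2.2.self_of_nhds (covY C.1 y (A.1 y))
    have h5 := hskew (p y) (mfderiv 𝓘(ℝ, E') 𝓘(ℝ, E) p y (A.1 y))
      (mfderiv 𝓘(ℝ, E') 𝓘(ℝ, E) p y (B.1 y)) (mfderiv 𝓘(ℝ, E') 𝓘(ℝ, E) p y (C.1 y))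
    rw [mvfderiv_congr e, h1] at h2
    rw [real_inner_comm] at h3
    rw [real_inner_comm] at h4
    have h6 := real_inner_comm (C.1 y) (covY B.1 y (A.1 y))
    have h7 := real_inner_comm (B.1 y) (covY C.1 y (A.1 y))
    have h8 := real_inner_comm (mfderiv 𝓘(ℝ, E') 𝓘(ℝ, E) p y (B.1 y))
      (pullbackCov cov p (fun z ↦ mfderiv 𝓘(ℝ, E') 𝓘(ℝ, E) p z (C.1 z)) y (A.1 y))
    simp only [D, inner_sub_left, inner_smul_left, map_div₀, map_one, map_ofNat]
    linarith
  have h0 : ∀ A B : α, D A B = 0 := by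
    intro A B
    -- A horizontal field whose image at `y` is `D A B` itself turns the vanishing of the trilinear
    -- form into `⟨D A B, D A B⟩ = 0`.
    obtain ⟨u, hu⟩ := hp.1.submersion y (D A B)
    obtain ⟨C, hC, hCh, e⟩ := exists_horizontal_field hp.1 (horPart_mem hp.1 y u)
    have := eq_zero_of_symm_of_skew (fun A B C : α ↦ inner ℝ (D A B)
      (mfderiv 𝓘(ℝ, E') 𝓘(ℝ, E) p y (C.1 y))) (fun A B C ↦ by rw [hsymm]) hsk A B
      ⟨C, hC, Eventually.of_forall hCh⟩
    simp only [e, mfderiv_horPart hp.1, hu] at this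
    exact inner_self_eq_zero.1 this
  exact sub_eq_zero.1 (h0 ⟨A, hA, hAh⟩ ⟨B, hB, hBh⟩)

end Submersion

/-! ### Complexified derivatives and linearity of horizontal lifts -/

section CovC

variable {E : Type*} [NormedAddCommGroup E] [NormedSpace ℝ E]
  {M : Type*} [TopologicalSpace M] [ChartedSpace E M] [IsManifold 𝓘(ℝ, E) ∞ M]
  {E' : Type*} [NormedAddCommGroup E'] [NormedSpace ℝ E']
  {N : Type*} [TopologicalSpace N] [ChartedSpace E' N]

theorem pullbackCovC_incl (cov : AffineConnection E M) (f : N → M)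
    (s : Π y : N, ℂ ⊗[ℝ] TangentSpace 𝓘(ℝ, E) (f y)) (y : N) (a : TangentSpace 𝓘(ℝ, E') y) :
    pullbackCovC cov f s y (incl _ a) = incl _ (pullbackCov cov f (fun z ↦ rePart _ (s z)) y a) +
      inclI _ (pullbackCov cov f (fun z ↦ imPart _ (s z)) y a) := by
  simp [pullbackCovC, incl]

end CovC

section Lift

variable {E : Type*} [NormedAddCommGroup E] [NormedSpace ℝ E] [FiniteDimensional ℝ E]
  {M : Type*} [TopologicalSpace M] [ChartedSpace E M] [IsManifold 𝓘(ℝ, E) ∞ M]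
  {E' : Type*} [NormedAddCommGroup E'] [NormedSpace ℝ E'] [FiniteDimensional ℝ E']
  {N : Type*} [TopologicalSpace N] [ChartedSpace E' N] [IsManifold 𝓘(ℝ, E') ∞ N]
  [RiemannianBundle (fun y : N ↦ TangentSpace 𝓘(ℝ, E') y)]
  [IsContMDiffRiemannianBundle 𝓘(ℝ, E') ∞ E' (fun y : N ↦ TangentSpace 𝓘(ℝ, E') y)]
  {f : N → M}

theorem horizontalLift_add (hf : IsSurjSubmersion E E' f) (y : N)
    (w w' : TangentSpace 𝓘(ℝ, E) (f y)) : horizontalLift (E' := E') f y (w + w') =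
      horizontalLift (E' := E') f y w + horizontalLift (E' := E') f y w' := by
  have h := horizontalLift_spec (hf.submersion y) w
  have h' := horizontalLift_spec (hf.submersion y) w'
  exact (eq_horizontalLift (Submodule.add_mem _ h.1 h'.1) (by rw [map_add, h.2, h'.2])).symm

theorem horizontalLift_smul (hf : IsSurjSubmersion E E' f) (y : N) (c : ℝ)
    (w : TangentSpace 𝓘(ℝ, E) (f y)) : horizontalLift (E' := E') f y (c • w) =
      c • horizontalLift (E' := E') f y w := by
  have h := horizontalLift_spec (hf.submersion y) w
  exact (eq_horizontalLift (Submodule.smul_mem _ c h.1) (by rw [map_smul, h.2])).symm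

theorem horizontalLift_neg (hf : IsSurjSubmersion E E' f) (y : N)
    (w : TangentSpace 𝓘(ℝ, E) (f y)) : horizontalLift (E' := E') f y (-w) =
      - horizontalLift (E' := E') f y w := by
  simpa using horizontalLift_smul hf y (-1) w

theorem horizontalLift_sub (hf : IsSurjSubmersion E E' f) (y : N)
    (w w' : TangentSpace 𝓘(ℝ, E) (f y)) : horizontalLift (E' := E') f y (w - w') =
      horizontalLift (E' := E') f y w - horizontalLift (E' := E') f y w' := by
  rw [sub_eq_add_neg, horizontalLift_add hf, horizontalLift_neg hf, ← sub_eq_add_neg]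

end Lift

/-! ### The integrability tensor of `ℋ` -/

section Integrability

variable {E : Type*} [NormedAddCommGroup E] [NormedSpace ℝ E] [FiniteDimensional ℝ E]
  {M : Type*} [TopologicalSpace M] [ChartedSpace E M] [IsManifold 𝓘(ℝ, E) ∞ M]
  [RiemannianBundle (fun x : M ↦ TangentSpace 𝓘(ℝ, E) x)]
  [IsContMDiffRiemannianBundle 𝓘(ℝ, E) ∞ E (fun x : M ↦ TangentSpace 𝓘(ℝ, E) x)]
  {E' : Type*} [NormedAddCommGroup E'] [NormedSpace ℝ E'] [FiniteDimensional ℝ E']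
  {Y : Type*} [TopologicalSpace Y] [ChartedSpace E' Y] [IsManifold 𝓘(ℝ, E') ∞ Y]
  [RiemannianBundle (fun y : Y ↦ TangentSpace 𝓘(ℝ, E') y)]
  [IsContMDiffRiemannianBundle 𝓘(ℝ, E') ∞ E' (fun y : Y ↦ TangentSpace 𝓘(ℝ, E') y)]
  {cov : AffineConnection E M} {covY : AffineConnection E' Y} {p : Y → M}

/-- The bracket is `D_A B - D_B A`, and the vertical parts of the two terms are opposite. The
right-hand side depends on `A` only through `A y`. -/
theorem sub_horPart_mlieBracket (hcovY : IsLeviCivita covY) (hcov : IsMetric cov)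
    (hp : IsRiemannianSubmersion (E := E) (E' := E') p) {y : Y}
    {A B : Π y : Y, TangentSpace 𝓘(ℝ, E') y} (hA : SmoothFieldAt A y) (hB : SmoothFieldAt B y)
    (hAh : ∀ᶠ z in 𝓝 y, A z ∈ (vert E E' p z)ᗮ) (hBh : ∀ᶠ z in 𝓝 y, B z ∈ (vert E E' p z)ᗮ) :
    (vert E E' p y).starProjection (VectorField.mlieBracket 𝓘(ℝ, E') A B y) =
      (2 : ℝ) • (vert E E' p y).starProjection (covY B y (A y)) := by
  have h1 := cov_add_cov_mem_orthogonal hcovY hcov hp hA hB hAh hBh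
  rw [← Submodule.starProjection_apply_eq_zero_iff, map_add] at h1
  rw [← hcovY.sub_eq_mlieBracket hA.diff hB.diff, map_sub, eq_neg_of_add_eq_zero_right h1, two_smul,
    sub_neg_eq_add]

/-- Independence of the chosen extensions: the vertical part of the bracket is `2 D_A B`, tensorial
in `A`, and after a swap it is tensorial in `B`; so the two fields are replaced one at a time. -/
theorem integrabilityTensor_eq (hcovY : IsLeviCivita covY) (hcov : IsMetric cov)
    (hp : IsRiemannianSubmersion (E := E) (E' := E') p) {y : Y}
    {A B : Π y : Y, TangentSpace 𝓘(ℝ, E') y} (hA : SmoothFieldAt A y) (hB : SmoothFieldAt B y)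
    (hAh : ∀ᶠ z in 𝓝 y, A z ∈ (vert E E' p z)ᗮ) (hBh : ∀ᶠ z in 𝓝 y, B z ∈ (vert E E' p z)ᗮ) :
    integrabilityTensor E p y (A y) (B y) =
      - (vert E E' p y).starProjection (VectorField.mlieBracket 𝓘(ℝ, E') A B y) := by
  have hsm : ∀ u : TangentSpace 𝓘(ℝ, E') y, SmoothFieldAt (fun z ↦
      (vert E E' p z)ᗮ.starProjection (FiberBundle.extend E' u z)) y := fun u ↦ by
    simpa only [← horPart_eq_starProjection hp.1] using (smoothFieldAt_extend u).horPart hp.1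
  have hho : ∀ u : TangentSpace 𝓘(ℝ, E') y, ∀ᶠ z in 𝓝 y,
      (vert E E' p z)ᗮ.starProjection (FiberBundle.extend E' u z) ∈ (vert E E' p z)ᗮ := fun u ↦
    Eventually.of_forall fun z ↦ Submodule.starProjection_apply_mem _ _
  have hval : ∀ u ∈ (vert E E' p y)ᗮ,
      (vert E E' p y)ᗮ.starProjection (FiberBundle.extend E' u y) = u := fun u hu ↦ by
    rw [FiberBundle.extend_apply_self, Submodule.starProjection_eq_self_iff.2 hu]
  rw [integrabilityTensor, sub_horPart_mlieBracket hcovY hcov hp (hsm _) (hsm _) (hho _) (hho _),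
    hval _ hAh.self_of_nhds, ← sub_horPart_mlieBracket hcovY hcov hp hA (hsm _) hAh (hho _),
    VectorField.mlieBracket_swap_apply, map_neg,
    sub_horPart_mlieBracket hcovY hcov hp (hsm _) hA (hho _) hAh, hval _ hBh.self_of_nhds,
    ← sub_horPart_mlieBracket hcovY hcov hp hB hA hBh hAh, VectorField.mlieBracket_swap_apply,
    map_neg, neg_neg]

end Integrability

/-! ### From the twistorial structure to its pointwise data -/

section Twistorial

variable {E : Type*} [NormedAddCommGroup E] [NormedSpace ℝ E] [FiniteDimensional ℝ E]
  {M : Type*} [TopologicalSpace M] [ChartedSpace E M] [IsManifold 𝓘(ℝ, E) ∞ M]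
  [RiemannianBundle (fun x : M ↦ TangentSpace 𝓘(ℝ, E) x)]
  [IsContMDiffRiemannianBundle 𝓘(ℝ, E) ∞ E (fun x : M ↦ TangentSpace 𝓘(ℝ, E) x)]
  {E' : Type*} [NormedAddCommGroup E'] [NormedSpace ℝ E'] [FiniteDimensional ℝ E']
  {Y : Type*} [TopologicalSpace Y] [ChartedSpace E' Y] [IsManifold 𝓘(ℝ, E') ∞ Y]
  [RiemannianBundle (fun y : Y ↦ TangentSpace 𝓘(ℝ, E') y)]
  [IsContMDiffRiemannianBundle 𝓘(ℝ, E') ∞ E' (fun y : Y ↦ TangentSpace 𝓘(ℝ, E') y)]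
  {F : Type*} [NormedAddCommGroup F] [NormedSpace ℂ F] [FiniteDimensional ℂ F]
  {Z : Type*} [TopologicalSpace Z] [ChartedSpace F Z] [IsManifold 𝓘(ℂ, F) ω Z]
  {cov : AffineConnection E M} {p : Y → M}
  {σ : Π y : Y, Submodule ℂ (ℂ ⊗[ℝ] TangentSpace 𝓘(ℝ, E) (p y))} {conjY : Y → Y}
  {covY : AffineConnection E' Y} {φ : Y → Z} {conjZ : Z → Z}

theorem mulI_mulI (z : Z) (u : TangentSpace 𝓘(ℝ, F) z) : mulI z (mulI z u) = - u := by
  have : ∀ v : F, Complex.I • (Complex.I • v) = - v := fun v ↦ by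
    rw [smul_smul, Complex.I_mul_I, neg_one_smul]
  exact this u

theorem mem_T01_iff {z : Z} (u v : TangentSpace 𝓘(ℝ, F) z) :
    incl _ u + inclI _ v ∈ T01 z ↔ v = mulI z u := by
  rw [T01, LinearMap.mem_ker]
  simp only [LinearMap.add_apply, LinearMap.smul_apply, LinearMap.id_apply, map_add, baseChange_incl,
    baseChange_inclI, I_smul_incl, I_smul_inclI, ContinuousLinearMap.coe_coe]
  constructor
  · intro h
    have h1 := congrArg (rePart _) h
    simp only [map_add, map_neg, rePart_incl, rePart_inclI, map_zero, zero_add, add_zero] at h1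
    exact (add_neg_eq_zero.1 h1).symm
  · rintro rfl
    rw [mulI_mulI, map_neg]
    abel

theorem IsGivenBy.isTwistorial (h : IsGivenBy (E' := E') (F := F) cov p σ conjY covY φ conjZ)
    (y : Y) : IsTwistorial (mfderiv 𝓘(ℝ, E') 𝓘(ℝ, E) p y).toLinearMap
      (mfderiv 𝓘(ℝ, E') 𝓘(ℝ, F) φ y).toLinearMap (mulI (φ y)).toLinearMap (σ y)
      (kerNabla (E' := E') cov σ y) where
  surj_left := h.almost.submersion.submersion y
  surj_right := h.submersion.submersion y
  isometric := h.riemannian.2 y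
  sq := mulI_mulI (φ y)
  mem_horiz u := by
    have : u ∈ horiz (E' := E') cov σ y ↔ u ∈ (vert E E' p y)ᗮ := by rw [h.horiz_eq]
    exact this
  mem_coCR u v := by
    have h1 := h.coCR_eq y
    rw [coCR, h.horiz_eq y] at h1
    have h2 : incl _ u + inclI _ v ∈ (T01 (φ y)).comap
        ((mfderiv 𝓘(ℝ, E') 𝓘(ℝ, F) φ y).toLinearMap.baseChange ℂ) ↔
        mfderiv 𝓘(ℝ, E') 𝓘(ℝ, F) φ y v = mulI (φ y) (mfderiv 𝓘(ℝ, E') 𝓘(ℝ, F) φ y u) := by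
      rw [Submodule.mem_comap, map_add, baseChange_incl, baseChange_inclI]
      exact mem_T01_iff _ _
    rw [← h1] at h2
    exact h2.symm
  complex_fibre := h.almost.complex_fibre y
  coisotropic := h.almost.coisotropic y

end Twistorial

/-! ### Derivatives along `ℋ`, and the fibres of `φ` -/

section Horizontal

variable {E : Type*} [NormedAddCommGroup E] [NormedSpace ℝ E] [FiniteDimensional ℝ E]
  {M : Type*} [TopologicalSpace M] [ChartedSpace E M] [IsManifold 𝓘(ℝ, E) ∞ M]
  [RiemannianBundle (fun x : M ↦ TangentSpace 𝓘(ℝ, E) x)]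
  [IsContMDiffRiemannianBundle 𝓘(ℝ, E) ∞ E (fun x : M ↦ TangentSpace 𝓘(ℝ, E) x)]
  {E' : Type*} [NormedAddCommGroup E'] [NormedSpace ℝ E'] [FiniteDimensional ℝ E']
  {Y : Type*} [TopologicalSpace Y] [ChartedSpace E' Y] [IsManifold 𝓘(ℝ, E') ∞ Y]
  [RiemannianBundle (fun y : Y ↦ TangentSpace 𝓘(ℝ, E') y)]
  [IsContMDiffRiemannianBundle 𝓘(ℝ, E') ∞ E' (fun y : Y ↦ TangentSpace 𝓘(ℝ, E') y)]
  {F : Type*} [NormedAddCommGroup F] [NormedSpace ℂ F] [FiniteDimensional ℂ F]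
  {Z : Type*} [TopologicalSpace Z] [ChartedSpace F Z] [IsManifold 𝓘(ℂ, F) ω Z]
  {cov : AffineConnection E M} {p : Y → M}
  {σ : Π y : Y, Submodule ℂ (ℂ ⊗[ℝ] TangentSpace 𝓘(ℝ, E) (p y))} {conjY : Y → Y}
  {covY : AffineConnection E' Y} {φ : Y → Z} {conjZ : Z → Z}

theorem complexStr_spec (hφ : IsSurjSubmersion F E' φ) (y : Y) (a : TangentSpace 𝓘(ℝ, E') y) :
    complexStr (F := F) φ y a ∈ (vert F E' φ y)ᗮ ∧
      mfderiv 𝓘(ℝ, E') 𝓘(ℝ, F) φ y (complexStr (F := F) φ y a) =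
        mulI (φ y) (mfderiv 𝓘(ℝ, E') 𝓘(ℝ, F) φ y a) :=
  have : FiniteDimensional ℝ F := FiniteDimensional.complexToReal F
  horizontalLift_spec (hφ.submersion y) _

theorem SmoothFieldAt.complexStr (hφ : IsSurjSubmersion F E' φ) {y : Y}
    {X : Π y : Y, TangentSpace 𝓘(ℝ, E') y} (hX : SmoothFieldAt X y) :
    SmoothFieldAt (fun z ↦ RTwist.complexStr (F := F) φ z (X z)) y :=
  have : FiniteDimensional ℝ F := FiniteDimensional.complexToReal F
  smoothFieldAt_horizontalLift hφ.submersion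
    (SmoothSecAt.mulI (hX.mfderiv_apply hφ.smooth.contMDiffAt))

theorem IsGivenBy.vert_le (h : IsGivenBy (E' := E') (F := F) cov p σ conjY covY φ conjZ) (y : Y) :
    vert F E' φ y ≤ (vert E E' p y)ᗮ :=
  (h.isTwistorial y).ker_le

theorem IsGivenBy.vert_le_orthogonal
    (h : IsGivenBy (E' := E') (F := F) cov p σ conjY covY φ conjZ) (y : Y) :
    vert E E' p y ≤ (vert F E' φ y)ᗮ :=
  (h.isTwistorial y).ker_left_le

/-- If `X + iX'` is a section of `ℬ` then the covariant derivatives of `dp X + i dp X'` in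
horizontal directions lift to `ℬ`. -/
theorem IsGivenBy.mfderiv_lift_pullbackCov
    (h : IsGivenBy (E' := E') (F := F) cov p σ conjY covY φ conjZ) {y : Y}
    {X X' : Π y : Y, TangentSpace 𝓘(ℝ, E') y} (hX : SmoothFieldAt X y) (hX' : SmoothFieldAt X' y)
    (hXh : ∀ᶠ z in 𝓝 y, X z ∈ (vert E E' p z)ᗮ) (hXh' : ∀ᶠ z in 𝓝 y, X' z ∈ (vert E E' p z)ᗮ)
    (hXX' : ∀ᶠ z in 𝓝 y, mfderiv 𝓘(ℝ, E') 𝓘(ℝ, F) φ z (X' z) =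
      mulI (φ z) (mfderiv 𝓘(ℝ, E') 𝓘(ℝ, F) φ z (X z)))
    {a : TangentSpace 𝓘(ℝ, E') y} (ha : a ∈ (vert E E' p y)ᗮ) :
    mfderiv 𝓘(ℝ, E') 𝓘(ℝ, F) φ y (horizontalLift (E' := E') p y
        (pullbackCov cov p (fun z ↦ mfderiv 𝓘(ℝ, E') 𝓘(ℝ, E) p z (X' z)) y a)) =
      mulI (φ y) (mfderiv 𝓘(ℝ, E') 𝓘(ℝ, F) φ y (horizontalLift (E' := E') p y
        (pullbackCov cov p (fun z ↦ mfderiv 𝓘(ℝ, E') 𝓘(ℝ, E) p z (X z)) y a))) := by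
  have hps := h.almost.submersion.smooth.contMDiffAt (x := y)
  set s : Π z : Y, ℂ ⊗[ℝ] TangentSpace 𝓘(ℝ, E) (p z) := fun z ↦
    incl _ (mfderiv 𝓘(ℝ, E') 𝓘(ℝ, E) p z (X z)) + inclI _ (mfderiv 𝓘(ℝ, E') 𝓘(ℝ, E) p z (X' z)) with hs
  have hre : (fun z ↦ rePart _ (s z)) = fun z ↦ mfderiv 𝓘(ℝ, E') 𝓘(ℝ, E) p z (X z) := by
    funext z; simp [hs]
  have him : (fun z ↦ imPart _ (s z)) = fun z ↦ mfderiv 𝓘(ℝ, E') 𝓘(ℝ, E) p z (X' z) := by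
    funext z; simp [hs]
  have hsec : IsLocalSection (E' := E') σ s y := by
    refine ⟨by rw [hre]; exact hX.mfderiv_apply hps, by rw [him]; exact hX'.mfderiv_apply hps, ?_⟩
    filter_upwards [hXh, hXh', hXX'] with z h1 h2 h3
    exact (h.isTwistorial z).mem_of_horiz h1 h2 h3
  -- A horizontal direction is one in which `σ` is parallel, so the derivative of the section `s` of
  -- `σ` stays in `σ`.
  have hmem : incl _ a ∈ kerNabla (E' := E') cov σ y := ((h.isTwistorial y).mem_horiz a).2 ha
  rw [kerNabla, Submodule.mem_iInf] at hmem
  have h1 := hmem s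
  rw [Submodule.mem_iInf] at h1
  have h2 : pullbackCovC cov p s y (incl _ a) ∈ σ y := h1 hsec
  rw [pullbackCovC_incl, hre, him] at h2
  have k := fun w ↦ horizontalLift_spec (h.almost.submersion.submersion y) w
  refine (h.isTwistorial y).apply_eq_of_mem (k _).1 (k _).1 ?_
  simpa only [ContinuousLinearMap.coe_coe, (k _).2] using h2

/-- A section `X` of `ker dφ` may play both roles in the previous theorem, since `0 = i0`. The
resulting vector `w` satisfies `w = iw`, hence `w = -w`. -/
theorem IsGivenBy.mfderiv_lift_pullbackCov_eq_zero
    (h : IsGivenBy (E' := E') (F := F) cov p σ conjY covY φ conjZ) {y : Y}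
    {X : Π y : Y, TangentSpace 𝓘(ℝ, E') y} (hX : SmoothFieldAt X y)
    (hXv : ∀ᶠ z in 𝓝 y, X z ∈ vert F E' φ z)
    {a : TangentSpace 𝓘(ℝ, E') y} (ha : a ∈ (vert E E' p y)ᗮ) :
    mfderiv 𝓘(ℝ, E') 𝓘(ℝ, F) φ y (horizontalLift (E' := E') p y
        (pullbackCov cov p (fun z ↦ mfderiv 𝓘(ℝ, E') 𝓘(ℝ, E) p z (X z)) y a)) = 0 := by
  have hX0 : ∀ᶠ z in 𝓝 y, mfderiv 𝓘(ℝ, E') 𝓘(ℝ, F) φ z (X z) = 0 := hXv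
  have hXh : ∀ᶠ z in 𝓝 y, X z ∈ (vert E E' p z)ᗮ := hXv.mono fun z hz ↦ h.vert_le z hz
  have h1 := h.mfderiv_lift_pullbackCov hX hX hXh hXh (hX0.mono fun z hz ↦ by simp [hz]) ha
  set w := mfderiv 𝓘(ℝ, E') 𝓘(ℝ, F) φ y (horizontalLift (E' := E') p y
        (pullbackCov cov p (fun z ↦ mfderiv 𝓘(ℝ, E') 𝓘(ℝ, E) p z (X z)) y a))
  have h2 := congrArg (mulI (φ y)) h1
  rw [mulI_mulI, ← h1] at h2
  calc w = (1 / 2 : ℝ) • (w + w) := by module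
    _ = 0 := by rw [add_eq_zero_iff_eq_neg.2 h2, smul_zero]

/-- The image by `dφ` of `∇_A B`, for horizontal fields `A`, `B`. -/
theorem IsGivenBy.mfderiv_cov (h : IsGivenBy (E' := E') (F := F) cov p σ conjY covY φ conjZ)
    (hcovY : IsLeviCivita covY) {y : Y}
    {A B : Π y : Y, TangentSpace 𝓘(ℝ, E') y} (hA : SmoothFieldAt A y) (hB : SmoothFieldAt B y)
    (hAh : ∀ᶠ z in 𝓝 y, A z ∈ (vert E E' p z)ᗮ) (hBh : ∀ᶠ z in 𝓝 y, B z ∈ (vert E E' p z)ᗮ) :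
    covY B y (A y) = (1 / 2 : ℝ) • (vert E E' p y).starProjection
        (VectorField.mlieBracket 𝓘(ℝ, E') A B y) +
      (horizontalLift (E' := E') p y
        (pullbackCov cov p (fun z ↦ mfderiv 𝓘(ℝ, E') 𝓘(ℝ, E) p z (B z)) y (A y)) -
        (1 / 2 : ℝ) • torsionH cov p y (A y) (B y)) := by
  have hsub := h.almost.submersion
  rw [sub_horPart_mlieBracket hcovY h.almost.metric h.riemannian hA hB hAh hBh, smul_smul]
  norm_num
  have h1 := mfderiv_cov_horizontal hcovY h.almost.metric h.almost.skewTorsion h.riemannian hA hB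
    hAh hBh
  have h2 := congrArg (horizontalLift (E' := E') p y) h1
  rw [horizontalLift_sub hsub, horizontalLift_smul hsub] at h2
  rw [starProjection_vert hsub, horPart, h2, torsionH]
  module

/-- The torsion formula for the pullback connection, lifted to `ℋ`; unlike the formula for `D`, it
involves no metric. -/
theorem IsGivenBy.mlieBracket_eq (h : IsGivenBy (E' := E') (F := F) cov p σ conjY covY φ conjZ)
    {y : Y} {A B : Π y : Y, TangentSpace 𝓘(ℝ, E') y} (hA : SmoothFieldAt A y)
    (hB : SmoothFieldAt B y) :
    VectorField.mlieBracket 𝓘(ℝ, E') A B y = (vert E E' p y).starProjection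
        (VectorField.mlieBracket 𝓘(ℝ, E') A B y) +
      (horizontalLift (E' := E') p y
        (pullbackCov cov p (fun z ↦ mfderiv 𝓘(ℝ, E') 𝓘(ℝ, E) p z (B z)) y (A y)) -
      horizontalLift (E' := E') p y
        (pullbackCov cov p (fun z ↦ mfderiv 𝓘(ℝ, E') 𝓘(ℝ, E) p z (A z)) y (B y)) -
        torsionH cov p y (A y) (B y)) := by
  have hsub := h.almost.submersion
  have h1 := pullbackCov_sub_eq_torsion cov hsub.smooth.contMDiffAt hA.diff hB.diff
  have h2 := congrArg (horizontalLift (E' := E') p y) (eq_sub_of_add_eq h1.symm)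
  rw [horizontalLift_sub hsub, horizontalLift_sub hsub] at h2
  rw [torsionH, ← h2, starProjection_vert hsub, horPart]
  abel

theorem IsGivenBy.hasTotallyGeodesicFibres
    (h : IsGivenBy (E' := E') (F := F) cov p σ conjY covY φ conjZ) (hcovY : IsLeviCivita covY) :
    HasTotallyGeodesicFibres F covY φ := by
  have : FiniteDimensional ℝ F := FiniteDimensional.complexToReal F
  intro y X a hX hXv ha
  obtain ⟨A, hA, hAv, rfl⟩ := exists_vertical_field h.submersion ha
  have hAv := Eventually.of_forall (f := 𝓝 y) hAv
  have hXh : ∀ᶠ z in 𝓝 y, X z ∈ (vert E E' p z)ᗮ := hXv.mono fun z hz ↦ h.vert_le z hz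
  have hAh : ∀ᶠ z in 𝓝 y, A z ∈ (vert E E' p z)ᗮ := hAv.mono fun z hz ↦ h.vert_le z hz
  have hbr := mlieBracket_mem_vert (f := φ) h.submersion.smooth.contMDiffAt hA.diff hX.diff hAv hXv
  -- The bracket lies in `ker dφ`, which is horizontal, so the integrability tensor does not
  -- contribute.
  have hpr : (vert E E' p y).starProjection (VectorField.mlieBracket 𝓘(ℝ, E') A X y) = 0 :=
    (Submodule.starProjection_apply_eq_zero_iff _).2 (h.vert_le y hbr)
  have h1 := h.mfderiv_cov hcovY hA hX hAh hXh
  have h2 := h.mlieBracket_eq hA hX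
  have h3 := h.mfderiv_lift_pullbackCov_eq_zero hX hXv hAh.self_of_nhds
  have h4 := h.mfderiv_lift_pullbackCov_eq_zero hA hAv hXh.self_of_nhds
  have h5 : mfderiv 𝓘(ℝ, E') 𝓘(ℝ, F) φ y (VectorField.mlieBracket 𝓘(ℝ, E') A X y) = 0 := hbr
  rw [hpr, zero_add] at h2
  -- In the bracket formula `dφ` kills every term except the torsion, so it kills the torsion too.
  rw [h2, map_sub, map_sub, h3, h4, sub_zero, zero_sub, neg_eq_zero] at h5
  have h6 : mfderiv 𝓘(ℝ, E') 𝓘(ℝ, F) φ y (covY X y (A y)) = 0 := by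
    rw [h1, hpr, smul_zero, zero_add, map_sub, map_smul, h3, h5, smul_zero, sub_zero]
  exact h6

theorem torsionH_self (cov : AffineConnection E M) (y : Y) (u : TangentSpace 𝓘(ℝ, E') y) :
    torsionH cov p y u u = 0 := by
  rw [torsionH, cov.torsion_self]
  exact (eq_horizontalLift (Submodule.zero_mem _) (map_zero _)).symm

theorem torsionH_swap (hp : IsSurjSubmersion E E' p) (y : Y) (u v : TangentSpace 𝓘(ℝ, E') y) :
    torsionH cov p y u v = - torsionH cov p y v u := by
  rw [torsionH, cov.torsion_antisymm, horizontalLift_neg hp, torsionH]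

/-- The vector `i dφ[X', X] - dφ(∇_X X + ∇_X' X')`, for sections `X`, `X' = JX` of `ℋ ∩ 𝒦`. -/
theorem IsGivenBy.tension_horizontal
    (h : IsGivenBy (E' := E') (F := F) cov p σ conjY covY φ conjZ) (hcovY : IsLeviCivita covY) {y : Y}
    {X X' : Π y : Y, TangentSpace 𝓘(ℝ, E') y} (hX : SmoothFieldAt X y) (hX' : SmoothFieldAt X' y)
    (hXh : ∀ᶠ z in 𝓝 y, X z ∈ (vert E E' p z)ᗮ) (hXh' : ∀ᶠ z in 𝓝 y, X' z ∈ (vert E E' p z)ᗮ)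
    (hXX' : ∀ᶠ z in 𝓝 y, mfderiv 𝓘(ℝ, E') 𝓘(ℝ, F) φ z (X' z) =
      mulI (φ z) (mfderiv 𝓘(ℝ, E') 𝓘(ℝ, F) φ z (X z))) :
    mulI (φ y) (mfderiv 𝓘(ℝ, E') 𝓘(ℝ, F) φ y (VectorField.mlieBracket 𝓘(ℝ, E') X' X y)) -
      mfderiv 𝓘(ℝ, E') 𝓘(ℝ, F) φ y (covY X y (X y) + covY X' y (X' y)) =
    mulI (φ y) (mfderiv 𝓘(ℝ, E') 𝓘(ℝ, F) φ y (integrabilityTensor E p y (X y) (X' y) +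
      torsionH cov p y (X y) (X' y))) := by
  have k1 := h.mfderiv_lift_pullbackCov hX hX' hXh hXh' hXX' hXh.self_of_nhds
  have k2 := h.mfderiv_lift_pullbackCov hX hX' hXh hXh' hXX' hXh'.self_of_nhds
  have e1 := h.mfderiv_cov hcovY hX hX hXh hXh
  have e2 := h.mfderiv_cov hcovY hX' hX' hXh' hXh'
  have e3 := h.mlieBracket_eq hX' hX
  have e4 := integrabilityTensor_eq hcovY h.almost.metric h.riemannian hX hX' hXh hXh'
  have e5 := torsionH_swap (cov := cov) h.almost.submersion y (X' y) (X y)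
  rw [VectorField.mlieBracket_swap_apply, map_neg, neg_neg] at e4
  rw [VectorField.mlieBracket_self, torsionH_self] at e1 e2
  simp only [Pi.zero_apply, map_zero, smul_zero, zero_add, sub_zero] at e1 e2
  rw [← e4, e5] at e3
  rw [e1, e2, e3]
  -- By `k1` and `k2`, the lifted derivatives in `i dφ[X', X]` become those of `X` along `X` and of
  -- `X'` along `X'`, and cancel against `dφ(D_X X + D_X' X')`.
  simp only [map_add, map_sub, map_neg, k1, k2, mulI_mulI]
  abel

end Horizontal

/-! ### The Hermitian product of a complexified Euclidean space -/

section Hermitian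

variable {V : Type*} [NormedAddCommGroup V] [InnerProductSpace ℝ V]

theorem conjC_incl_add_inclI (a b : V) : conjC V (incl V a + inclI V b) = incl V a + inclI V (-b) := by
  have : conjC V (incl V a + inclI V b) = LinearMap.rTensor V Complex.conjAe.toLinearMap
    (incl V a + inclI V b) := rfl
  rw [this, map_add]
  simp [incl, inclI, TensorProduct.neg_tmul, TensorProduct.tmul_neg]

theorem hermC_incl_add_inclI (a b c d : V) : hermC (incl V a + inclI V b) (incl V c + inclI V d) =
    ((inner ℝ a c + inner ℝ b d : ℝ) : ℂ) + Complex.I * ((inner ℝ a d - inner ℝ b c : ℝ) : ℂ) := by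
  rw [hermC, conjC_incl_add_inclI, bilC_incl_add_inclI]
  simp only [inner_neg_left, sub_neg_eq_add, ← sub_eq_add_neg]

theorem hermC_add_left (a b c : ℂ ⊗[ℝ] V) : hermC (a + b) c = hermC a c + hermC b c := by
  simp [hermC, bilC]

theorem hermC_smul_left (z : ℂ) (a c : ℂ ⊗[ℝ] V) :
    hermC (z • a) c = (starRingEnd ℂ) z * hermC a c := by
  simp [hermC, bilC, map_smulₛₗ]

theorem hermC_smul_right (z : ℂ) (a c : ℂ ⊗[ℝ] V) : hermC a (z • c) = z * hermC a c := by
  simp [hermC, bilC]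

theorem hermC_sum_left {ι : Type*} (t : Finset ι) (a : ι → ℂ ⊗[ℝ] V) (c : ℂ ⊗[ℝ] V) :
    hermC (∑ i ∈ t, a i) c = ∑ i ∈ t, hermC (a i) c := by
  simp [hermC, bilC]

theorem hermC_sum_right {ι : Type*} (t : Finset ι) (a : ι → ℂ ⊗[ℝ] V) (c : ℂ ⊗[ℝ] V) :
    hermC c (∑ i ∈ t, a i) = ∑ i ∈ t, hermC c (a i) := by
  simp [hermC, bilC]

theorem hermC_conj_symm (a b : ℂ ⊗[ℝ] V) : (starRingEnd ℂ) (hermC b a) = hermC a b := by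
  rw [← incl_rePart_add_inclI_imPart a, ← incl_rePart_add_inclI_imPart b, hermC_incl_add_inclI,
    hermC_incl_add_inclI]
  simp only [map_add, map_mul, Complex.conj_ofReal, Complex.conj_I,
    real_inner_comm (rePart V a), real_inner_comm (imPart V a)]
  push_cast
  ring

theorem hermC_self (a : ℂ ⊗[ℝ] V) : hermC a a =
    ((inner ℝ (rePart V a) (rePart V a) + inner ℝ (imPart V a) (imPart V a) : ℝ) : ℂ) := by
  conv_lhs => rw [← incl_rePart_add_inclI_imPart a, hermC_incl_add_inclI,
    real_inner_comm (rePart V a) (imPart V a), sub_self]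
  simp

/-- The Hermitian inner product of the complexification of a Euclidean space. -/
noncomputable abbrev hermCore (V : Type*) [NormedAddCommGroup V] [InnerProductSpace ℝ V] :
    InnerProductSpace.Core ℂ (ℂ ⊗[ℝ] V) where
  inner := hermC
  conj_inner_symm a b := hermC_conj_symm a b
  re_inner_nonneg a := by
    rw [hermC_self]
    exact add_nonneg real_inner_self_nonneg real_inner_self_nonneg
  add_left := hermC_add_left
  smul_left a b z := hermC_smul_left z a b
  definite a ha := by
    rw [hermC_self, Complex.ofReal_eq_zero] at ha
    have h1 := real_inner_self_nonneg (x := rePart V a)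
    have h2 := real_inner_self_nonneg (x := imPart V a)
    rw [← incl_rePart_add_inclI_imPart a, inner_self_eq_zero.1 (by linarith : inner ℝ (rePart V a)
      (rePart V a) = 0), inner_self_eq_zero.1 (by linarith : inner ℝ (imPart V a) (imPart V a) = 0)]
    simp

open scoped ComplexOrder in
theorem det_hermC_ne_zero {n : Type*} [Fintype n] [DecidableEq n] {v : n → ℂ ⊗[ℝ] V}
    (hv : LinearIndependent ℂ v) : (Matrix.of fun i j ↦ hermC (v i) (v j)).det ≠ 0 := by
  let _ := (hermCore V).toNormedAddCommGroup
  let _ := InnerProductSpace.ofCore (hermCore V).toCore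
  exact (Matrix.posDef_gram_of_linearIndependent (𝕜 := ℂ) hv).det_pos.ne'

theorem exists_unitary_basis [FiniteDimensional ℝ V] (S : Submodule ℂ (ℂ ⊗[ℝ] V)) :
    ∃ (k : ℕ) (ξ : Fin k → ℂ ⊗[ℝ] V), (∀ i j, hermC (ξ i) (ξ j) = if i = j then 1 else 0) ∧
      Submodule.span ℂ (Set.range ξ) = S := by
  let _ := (hermCore V).toNormedAddCommGroup
  let _ := InnerProductSpace.ofCore (hermCore V).toCore
  let b := stdOrthonormalBasis ℂ S
  refine ⟨_, fun i ↦ (b i : ℂ ⊗[ℝ] V), fun i j ↦ ?_, ?_⟩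
  · exact orthonormal_iff_ite.1 b.orthonormal i j
  · have h1 := b.toBasis.span_eq
    have h2 := congrArg (Submodule.map S.subtype) h1
    rw [Submodule.map_span, ← Set.range_comp, Submodule.map_top, Submodule.range_subtype] at h2
    simpa [Function.comp_def] using h2

end Hermitian

/-! ### Components of complex tangent vectors and the Gram matrix -/

section ComplexCoefficients

variable {E : Type*} [NormedAddCommGroup E] [NormedSpace ℝ E] [FiniteDimensional ℝ E]
  {M : Type*} [TopologicalSpace M] [ChartedSpace E M] [IsManifold 𝓘(ℝ, E) ∞ M]

/-- The coefficients of complex tangent vectors with respect to the local frame `frameAt x₀`. -/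
noncomputable def coefC (x₀ x : M) :
    ℂ ⊗[ℝ] TangentSpace 𝓘(ℝ, E) x →ₗ[ℂ] (Fin (Module.finrank ℝ E) → ℂ) :=
  LinearMap.pi fun j ↦ LinearMap.liftBaseChange ℂ
    (Complex.ofRealCLM.toLinearMap ∘ₗ (coefAt x₀ j x).toLinearMap)

/-- The complex tangent vector with given coefficients. -/
noncomputable def combC (x₀ x : M) (c : Fin (Module.finrank ℝ E) → ℂ) :
    ℂ ⊗[ℝ] TangentSpace 𝓘(ℝ, E) x :=
  ∑ j, c j • incl _ (frameAt x₀ j x)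

theorem coefC_incl (x₀ x : M) (u : TangentSpace 𝓘(ℝ, E) x) (j) :
    coefC x₀ x (incl _ u) j = (coefAt x₀ j x u : ℂ) := by
  simp [coefC, incl]

theorem coefC_inclI (x₀ x : M) (u : TangentSpace 𝓘(ℝ, E) x) (j) :
    coefC x₀ x (inclI _ u) j = Complex.I * (coefAt x₀ j x u : ℂ) := by
  simp [coefC, inclI]

theorem coefC_combC {x₀ x : M} (hx : x ∈ (chartAt E x₀).source)
    (c : Fin (Module.finrank ℝ E) → ℂ) : coefC x₀ x (combC x₀ x c) = c := by
  funext i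
  simp [combC, coefC_incl, coefAt_frameAt hx, Finset.sum_apply, apply_ite Complex.ofReal]

theorem rePart_smul_incl {V : Type*} [AddCommGroup V] [Module ℝ V] (z : ℂ) (u : V) :
    rePart V (z • incl V u) = z.re • u := by
  have := smul_incl_add_inclI z u 0
  simp only [map_zero, add_zero, smul_zero, sub_zero, zero_add] at this
  rw [this]
  simp

theorem imPart_smul_incl {V : Type*} [AddCommGroup V] [Module ℝ V] (z : ℂ) (u : V) :
    imPart V (z • incl V u) = z.im • u := by
  have := smul_incl_add_inclI z u 0
  simp only [map_zero, add_zero, smul_zero, sub_zero, zero_add] at this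
  rw [this]
  simp

theorem rePart_combC (x₀ x : M) (c : Fin (Module.finrank ℝ E) → ℂ) :
    rePart _ (combC x₀ x c) = ∑ j, (c j).re • frameAt x₀ j x := by
  simp only [combC, map_sum, rePart_smul_incl]

theorem imPart_combC (x₀ x : M) (c : Fin (Module.finrank ℝ E) → ℂ) :
    imPart _ (combC x₀ x c) = ∑ j, (c j).im • frameAt x₀ j x := by
  simp only [combC, map_sum, imPart_smul_incl]

theorem combC_coefC {x₀ x : M} (hx : x ∈ (chartAt E x₀).source)
    (a : ℂ ⊗[ℝ] TangentSpace 𝓘(ℝ, E) x) : combC x₀ x (coefC x₀ x a) = a := by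
  rw [← incl_rePart_add_inclI_imPart a, ← incl_rePart_add_inclI_imPart (combC _ _ _), rePart_combC,
    imPart_combC]
  simp only [map_add, Pi.add_apply, coefC_incl, coefC_inclI]
  congr 2
  · refine Eq.trans (Finset.sum_congr rfl fun j _ ↦ ?_) (sum_coefAt_smul_frameAt hx _)
    simp
  · refine Eq.trans (Finset.sum_congr rfl fun j _ ↦ ?_) (sum_coefAt_smul_frameAt hx _)
    simp

theorem coefC_injective {x₀ x : M} (hx : x ∈ (chartAt E x₀).source) :
    Function.Injective (coefC (E := E) x₀ x) :=
  Function.LeftInverse.injective (combC_coefC hx)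

variable [RiemannianBundle (fun x : M ↦ TangentSpace 𝓘(ℝ, E) x)]

/-- The matrix of the Riemannian metric in the local frame `frameAt x₀`. -/
noncomputable def gramC (x₀ x : M) :
    Matrix (Fin (Module.finrank ℝ E)) (Fin (Module.finrank ℝ E)) ℂ :=
  Matrix.of fun i j ↦ hermC (incl _ (frameAt x₀ i x)) (incl _ (frameAt x₀ j x))

theorem hermC_combC (x₀ x : M) (c d : Fin (Module.finrank ℝ E) → ℂ) :
    hermC (combC x₀ x c) (combC x₀ x d) = star c ⬝ᵥ (gramC x₀ x).mulVec d := by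
  simp only [combC, hermC_sum_left, hermC_sum_right, hermC_smul_left, hermC_smul_right, dotProduct,
    Matrix.mulVec, gramC, Matrix.of_apply, Pi.star_apply, Finset.mul_sum, RCLike.star_def]
  rw [Finset.sum_comm]
  exact Finset.sum_congr rfl fun i _ ↦ Finset.sum_congr rfl fun j _ ↦ by ring

theorem hermC_eq {x₀ x : M} (hx : x ∈ (chartAt E x₀).source)
    (a b : ℂ ⊗[ℝ] TangentSpace 𝓘(ℝ, E) x) :
    hermC a b = star (coefC x₀ x a) ⬝ᵥ (gramC x₀ x).mulVec (coefC x₀ x b) := by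
  rw [← hermC_combC, combC_coefC hx, combC_coefC hx]

theorem gramC_apply (x₀ x : M) (i j) :
    gramC (E := E) x₀ x i j = ((inner ℝ (frameAt x₀ i x) (frameAt x₀ j x) : ℝ) : ℂ) := by
  have := hermC_incl_add_inclI (frameAt x₀ i x) 0 (frameAt x₀ j x) 0
  simp only [map_zero, add_zero, inner_zero_right, inner_zero_left, sub_zero, Complex.ofReal_zero,
    mul_zero] at this
  exact this

theorem gramC_isHermitian (x₀ x : M) : (gramC (E := E) x₀ x).conjTranspose = gramC x₀ x := by
  ext i j
  rw [Matrix.conjTranspose_apply, gramC, Matrix.of_apply, Matrix.of_apply, RCLike.star_def,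
    hermC_conj_symm]

theorem det_gramC_ne_zero {x₀ x : M} (hx : x ∈ (chartAt E x₀).source) :
    (gramC (E := E) x₀ x).det ≠ 0 := by
  refine det_hermC_ne_zero (Fintype.linearIndependent_iff.2 fun c hc i ↦ ?_)
  have h1 : coefC x₀ x (combC x₀ x c) = 0 := by
    rw [combC, hc, map_zero]
  rw [coefC_combC hx] at h1
  exact congrFun h1 i

end ComplexCoefficients

/-! ### Derivatives of matrix valued functions -/

section MatrixDerivative

variable {E' : Type*} [NormedAddCommGroup E'] [NormedSpace ℝ E'] [FiniteDimensional ℝ E']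
  {N : Type*} [TopologicalSpace N] [ChartedSpace E' N] [IsManifold 𝓘(ℝ, E') ∞ N]
  {l m n : Type*}

theorem mvfderiv_clm_comp {G H : Type*} [NormedAddCommGroup G] [NormedSpace ℝ G]
    [NormedAddCommGroup H] [NormedSpace ℝ H] (L : G →L[ℝ] H) {g : N → G} {z : N}
    (hg : MDifferentiableAt 𝓘(ℝ, E') 𝓘(ℝ, G) g z) (v : TangentSpace 𝓘(ℝ, E') z) :
    mvfderiv 𝓘(ℝ, E') (fun z ↦ L (g z)) z v = L (mvfderiv 𝓘(ℝ, E') g z v) := by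
  have h1 : MDifferentiableAt 𝓘(ℝ, G) 𝓘(ℝ, H) L (g z) :=
    L.differentiableAt.mdifferentiableAt
  have h2 := mfderiv_comp_apply z h1 hg v
  rw [mfderiv_eq_fderiv, L.fderiv] at h2
  exact h2

theorem mvfderiv_mul_complex {f g : N → ℂ} {z : N}
    (hf : MDifferentiableAt 𝓘(ℝ, E') 𝓘(ℝ, ℂ) f z) (hg : MDifferentiableAt 𝓘(ℝ, E') 𝓘(ℝ, ℂ) g z)
    (v : TangentSpace 𝓘(ℝ, E') z) :
    mvfderiv 𝓘(ℝ, E') (fun z ↦ f z * g z) z v =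
      mvfderiv 𝓘(ℝ, E') f z v * g z + f z * mvfderiv 𝓘(ℝ, E') g z v := by
  have h := (hf.hasMFDerivAt.mul hg.hasMFDerivAt).mfderiv
  have h2 := congrArg (fun L : E' →L[ℝ] ℂ ↦ L v) h
  refine Eq.trans h2 ?_
  refine (add_comm _ _).trans ?_
  congr 1
  exact mul_comm _ _

/-- The entries of the matrix valued function `P` are smooth at `z`. -/
def SmoothMatAt (P : N → Matrix m n ℂ) (z : N) : Prop :=
  ∀ i j, ContMDiffAt 𝓘(ℝ, E') 𝓘(ℝ, ℂ) ∞ (fun z ↦ P z i j) z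

/-- The entries of the matrix valued function `P` are differentiable at `z`. -/
def DiffMatAt (P : N → Matrix m n ℂ) (z : N) : Prop :=
  ∀ i j, MDifferentiableAt 𝓘(ℝ, E') 𝓘(ℝ, ℂ) (fun z ↦ P z i j) z

theorem SmoothMatAt.diff {P : N → Matrix m n ℂ} {z : N} (h : SmoothMatAt (E' := E') P z) :
    DiffMatAt (E' := E') P z := fun i j ↦ (h i j).mdifferentiableAt (by simp)

/-- The derivative of a matrix valued function. -/
noncomputable def dMat (P : N → Matrix m n ℂ) (z : N) (v : TangentSpace 𝓘(ℝ, E') z) : Matrix m n ℂ :=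
  Matrix.of fun i j ↦ mvfderiv 𝓘(ℝ, E') (fun z ↦ P z i j) z v

theorem dMat_add_vec (P : N → Matrix m n ℂ) (z : N) (v w : TangentSpace 𝓘(ℝ, E') z) :
    dMat P z (v + w) = dMat P z v + dMat P z w := by
  ext i j; simp [dMat]

theorem dMat_congr {P P' : N → Matrix m n ℂ} {z : N} (h : P =ᶠ[𝓝 z] P')
    (v : TangentSpace 𝓘(ℝ, E') z) : dMat P z v = dMat P' z v := by
  ext i j
  simp only [dMat, Matrix.of_apply]
  rw [mvfderiv_congr (g := fun z ↦ P z i j) (h := fun z ↦ P' z i j) (h.mono fun z hz ↦ by simp only [hz])]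

theorem DiffMatAt.mul [Fintype m] {P : N → Matrix l m ℂ} {P' : N → Matrix m n ℂ} {z : N}
    (h : DiffMatAt (E' := E') P z) (h' : DiffMatAt (E' := E') P' z) :
    DiffMatAt (E' := E') (fun z ↦ P z * P' z) z := fun i j ↦ by
  simp only [Matrix.mul_apply]
  exact (mvfderiv_sum (g := fun k z ↦ P z i k * P' z k j) _ fun k _ ↦ (h i k).mul (h' k j)).1

theorem dMat_mul [Fintype m] {P : N → Matrix l m ℂ} {P' : N → Matrix m n ℂ} {z : N}
    (h : DiffMatAt (E' := E') P z) (h' : DiffMatAt (E' := E') P' z) (v : TangentSpace 𝓘(ℝ, E') z) :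
    dMat (fun z ↦ P z * P' z) z v = dMat P z v * P' z + P z * dMat P' z v := by
  ext i j
  simp only [dMat, Matrix.of_apply, Matrix.mul_apply, Matrix.add_apply]
  rw [(mvfderiv_sum (g := fun k z ↦ P z i k * P' z k j) _ fun k _ ↦ (h i k).mul (h' k j)).2, sum_apply,
    ← Finset.sum_add_distrib]
  exact Finset.sum_congr rfl fun k _ ↦ mvfderiv_mul_complex (h i k) (h' k j) v

theorem dMat_sub {P P' : N → Matrix m n ℂ} {z : N}
    (h : DiffMatAt (E' := E') P z) (h' : DiffMatAt (E' := E') P' z) (v : TangentSpace 𝓘(ℝ, E') z) :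
    dMat (fun z ↦ P z - P' z) z v = dMat P z v - dMat P' z v := by
  ext i j
  simp only [dMat, Matrix.of_apply, Matrix.sub_apply]
  rw [mvfderiv_fun_sub (h i j) (h' i j)]
  rfl

theorem DiffMatAt.sub {P P' : N → Matrix m n ℂ} {z : N}
    (h : DiffMatAt (E' := E') P z) (h' : DiffMatAt (E' := E') P' z) :
    DiffMatAt (E' := E') (fun z ↦ P z - P' z) z := fun i j ↦ (h i j).sub (h' i j)

theorem DiffMatAt.smul (c : ℂ) {P : N → Matrix m n ℂ} {z : N} (h : DiffMatAt (E' := E') P z) :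
    DiffMatAt (E' := E') (fun z ↦ c • P z) z := fun i j ↦
  (mdifferentiableAt_const (c := c)).mul (h i j)

theorem dMat_smul (c : ℂ) {P : N → Matrix m n ℂ} {z : N}
    (h : DiffMatAt (E' := E') P z) (v : TangentSpace 𝓘(ℝ, E') z) :
    dMat (fun z ↦ c • P z) z v = c • dMat P z v := by
  ext i j
  simp only [dMat, Matrix.of_apply, Matrix.smul_apply, smul_eq_mul]
  rw [mvfderiv_mul_complex mdifferentiableAt_const (h i j), mvfderiv_const]
  simp

theorem dMat_conjTranspose {P : N → Matrix m n ℂ} {z : N}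
    (h : DiffMatAt (E' := E') P z) (v : TangentSpace 𝓘(ℝ, E') z) :
    dMat (fun z ↦ (P z).conjTranspose) z v = (dMat P z v).conjTranspose := by
  ext i j
  simp only [dMat, Matrix.of_apply, Matrix.conjTranspose_apply]
  exact mvfderiv_clm_comp (Complex.conjCLE : ℂ →L[ℝ] ℂ) (h j i) v

theorem DiffMatAt.conjTranspose {P : N → Matrix m n ℂ} {z : N}
    (h : DiffMatAt (E' := E') P z) : DiffMatAt (E' := E') (fun z ↦ (P z).conjTranspose) z := fun i j ↦
  (Complex.conjCLE : ℂ →L[ℝ] ℂ).differentiableAt.mdifferentiableAt.comp z (h j i)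

theorem mvfderiv_re_trace [Fintype n] {P : N → Matrix n n ℂ} {z : N}
    (h : DiffMatAt (E' := E') P z) (v : TangentSpace 𝓘(ℝ, E') z) :
    mvfderiv 𝓘(ℝ, E') (fun z ↦ (P z).trace.re) z v = (dMat P z v).trace.re := by
  have h1 := mvfderiv_sum (g := fun i z ↦ P z i i) Finset.univ fun i _ ↦ h i i
  have h2 := mvfderiv_clm_comp Complex.reCLM h1.1 v
  rw [h1.2, sum_apply] at h2
  exact h2

theorem SmoothMatAt.mul [Fintype m] {P : N → Matrix l m ℂ} {P' : N → Matrix m n ℂ} {z : N}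
    (h : SmoothMatAt (E' := E') P z) (h' : SmoothMatAt (E' := E') P' z) :
    SmoothMatAt (E' := E') (fun z ↦ P z * P' z) z := fun i j ↦ by
  simp only [Matrix.mul_apply]
  exact contMDiffAt_fun_sum fun k _ ↦ contMDiffAt_fun_mul (h i k) (h' k j)

theorem SmoothMatAt.conjTranspose {P : N → Matrix m n ℂ} {z : N}
    (h : SmoothMatAt (E' := E') P z) :
    SmoothMatAt (E' := E') (fun z ↦ (P z).conjTranspose) z := fun i j ↦
  (Complex.conjCLE : ℂ →L[ℝ] ℂ).contMDiff.contMDiffAt.comp z (h j i)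

theorem SmoothMatAt.congr {P P' : N → Matrix m n ℂ} {z : N} (h : SmoothMatAt (E' := E') P z)
    (e : P' =ᶠ[𝓝 z] P) : SmoothMatAt (E' := E') P' z := fun i j ↦
  (h i j).congr_of_eventuallyEq (e.mono fun z hz ↦ by simp only [hz])

theorem SmoothMatAt.dMat {P : N → Matrix m n ℂ} {z : N} (h : SmoothMatAt (E' := E') P z)
    {X : Π z : N, TangentSpace 𝓘(ℝ, E') z} (hX : SmoothFieldAt X z) :
    SmoothMatAt (E' := E') (fun z ↦ RTwist.dMat P z (X z)) z := fun i j ↦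
  contMDiffAt_mvfderiv_apply (h i j) hX

theorem dMat_mlieBracket {P : N → Matrix m n ℂ} {z : N} (h : SmoothMatAt (E' := E') P z)
    {A B : Π z : N, TangentSpace 𝓘(ℝ, E') z} (hA : SmoothFieldAt A z) (hB : SmoothFieldAt B z) :
    dMat P z (VectorField.mlieBracket 𝓘(ℝ, E') A B z) =
      dMat (fun z ↦ dMat P z (B z)) z (A z) - dMat (fun z ↦ dMat P z (A z)) z (B z) := by
  ext i j
  exact mvfderiv_mlieBracket (h i j) hA.diff hB.diff

end MatrixDerivative

/-! ### Matrices of Hermitian projections -/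

section Projection

variable {E : Type*} [NormedAddCommGroup E] [NormedSpace ℝ E] [FiniteDimensional ℝ E]
  {M : Type*} [TopologicalSpace M] [ChartedSpace E M] [IsManifold 𝓘(ℝ, E) ∞ M]
  [RiemannianBundle (fun x : M ↦ TangentSpace 𝓘(ℝ, E) x)]
  [IsContMDiffRiemannianBundle 𝓘(ℝ, E) ∞ E (fun x : M ↦ TangentSpace 𝓘(ℝ, E) x)]

/-- The matrix whose columns are the coefficients of given complex tangent vectors. -/
noncomputable def coefMat (x₀ x : M) {k : ℕ} (s : Fin k → ℂ ⊗[ℝ] TangentSpace 𝓘(ℝ, E) x) :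
    Matrix (Fin (Module.finrank ℝ E)) (Fin k) ℂ :=
  Matrix.of fun j i ↦ coefC x₀ x (s i) j

theorem coefMat_gram {x₀ x : M} (hx : x ∈ (chartAt E x₀).source) {k : ℕ}
    (s : Fin k → ℂ ⊗[ℝ] TangentSpace 𝓘(ℝ, E) x) :
    (coefMat x₀ x s).conjTranspose * gramC (E := E) x₀ x * coefMat x₀ x s =
      Matrix.of fun i j ↦ hermC (s i) (s j) := by
  ext i j
  rw [Matrix.of_apply, hermC_eq hx, Matrix.mul_assoc, Matrix.mul_apply]
  rfl

/-- Characterization of the matrix of the Hermitian projection onto a complex subspace. -/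
structure IsProjMat (x₀ x : M) (S : Submodule ℂ (ℂ ⊗[ℝ] TangentSpace 𝓘(ℝ, E) x))
    (P : Matrix (Fin (Module.finrank ℝ E)) (Fin (Module.finrank ℝ E)) ℂ) : Prop where
  idem : P * P = P
  adj : P.conjTranspose * gramC x₀ x = gramC x₀ x * P
  mem_iff : ∀ a, a ∈ S ↔ P.mulVec (coefC x₀ x a) = coefC x₀ x a

/-- The columns of `P` are components of vectors of `S`, and `P'` fixes these. -/
theorem IsProjMat.mul_eq {x₀ x : M} (hx : x ∈ (chartAt E x₀).source)
    {S : Submodule ℂ (ℂ ⊗[ℝ] TangentSpace 𝓘(ℝ, E) x)}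
    {P P' : Matrix (Fin (Module.finrank ℝ E)) (Fin (Module.finrank ℝ E)) ℂ}
    (h : IsProjMat x₀ x S P) (h' : IsProjMat x₀ x S P') : P' * P = P := by
  refine Matrix.ext_of_mulVec_single fun i ↦ ?_
  rw [← Matrix.mulVec_mulVec]
  have h1 : combC x₀ x (P.mulVec (Pi.single i 1)) ∈ S := by
    rw [h.mem_iff, coefC_combC hx, Matrix.mulVec_mulVec, h.idem]
  rw [h'.mem_iff, coefC_combC hx] at h1
  exact h1

theorem isUnit_gramC {x₀ x : M} (hx : x ∈ (chartAt E x₀).source) : IsUnit (gramC (E := E) x₀ x) :=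
  (Matrix.isUnit_iff_isUnit_det _).2 (det_gramC_ne_zero hx).isUnit

/-- Taking adjoints with respect to `G` in `P P' = P'` gives `P' P = P'`, while `P' P = P`. -/
theorem IsProjMat.unique {x₀ x : M} (hx : x ∈ (chartAt E x₀).source)
    {S : Submodule ℂ (ℂ ⊗[ℝ] TangentSpace 𝓘(ℝ, E) x)}
    {P P' : Matrix (Fin (Module.finrank ℝ E)) (Fin (Module.finrank ℝ E)) ℂ}
    (h : IsProjMat x₀ x S P) (h' : IsProjMat x₀ x S P') : P = P' := by
  have h1 := congrArg (fun A ↦ A.conjTranspose * gramC x₀ x) (h'.mul_eq hx h)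
  simp only [Matrix.conjTranspose_mul] at h1
  rw [Matrix.mul_assoc, h.adj, ← Matrix.mul_assoc, h'.adj, Matrix.mul_assoc, h.mul_eq hx h'] at h1
  exact (isUnit_gramC hx).mul_left_cancel h1

/-- The classical formula `B (B^* G B)⁻¹ B^* G` for the projection onto the span of the columns of
`B`. It is smooth in `B`, and for a unitary basis the inverse disappears. -/
theorem isProjMat_of_span {x₀ x : M} (hx : x ∈ (chartAt E x₀).source) {k : ℕ}
    {s : Fin k → ℂ ⊗[ℝ] TangentSpace 𝓘(ℝ, E) x} {S : Submodule ℂ (ℂ ⊗[ℝ] TangentSpace 𝓘(ℝ, E) x)}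
    (hs : Submodule.span ℂ (Set.range s) = S)
    (hdet : ((coefMat x₀ x s).conjTranspose * gramC (E := E) x₀ x * coefMat x₀ x s).det ≠ 0) :
    IsProjMat x₀ x S (coefMat x₀ x s *
      ((coefMat x₀ x s).conjTranspose * gramC (E := E) x₀ x * coefMat x₀ x s)⁻¹ *
        ((coefMat x₀ x s).conjTranspose * gramC (E := E) x₀ x)) := by
  set B := coefMat x₀ x s with hB
  set G := gramC (E := E) x₀ x with hG
  have hGh : G.conjTranspose = G := gramC_isHermitian x₀ x
  set Γ := B.conjTranspose * G * B with hΓ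
  have hΓh : Γ⁻¹.conjTranspose = Γ⁻¹ := by
    rw [Matrix.conjTranspose_nonsing_inv, hΓ, Matrix.conjTranspose_mul, Matrix.conjTranspose_mul, hGh,
      Matrix.conjTranspose_conjTranspose, Matrix.mul_assoc]
  have hPB : B * Γ⁻¹ * (B.conjTranspose * G) * B = B := by
    rw [Matrix.mul_assoc, ← hΓ, Matrix.mul_assoc, Matrix.nonsing_inv_mul _ hdet.isUnit, Matrix.mul_one]
  have hBu : ∀ u : Fin k → ℂ, B.mulVec u = coefC x₀ x (∑ i, u i • s i) := by
    intro u
    funext j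
    simp [hB, coefMat, Matrix.mulVec, dotProduct, mul_comm]
  refine ⟨?_, ?_, fun a ↦ ⟨fun ha ↦ ?_, fun ha ↦ ?_⟩⟩
  · rw [← Matrix.mul_assoc (B * Γ⁻¹ * (B.conjTranspose * G)), ← Matrix.mul_assoc _ B, hPB]
  · change _ * G = G * _
    simp only [Matrix.conjTranspose_mul, hΓh, hGh, Matrix.conjTranspose_conjTranspose,
      Matrix.mul_assoc]
  · rw [← hs] at ha
    obtain ⟨u, rfl⟩ := (Submodule.mem_span_range_iff_exists_fun ℂ).1 ha
    rw [← hBu, Matrix.mulVec_mulVec, hPB]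
  · rw [Matrix.mul_assoc, ← Matrix.mulVec_mulVec, hBu] at ha
    rw [← coefC_injective hx ha, ← hs]
    exact Submodule.sum_mem _ fun i _ ↦ Submodule.smul_mem _ _ (Submodule.subset_span ⟨i, rfl⟩)

end Projection

section ProjectionMatrix

variable {E : Type*} [NormedAddCommGroup E] [NormedSpace ℝ E] [FiniteDimensional ℝ E]
  {M : Type*} [TopologicalSpace M] [ChartedSpace E M] [IsManifold 𝓘(ℝ, E) ∞ M]
  [RiemannianBundle (fun x : M ↦ TangentSpace 𝓘(ℝ, E) x)]
  [IsContMDiffRiemannianBundle 𝓘(ℝ, E) ∞ E (fun x : M ↦ TangentSpace 𝓘(ℝ, E) x)]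

/-- The matrix, in the local frame `frameAt x₀`, of the Hermitian projection onto `S`. -/
noncomputable def projMat (x₀ x : M) (S : Submodule ℂ (ℂ ⊗[ℝ] TangentSpace 𝓘(ℝ, E) x)) :
    Matrix (Fin (Module.finrank ℝ E)) (Fin (Module.finrank ℝ E)) ℂ :=
  let ξ := (exists_unitary_basis S).choose_spec.choose
  coefMat x₀ x ξ * ((coefMat x₀ x ξ).conjTranspose * gramC (E := E) x₀ x)

theorem isProjMat_of_unitary {x₀ x : M} (hx : x ∈ (chartAt E x₀).source)
    {S : Submodule ℂ (ℂ ⊗[ℝ] TangentSpace 𝓘(ℝ, E) x)} {k : ℕ}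
    {ξ : Fin k → ℂ ⊗[ℝ] TangentSpace 𝓘(ℝ, E) x}
    (hξ : ∀ i j, hermC (ξ i) (ξ j) = if i = j then 1 else 0)
    (hS : Submodule.span ℂ (Set.range ξ) = S) :
    IsProjMat x₀ x S (coefMat x₀ x ξ * ((coefMat x₀ x ξ).conjTranspose * gramC (E := E) x₀ x)) := by
  have h1 : (coefMat x₀ x ξ).conjTranspose * gramC (E := E) x₀ x * coefMat x₀ x ξ = 1 := by
    rw [coefMat_gram hx]
    ext i j
    rw [Matrix.of_apply, hξ, Matrix.one_apply]
  have h2 := isProjMat_of_span hx hS (by rw [h1, Matrix.det_one]; exact one_ne_zero)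
  rwa [h1, inv_one, Matrix.mul_one] at h2

theorem isProjMat_projMat {x₀ x : M} (hx : x ∈ (chartAt E x₀).source)
    (S : Submodule ℂ (ℂ ⊗[ℝ] TangentSpace 𝓘(ℝ, E) x)) : IsProjMat x₀ x S (projMat x₀ x S) :=
  isProjMat_of_unitary hx (exists_unitary_basis S).choose_spec.choose_spec.1
    (exists_unitary_basis S).choose_spec.choose_spec.2

variable {E' : Type*} [NormedAddCommGroup E'] [NormedSpace ℝ E'] [FiniteDimensional ℝ E']
  {Y : Type*} [TopologicalSpace Y] [ChartedSpace E' Y] [IsManifold 𝓘(ℝ, E') ∞ Y]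

theorem smoothMatAt_gramC {x₀ : M} {p : Y → M} {y : Y} (hp : ContMDiffAt 𝓘(ℝ, E') 𝓘(ℝ, E) ∞ p y)
    (hy : p y ∈ (chartAt E x₀).source) :
    SmoothMatAt (E' := E') (fun z ↦ gramC (E := E) x₀ (p z)) y := fun i j ↦ by
  simp only [gramC_apply]
  exact Complex.ofRealCLM.contMDiff.contMDiffAt.comp y
    (((smoothFieldAt_frameAt hy i).comp hp).inner ((smoothFieldAt_frameAt hy j).comp hp))

theorem coefC_eq (x₀ x : M) (a : ℂ ⊗[ℝ] TangentSpace 𝓘(ℝ, E) x) (j) : coefC x₀ x a j =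
    (coefAt x₀ j x (rePart _ a) : ℂ) + Complex.I * (coefAt x₀ j x (imPart _ a) : ℂ) := by
  conv_lhs => rw [← incl_rePart_add_inclI_imPart a, map_add, Pi.add_apply, coefC_incl, coefC_inclI]

theorem contMDiffAt_coefC {x₀ : M} {p : Y → M} {y : Y} (hy : p y ∈ (chartAt E x₀).source)
    {s : Π y : Y, ℂ ⊗[ℝ] TangentSpace 𝓘(ℝ, E) (p y)}
    (h1 : SmoothSecAt (E' := E') p (fun y' ↦ rePart _ (s y')) y)
    (h2 : SmoothSecAt (E' := E') p (fun y' ↦ imPart _ (s y')) y) (j) :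
    ContMDiffAt 𝓘(ℝ, E') 𝓘(ℝ, ℂ) ∞ (fun z ↦ coefC x₀ (p z) (s z) j) y := by
  simp only [coefC_eq]
  exact (Complex.ofRealCLM.contMDiff.contMDiffAt.comp y (h1.coefAt hy j)).add
    (contMDiffAt_fun_mul contMDiffAt_const
      (Complex.ofRealCLM.contMDiff.contMDiffAt.comp y (h2.coefAt hy j)))

/-- The unitary bases in the definition of `projMat` are chosen pointwise, without regularity. By
uniqueness of the projection they can be replaced by a smooth local frame of `σ`. -/
theorem smoothMatAt_projMat {x₀ : M} {p : Y → M}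
    {σ : Π y : Y, Submodule ℂ (ℂ ⊗[ℝ] TangentSpace 𝓘(ℝ, E) (p y))} {y : Y}
    (hp : ContMDiffAt 𝓘(ℝ, E') 𝓘(ℝ, E) ∞ p y) (hy : p y ∈ (chartAt E x₀).source) {k : ℕ}
    {s : Fin k → Π y : Y, ℂ ⊗[ℝ] TangentSpace 𝓘(ℝ, E) (p y)}
    (hs : ∀ i, IsLocalSection (E' := E') σ (s i) y)
    (hsσ : ∀ᶠ y' in 𝓝 y, LinearIndependent ℂ (fun i ↦ s i y') ∧
      Submodule.span ℂ (Set.range fun i ↦ s i y') = σ y') :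
    SmoothMatAt (E' := E') (fun z ↦ projMat x₀ (p z) (σ z)) y := by
  have hB : SmoothMatAt (E' := E') (fun z ↦ coefMat x₀ (p z) fun i ↦ s i z) y := fun j i ↦
    contMDiffAt_coefC hy (hs i).smooth_re (hs i).smooth_im j
  have hBG := hB.conjTranspose.mul (smoothMatAt_gramC hp hy)
  have hdet : ∀ z, p z ∈ (chartAt E x₀).source → LinearIndependent ℂ (fun i ↦ s i z) →
      ((coefMat x₀ (p z) fun i ↦ s i z).conjTranspose * gramC (E := E) x₀ (p z) *
        coefMat x₀ (p z) fun i ↦ s i z).det ≠ 0 := fun z hz hl ↦ by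
    rw [coefMat_gram hz]
    exact det_hermC_ne_zero hl
  have h1 : SmoothMatAt (E' := E') (fun z ↦ ((coefMat x₀ (p z) fun i ↦ s i z).conjTranspose *
      gramC (E := E) x₀ (p z) * coefMat x₀ (p z) fun i ↦ s i z)⁻¹) y := fun i j ↦
    contMDiffAt_matrix_inv (hBG.mul hB) (hdet y hy hsσ.self_of_nhds.1) i j
  refine ((hB.mul h1).mul hBG).congr ?_
  filter_upwards [hsσ, hp.continuousAt.eventually ((chartAt E x₀).open_source.mem_nhds hy)]
    with z hz hz'
  exact (isProjMat_projMat hz' _).unique hz' (isProjMat_of_span hz' hz.2 (hdet z hz' hz.1))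

theorem mvfderiv_comp_vert {G : Type*} [NormedAddCommGroup G] [NormedSpace ℝ G] {p : Y → M} {y : Y}
    {g : M → G} (hg : MDifferentiableAt 𝓘(ℝ, E) 𝓘(ℝ, G) g (p y))
    (hp : MDifferentiableAt 𝓘(ℝ, E') 𝓘(ℝ, E) p y) {v : TangentSpace 𝓘(ℝ, E') y}
    (hv : v ∈ vert E E' p y) : mvfderiv 𝓘(ℝ, E') (fun z ↦ g (p z)) y v = 0 := by
  have h := mfderiv_comp_apply y hg hp v
  have hv : mfderiv 𝓘(ℝ, E') 𝓘(ℝ, E) p y v = 0 := hv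
  rw [hv, map_zero] at h
  exact h

theorem dMat_gramC_vert {x₀ : M} {p : Y → M} {y : Y} (hp : ContMDiffAt 𝓘(ℝ, E') 𝓘(ℝ, E) ∞ p y)
    (hy : p y ∈ (chartAt E x₀).source) {v : TangentSpace 𝓘(ℝ, E') y} (hv : v ∈ vert E E' p y) :
    dMat (fun z ↦ gramC (E := E) x₀ (p z)) y v = 0 := by
  ext i j
  exact mvfderiv_comp_vert (g := fun x ↦ gramC (E := E) x₀ x i j)
    ((smoothMatAt_gramC (p := (id : M → M)) contMDiffAt_id hy i j).mdifferentiableAt (by simp))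
    (hp.mdifferentiableAt (by simp)) hv

theorem smoothSecAt_combC {x₀ : M} {p : Y → M} {y : Y} (hp : ContMDiffAt 𝓘(ℝ, E') 𝓘(ℝ, E) ∞ p y)
    (hy : p y ∈ (chartAt E x₀).source) {c : Y → Fin (Module.finrank ℝ E) → ℂ}
    (hc : ∀ j, ContMDiffAt 𝓘(ℝ, E') 𝓘(ℝ, ℂ) ∞ (fun z ↦ c z j) y) :
    SmoothSecAt (E' := E') p (fun z ↦ rePart _ (combC x₀ (p z) (c z))) y ∧
      SmoothSecAt (E' := E') p (fun z ↦ imPart _ (combC x₀ (p z) (c z))) y := by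
  simp only [rePart_combC, imPart_combC]
  exact ⟨SmoothSecAt.sum _ hp fun j _ ↦ ((smoothFieldAt_frameAt hy j).comp hp).smul
      (Complex.reCLM.contMDiff.contMDiffAt.comp y (hc j)),
    SmoothSecAt.sum _ hp fun j _ ↦ ((smoothFieldAt_frameAt hy j).comp hp).smul
      (Complex.imCLM.contMDiff.contMDiffAt.comp y (hc j))⟩

/-- The frame is pulled back from `M`, so along the fibres only the coefficients are differentiated;
in particular the connection plays no role there. -/
theorem pullbackCovC_combC_vert (cov : AffineConnection E M) {x₀ : M} {p : Y → M} {y : Y}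
    (hp : ContMDiffAt 𝓘(ℝ, E') 𝓘(ℝ, E) ∞ p y)
    (hy : p y ∈ (chartAt E x₀).source) {c : Y → Fin (Module.finrank ℝ E) → ℂ}
    (hc : ∀ j, ContMDiffAt 𝓘(ℝ, E') 𝓘(ℝ, ℂ) ∞ (fun z ↦ c z j) y)
    {v : TangentSpace 𝓘(ℝ, E') y} (hv : v ∈ vert E E' p y) :
    pullbackCovC cov p (fun z ↦ combC x₀ (p z) (c z)) y (incl _ v) =
      combC x₀ (p y) fun j ↦ mvfderiv 𝓘(ℝ, E') (fun z ↦ c z j) y v := by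
  have hev := hp.continuousAt.eventually ((chartAt E x₀).open_source.mem_nhds hy)
  have hd := fun j ↦ (hc j).mdifferentiableAt (show (∞ : WithTop ℕ∞) ≠ 0 by simp)
  have e : ∀ {x : M} (hx : x ∈ (chartAt E x₀).source) (d : Fin (Module.finrank ℝ E) → ℝ) (j),
      coefAt x₀ j x (∑ i, d i • frameAt x₀ i x) = d j := fun hx d j ↦ by
    simp [coefAt_frameAt hx]
  rw [pullbackCovC_incl, pullbackCov_vert cov (smoothSecAt_combC hp hy hc).1 hy hv,
    pullbackCov_vert cov (smoothSecAt_combC hp hy hc).2 hy hv,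
    ← incl_rePart_add_inclI_imPart (combC x₀ (p y) _), rePart_combC, imPart_combC]
  congr 2
  · refine Finset.sum_congr rfl fun j _ ↦ ?_
    congr 1
    refine Eq.trans ?_ (mvfderiv_clm_comp Complex.reCLM (hd j) v)
    rw [mvfderiv_congr (h := fun z ↦ Complex.reCLM (c z j))]
    filter_upwards [hev] with z hz
    rw [rePart_combC, e hz]
    rfl
  · refine Finset.sum_congr rfl fun j _ ↦ ?_
    congr 1
    refine Eq.trans ?_ (mvfderiv_clm_comp Complex.imCLM (hd j) v)
    rw [mvfderiv_congr (h := fun z ↦ Complex.imCLM (c z j))]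
    filter_upwards [hev] with z hz
    rw [imPart_combC, e hz]
    rfl

end ProjectionMatrix

/-! ### Tangent vectors of the Grassmannian as off-diagonal matrices -/

section Idempotent

variable {n : Type*} [Fintype n] {P Q Q' G : Matrix n n ℂ}

/-- The condition on `Q` is the derivative of `P² = P`; it says that `Q` has no diagonal blocks with
respect to `P`. -/
theorem idem_mul_deriv_mul (hP : P * P = P) (hQ : Q = Q * P + P * Q) : P * Q * P = 0 := by
  have h1 : P * Q * P = P * Q * P + P * Q * P := by
    conv_lhs => rw [hQ]
    rw [Matrix.mul_add, Matrix.add_mul, Matrix.mul_assoc P (Q * P) P, Matrix.mul_assoc Q, hP,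
      ← Matrix.mul_assoc P P, hP, ← Matrix.mul_assoc]
  simpa using h1

/-- A complex linearity property of the tangent spaces of the Grassmannian. -/
theorem deriv_eq_of_mul_eq [DecidableEq n] (hG : IsUnit G)
    (hPG : P.conjTranspose * G = G * P)
    (hQ : Q = Q * P + P * Q) (hQ' : Q' = Q' * P + P * Q')
    (hQG : Q.conjTranspose * G = G * Q) (hQG' : Q'.conjTranspose * G = G * Q')
    (h : P * (Q + Complex.I • Q') = Q + Complex.I • Q') :
    Q' = Complex.I • (Q * P - P * Q) := by
  -- `Q + iQ'` is off-diagonal with range in that of `P`, so it kills the range of `P`.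
  have h1 : Q * P + Complex.I • (Q' * P) = 0 := by
    have h2 : Q + Complex.I • Q' = (Q * P + Complex.I • (Q' * P)) + P * (Q + Complex.I • Q') := by
      conv_lhs => rw [hQ, hQ']
      rw [Matrix.mul_add, Matrix.mul_smul, smul_add]
      abel
    rw [h] at h2
    simpa using h2
  have h3 : Q' * P = Complex.I • (Q * P) := by
    have h4 := congrArg (Complex.I • ·) h1
    simp only [smul_add, smul_smul, Complex.I_mul_I, smul_zero, neg_one_smul] at h4
    exact (add_neg_eq_zero.1 h4).symm
  have h5 : P * Q' = -(Complex.I • (P * Q)) := by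
    refine hG.mul_left_cancel ?_
    have h6 := congrArg (fun A ↦ A.conjTranspose * G) h3
    simp only [Matrix.conjTranspose_mul, Matrix.conjTranspose_smul, RCLike.star_def, Complex.conj_I,
      Matrix.neg_mul, Matrix.smul_mul, Matrix.mul_assoc, hQG, hQG', neg_smul] at h6
    rw [← Matrix.mul_assoc, hPG, ← Matrix.mul_assoc P.conjTranspose, hPG] at h6
    rw [Matrix.mul_neg, Matrix.mul_smul, ← Matrix.mul_assoc, h6, Matrix.mul_assoc]
  rw [hQ', h3, h5, smul_sub, sub_eq_add_neg]

/-- An off-diagonal `Q` interchanges the two blocks, which therefore contribute equally to the trace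
of `Q²`. This is the source of the factor `c / 2` in the fibre metric. -/
theorem trace_mul_self_idem (hQ : Q = Q * P + P * Q) :
    (Q * Q).trace = 2 * (Q * Q * P).trace := by
  have h1 : Q * Q = Q * Q * P + Q * (P * Q) := by
    conv_lhs => rw [hQ]
    conv_rhs => rw [Matrix.mul_assoc, ← Matrix.mul_add, ← hQ]
    rw [← hQ]
  have h2 := congrArg Matrix.trace h1
  rw [Matrix.trace_add, ← Matrix.mul_assoc Q P Q, Matrix.trace_mul_comm (Q * P) Q,
    ← Matrix.mul_assoc] at h2
  rw [h2, two_mul]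

end Idempotent

/-! ### The fibres of `p` through Hermitian projections -/

section FibreProjection

variable {E : Type*} [NormedAddCommGroup E] [NormedSpace ℝ E] [FiniteDimensional ℝ E]
  {M : Type*} [TopologicalSpace M] [ChartedSpace E M] [IsManifold 𝓘(ℝ, E) ∞ M]
  [RiemannianBundle (fun x : M ↦ TangentSpace 𝓘(ℝ, E) x)]
  [IsContMDiffRiemannianBundle 𝓘(ℝ, E) ∞ E (fun x : M ↦ TangentSpace 𝓘(ℝ, E) x)]
  {E' : Type*} [NormedAddCommGroup E'] [NormedSpace ℝ E'] [FiniteDimensional ℝ E']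
  {Y : Type*} [TopologicalSpace Y] [ChartedSpace E' Y] [IsManifold 𝓘(ℝ, E') ∞ Y]
  [RiemannianBundle (fun y : Y ↦ TangentSpace 𝓘(ℝ, E') y)]
  [IsContMDiffRiemannianBundle 𝓘(ℝ, E') ∞ E' (fun y : Y ↦ TangentSpace 𝓘(ℝ, E') y)]
  {cov : AffineConnection E M} {p : Y → M}
  {σ : Π y : Y, Submodule ℂ (ℂ ⊗[ℝ] TangentSpace 𝓘(ℝ, E) (p y))} {x₀ : M} {y : Y}

/-- The matrix valued function, on the inverse image by `p` of the domain of a chart, given by the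
Hermitian projections onto the subspaces `σ`. -/
noncomputable abbrev projFun (σ : Π y : Y, Submodule ℂ (ℂ ⊗[ℝ] TangentSpace 𝓘(ℝ, E) (p y))) (x₀ : M)
    (z : Y) : Matrix (Fin (Module.finrank ℝ E)) (Fin (Module.finrank ℝ E)) ℂ :=
  projMat x₀ (p z) (σ z)

theorem eventually_mem_source (hp : ContMDiffAt 𝓘(ℝ, E') 𝓘(ℝ, E) ∞ p y)
    (hy : p y ∈ (chartAt E x₀).source) : ∀ᶠ z in 𝓝 y, p z ∈ (chartAt E x₀).source :=
  hp.continuousAt.eventually ((chartAt E x₀).open_source.mem_nhds hy)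

theorem dMat_projFun (hp : ContMDiffAt 𝓘(ℝ, E') 𝓘(ℝ, E) ∞ p y)
    (hy : p y ∈ (chartAt E x₀).source) (hP : SmoothMatAt (E' := E') (projFun σ x₀) y)
    (v : TangentSpace 𝓘(ℝ, E') y) : dMat (projFun σ x₀) y v =
      dMat (projFun σ x₀) y v * projFun σ x₀ y + projFun σ x₀ y * dMat (projFun σ x₀) y v := by
  rw [← dMat_mul hP.diff hP.diff]
  refine dMat_congr ?_ v
  filter_upwards [eventually_mem_source hp hy] with z hz
  exact (isProjMat_projMat hz _).idem.symm

/-- Derivative of the self-adjointness of `P` along the fibre, where the Gram matrix is constant. -/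
theorem dMat_projFun_gramC (hp : ContMDiffAt 𝓘(ℝ, E') 𝓘(ℝ, E) ∞ p y)
    (hy : p y ∈ (chartAt E x₀).source) (hP : SmoothMatAt (E' := E') (projFun σ x₀) y)
    {v : TangentSpace 𝓘(ℝ, E') y} (hv : v ∈ vert E E' p y) :
    (dMat (projFun σ x₀) y v).conjTranspose * gramC (E := E) x₀ (p y) =
      gramC (E := E) x₀ (p y) * dMat (projFun σ x₀) y v := by
  have hG := (smoothMatAt_gramC (x₀ := x₀) hp hy).diff
  have h1 := dMat_mul hP.diff.conjTranspose hG v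
  have h2 := dMat_mul hG hP.diff v
  rw [dMat_gramC_vert hp hy hv] at h1 h2
  rw [dMat_conjTranspose hP.diff, Matrix.mul_zero, add_zero] at h1
  rw [Matrix.zero_mul, zero_add] at h2
  rw [← h1, ← h2]
  refine dMat_congr ?_ v
  filter_upwards [eventually_mem_source hp hy] with z hz
  exact (isProjMat_projMat hz _).adj

theorem contMDiffAt_projFun_mulVec (hP : SmoothMatAt (E' := E') (projFun σ x₀) y)
    (ξ : Fin (Module.finrank ℝ E) → ℂ) (j) :
    ContMDiffAt 𝓘(ℝ, E') 𝓘(ℝ, ℂ) ∞ (fun z ↦ (projFun σ x₀ z).mulVec ξ j) y := by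
  simp only [Matrix.mulVec, dotProduct]
  exact contMDiffAt_fun_sum fun k _ ↦ contMDiffAt_fun_mul (hP j k) contMDiffAt_const

theorem mvfderiv_projFun_mulVec (hP : SmoothMatAt (E' := E') (projFun σ x₀) y)
    (ξ : Fin (Module.finrank ℝ E) → ℂ) (v : TangentSpace 𝓘(ℝ, E') y) (j) :
    mvfderiv 𝓘(ℝ, E') (fun z ↦ (projFun σ x₀ z).mulVec ξ j) y v =
      (dMat (projFun σ x₀) y v).mulVec ξ j := by
  simp only [Matrix.mulVec, dotProduct]
  rw [(mvfderiv_sum (g := fun k z ↦ projFun σ x₀ z j k * ξ k) _ fun k _ ↦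
    (hP.diff j k).mul mdifferentiableAt_const).2, sum_apply]
  refine Finset.sum_congr rfl fun k _ ↦ ?_
  rw [mvfderiv_mul_complex (hP.diff j k) mdifferentiableAt_const, mvfderiv_const]
  simp [dMat]

theorem isLocalSection_projFun (hp : ContMDiffAt 𝓘(ℝ, E') 𝓘(ℝ, E) ∞ p y)
    (hy : p y ∈ (chartAt E x₀).source) (hP : SmoothMatAt (E' := E') (projFun σ x₀) y)
    (ξ : Fin (Module.finrank ℝ E) → ℂ) :
    IsLocalSection (E' := E') σ (fun z ↦ combC x₀ (p z) ((projFun σ x₀ z).mulVec ξ)) y where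
  smooth_re := (smoothSecAt_combC hp hy (contMDiffAt_projFun_mulVec hP ξ)).1
  smooth_im := (smoothSecAt_combC hp hy (contMDiffAt_projFun_mulVec hP ξ)).2
  mem := by
    filter_upwards [eventually_mem_source hp hy] with z hz
    rw [(isProjMat_projMat hz (σ z)).mem_iff, coefC_combC hz, Matrix.mulVec_mulVec,
      (isProjMat_projMat hz (σ z)).idem]

theorem pullbackCovC_projFun (hp : ContMDiffAt 𝓘(ℝ, E') 𝓘(ℝ, E) ∞ p y)
    (hy : p y ∈ (chartAt E x₀).source) (hP : SmoothMatAt (E' := E') (projFun σ x₀) y)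
    (ξ : Fin (Module.finrank ℝ E) → ℂ) {v : TangentSpace 𝓘(ℝ, E') y} (hv : v ∈ vert E E' p y) :
    pullbackCovC cov p (fun z ↦ combC x₀ (p z) ((projFun σ x₀ z).mulVec ξ)) y (incl _ v) =
      combC x₀ (p y) ((dMat (projFun σ x₀) y v).mulVec ξ) := by
  rw [pullbackCovC_combC_vert cov hp hy (contMDiffAt_projFun_mulVec hP ξ) hv]
  congr 1
  funext j
  exact mvfderiv_projFun_mulVec hP ξ v j

/-- The sections `P ξ`, with `ξ` constant, are sections of `σ`, so membership of `v + iw` in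
`kerNabla` says that `Q + iQ'` has range in that of `P`, for `Q`, `Q'` the derivatives of `P` along
`v`, `w`. Then `deriv_eq_of_mul_eq` applies. -/
theorem dMat_projFun_of_mem_kerNabla (hp : ContMDiffAt 𝓘(ℝ, E') 𝓘(ℝ, E) ∞ p y)
    (hy : p y ∈ (chartAt E x₀).source) (hP : SmoothMatAt (E' := E') (projFun σ x₀) y)
    {v w : TangentSpace 𝓘(ℝ, E') y} (hv : v ∈ vert E E' p y) (hw : w ∈ vert E E' p y)
    (h : incl _ v + inclI _ w ∈ kerNabla (E' := E') cov σ y) :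
    dMat (projFun σ x₀) y w = Complex.I • (dMat (projFun σ x₀) y v * projFun σ x₀ y -
      projFun σ x₀ y * dMat (projFun σ x₀) y v) := by
  refine deriv_eq_of_mul_eq (isUnit_gramC hy) (isProjMat_projMat hy _).adj
    (dMat_projFun hp hy hP v) (dMat_projFun hp hy hP w) (dMat_projFun_gramC hp hy hP hv)
    (dMat_projFun_gramC hp hy hP hw) ?_
  refine Matrix.ext_of_mulVec_single fun i ↦ ?_
  have hs := isLocalSection_projFun hp hy hP (Pi.single i 1)
  have h1 := (Submodule.mem_iInf _).1 ((Submodule.mem_iInf _).1 h _) hs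
  rw [Submodule.mem_comap, map_add, ← I_smul_incl, map_smul, pullbackCovC_projFun hp hy hP _ hv,
    pullbackCovC_projFun hp hy hP _ hw, (isProjMat_projMat hy _).mem_iff, map_add, map_smul,
    coefC_combC hy, coefC_combC hy] at h1
  rw [← Matrix.mulVec_mulVec, Matrix.add_mulVec, Matrix.smul_mulVec]
  exact h1

/-- A consequence of `PQP = 0`; it provides the orthogonality hypothesis in
`HasGrassmannFibreMetric`. -/
theorem hermC_projFun_eq_zero (hp : ContMDiffAt 𝓘(ℝ, E') 𝓘(ℝ, E) ∞ p y)
    (hy : p y ∈ (chartAt E x₀).source) (hP : SmoothMatAt (E' := E') (projFun σ x₀) y)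
    {v : TangentSpace 𝓘(ℝ, E') y} {a b : ℂ ⊗[ℝ] TangentSpace 𝓘(ℝ, E) (p y)} (ha : a ∈ σ y)
    (hb : b ∈ σ y) :
    hermC b (combC x₀ (p y) ((dMat (projFun σ x₀) y v).mulVec (coefC x₀ (p y) a))) = 0 := by
  have hA := isProjMat_projMat hy (σ y)
  have h1 := (hA.mem_iff a).1 ha
  have h2 := (hA.mem_iff b).1 hb
  have h3 := idem_mul_deriv_mul hA.idem (dMat_projFun hp hy hP v)
  rw [hermC_eq hy, coefC_combC hy, ← h1, ← h2, Matrix.star_mulVec, ← Matrix.dotProduct_mulVec,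
    Matrix.mulVec_mulVec, Matrix.mulVec_mulVec, Matrix.mulVec_mulVec, hA.adj, Matrix.mul_assoc,
    Matrix.mul_assoc, ← Matrix.mul_assoc (projMat _ _ _) _ (projMat _ _ _), h3]
  simp

/-- A unitary basis `ξ_i` of `σ y` is extended by `z ↦ P(z) ξ_i`, whose vertical derivatives `Q ξ_i`
are orthogonal to `σ y`. The sum of their squared norms is `tr(Q² P) = tr(Q²)/2`. -/
theorem inner_vert_self {c : ℝ} (hc : HasGrassmannFibreMetric (E' := E') cov p σ c)
    (hp : ContMDiffAt 𝓘(ℝ, E') 𝓘(ℝ, E) ∞ p y)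
    (hy : p y ∈ (chartAt E x₀).source) (hP : SmoothMatAt (E' := E') (projFun σ x₀) y)
    {v : TangentSpace 𝓘(ℝ, E') y} (hv : v ∈ vert E E' p y) :
    inner ℝ v v = c / 2 * (dMat (projFun σ x₀) y v * dMat (projFun σ x₀) y v).trace.re := by
  obtain ⟨k, ξ, hξ, hspan⟩ := exists_unitary_basis (σ y)
  have hA := isProjMat_projMat hy (σ y)
  have hξσ : ∀ i, ξ i ∈ σ y := fun i ↦ hspan ▸ Submodule.subset_span ⟨i, rfl⟩
  have hval : ∀ i, combC x₀ (p y) ((projFun σ x₀ y).mulVec (coefC x₀ (p y) (ξ i))) = ξ i := fun i ↦ by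
    rw [(hA.mem_iff _).1 (hξσ i), combC_coefC hy]
  have h := hc y v hv k (fun i z ↦ combC x₀ (p z) ((projFun σ x₀ z).mulVec (coefC x₀ (p y) (ξ i))))
    (fun i ↦ isLocalSection_projFun hp hy hP _) (by simpa only [hval] using hξ)
    (by simpa only [hval] using hspan)
    (fun i b hb ↦ by
      rw [pullbackCovC_projFun hp hy hP _ hv]
      exact hermC_projFun_eq_zero hp hy hP (hξσ i) hb)
  rw [h, trace_mul_self_idem (dMat_projFun hp hy hP v)]
  simp only [pullbackCovC_projFun hp hy hP _ hv]
  set Q := dMat (projFun σ x₀) y v with hQ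
  set Ξ := coefMat x₀ (p y) ξ with hΞ
  have hPΞ : projFun σ x₀ y = Ξ * (Ξ.conjTranspose * gramC (E := E) x₀ (p y)) :=
    hA.unique hy (isProjMat_of_unitary hy hξ hspan)
  have h1 : ∑ i, hermC (combC x₀ (p y) (Q.mulVec (coefC x₀ (p y) (ξ i))))
      (combC x₀ (p y) (Q.mulVec (coefC x₀ (p y) (ξ i)))) = (Q * Q * projFun σ x₀ y).trace := by
    have h2 : (Q * Q * projFun σ x₀ y).trace =
        ((Q * Ξ).conjTranspose * (gramC (E := E) x₀ (p y) * (Q * Ξ))).trace := by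
      rw [hPΞ, ← Matrix.mul_assoc, Matrix.trace_mul_comm, Matrix.conjTranspose_mul, Matrix.mul_assoc,
        Matrix.mul_assoc, Matrix.mul_assoc, ← Matrix.mul_assoc Q.conjTranspose,
        hQ, dMat_projFun_gramC hp hy hP hv]
      simp only [Matrix.mul_assoc]
    rw [h2]
    refine Finset.sum_congr rfl fun i _ ↦ ?_
    rw [hermC_combC]
    rfl
  rw [← h1, ← Complex.re_sum]
  have h3 : ∀ z : ℂ, (2 * z).re = 2 * z.re := fun z ↦ by simp
  rw [h3]
  ring

/-- The metric of the fibres, in terms of the Hermitian projections. -/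
theorem inner_vert {c : ℝ} (hc : HasGrassmannFibreMetric (E' := E') cov p σ c)
    (hp : ContMDiffAt 𝓘(ℝ, E') 𝓘(ℝ, E) ∞ p y)
    (hy : p y ∈ (chartAt E x₀).source) (hP : SmoothMatAt (E' := E') (projFun σ x₀) y)
    {v w : TangentSpace 𝓘(ℝ, E') y} (hv : v ∈ vert E E' p y) (hw : w ∈ vert E E' p y) :
    inner ℝ v w = c / 2 * (dMat (projFun σ x₀) y v * dMat (projFun σ x₀) y w).trace.re := by
  have h1 := inner_vert_self hc hp hy hP (Submodule.add_mem _ hv hw)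
  have h2 := inner_vert_self hc hp hy hP hv
  have h3 := inner_vert_self hc hp hy hP hw
  rw [dMat_add_vec, Matrix.add_mul, Matrix.mul_add, Matrix.mul_add, Matrix.trace_add, Matrix.trace_add,
    Matrix.trace_add, Matrix.trace_mul_comm (dMat _ _ w) (dMat _ _ v), real_inner_add_add_self] at h1
  simp only [Complex.add_re] at h1
  linarith

end FibreProjection

/-! ### Trace identities for off-diagonal matrices -/

section OffDiagonal

variable {n : Type*} [Fintype n] {P Q Q' N a b D : Matrix n n ℂ}

/-- Block diagonal matrices are trace orthogonal to off-diagonal ones. -/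
theorem trace_mul_eq_zero_of_comm (hP : P * P = P) (hN : N = N * P + P * N) (hD : P * D = D * P) :
    (D * N).trace = 0 := by
  have h0 := idem_mul_deriv_mul hP hN
  have h1 : (D * (N * P)).trace = 0 := by
    rw [← hP, ← Matrix.mul_assoc N, ← Matrix.mul_assoc, Matrix.trace_mul_comm, ← Matrix.mul_assoc,
      hD, Matrix.mul_assoc, ← Matrix.mul_assoc P, h0, Matrix.mul_zero, Matrix.trace_zero]
  have h2 : (D * (P * N)).trace = 0 := by
    rw [← Matrix.mul_assoc, ← hD, Matrix.mul_assoc, Matrix.trace_mul_comm, Matrix.mul_assoc, h1]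
  rw [hN, Matrix.mul_add, Matrix.trace_add, h1, h2, add_zero]

theorem idem_mul_mul_comm (hQ : Q = Q * P + P * Q) (hQ' : Q' = Q' * P + P * Q') :
    P * (Q * Q') = Q * Q' * P := by
  have h1 : P * Q = Q - Q * P := eq_sub_of_add_eq' hQ.symm
  have h2 : Q' * P = Q' - P * Q' := eq_sub_of_add_eq hQ'.symm
  rw [← Matrix.mul_assoc, h1, Matrix.mul_assoc, h2, Matrix.sub_mul, Matrix.mul_sub, Matrix.mul_assoc]

/-- The Kähler identity of the Grassmannian. In its application `Q = X(P)`, `Q' = X'(P)`, `a =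
X(X(P))`, `b = X'(X(P))`, so that `J[X', X]` on the left and the sum of the second derivatives along
`X` and `X'` on the right are paired with a tangent matrix `N`. The terms `QQ'`, `Q'Q` and `PaP`
commute with `P` and drop out. -/
theorem trace_double_commutator (hP : P * P = P) (hN : N = N * P + P * N)
    (hQ : Q = Q * P + P * Q) (hQ' : Q' = Q' * P + P * Q') :
    (Complex.I • ((b - Complex.I • (a * P - P * a)) * P -
        P * (b - Complex.I • (a * P - P * a))) * N).trace =
      ((a + Complex.I • ((b * P + Q * Q') - (Q' * Q + P * b))) * N).trace := by
  have h0 := idem_mul_deriv_mul hP hN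
  have h1 := trace_mul_eq_zero_of_comm hP hN (idem_mul_mul_comm hQ hQ')
  have h2 := trace_mul_eq_zero_of_comm hP hN (idem_mul_mul_comm hQ' hQ)
  have h3 := trace_mul_eq_zero_of_comm (D := P * a * P) hP hN (by
    rw [← Matrix.mul_assoc, ← Matrix.mul_assoc, hP, Matrix.mul_assoc (P * a), hP])
  have h4 : (a * N).trace = (a * P * N).trace + (P * a * N).trace := by
    conv_lhs => rw [hN]
    rw [Matrix.mul_add, Matrix.trace_add, ← Matrix.mul_assoc a N, Matrix.trace_mul_comm (a * N) P,
      ← Matrix.mul_assoc, ← Matrix.mul_assoc, add_comm]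
  have e : Complex.I • ((b - Complex.I • (a * P - P * a)) * P -
        P * (b - Complex.I • (a * P - P * a))) =
      Complex.I • (b * P - P * b) + (a * P + P * a - 2 • (P * a * P)) := by
    have h5 : a * P * P = a * P := by rw [Matrix.mul_assoc, hP]
    have h6 : P * (P * a) = P * a := by rw [← Matrix.mul_assoc, hP]
    simp only [Matrix.sub_mul, Matrix.mul_sub, Matrix.smul_mul, Matrix.mul_smul, h5, h6, smul_sub,
      smul_smul, Complex.I_mul_I, Matrix.mul_assoc]
    module
  rw [e]
  simp only [Matrix.add_mul, Matrix.sub_mul, Matrix.smul_mul, Matrix.trace_add, Matrix.trace_sub,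
    Matrix.trace_smul, h1, h2, h3, h4, smul_eq_mul]
  ring

theorem trace_complex_mul (hP : P * P = P) (hN : N = N * P + P * N) (hQ : Q = Q * P + P * Q) :
    ((Complex.I • (Q * P - P * Q)) * (Complex.I • (N * P - P * N))).trace = (Q * N).trace := by
  have h0 := idem_mul_deriv_mul hP hN
  have h1 := idem_mul_deriv_mul hP hQ
  have h2 : (P * Q * (N * P)).trace = (Q * (N * P)).trace := by
    rw [Matrix.mul_assoc, Matrix.trace_mul_comm, Matrix.mul_assoc, Matrix.mul_assoc, hP]
  have h3 : Q * P * (N * P) = 0 := by rw [Matrix.mul_assoc, ← Matrix.mul_assoc P, h0, Matrix.mul_zero]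
  have h4 : P * Q * (P * N) = 0 := by rw [← Matrix.mul_assoc, h1, Matrix.zero_mul]
  have h5 : Q * P * (P * N) = Q * (P * N) := by
    rw [Matrix.mul_assoc, ← Matrix.mul_assoc P, hP]
  have h6 : (Q * N).trace = (Q * (N * P)).trace + (Q * (P * N)).trace := by
    conv_lhs => rw [hN]
    rw [Matrix.mul_add, Matrix.trace_add]
  rw [Matrix.smul_mul, Matrix.mul_smul, smul_smul, Complex.I_mul_I, Matrix.sub_mul, Matrix.mul_sub,
    Matrix.mul_sub, h3, h4, h5, Matrix.trace_smul, Matrix.trace_sub, Matrix.trace_sub,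
    Matrix.trace_sub, h2, h6, Matrix.trace_zero]
  simp

end OffDiagonal

/-! ### The fibres of `p` are Kähler -/

section Vertical

variable {E : Type*} [NormedAddCommGroup E] [NormedSpace ℝ E] [FiniteDimensional ℝ E]
  {M : Type*} [TopologicalSpace M] [ChartedSpace E M] [IsManifold 𝓘(ℝ, E) ∞ M]
  [RiemannianBundle (fun x : M ↦ TangentSpace 𝓘(ℝ, E) x)]
  [IsContMDiffRiemannianBundle 𝓘(ℝ, E) ∞ E (fun x : M ↦ TangentSpace 𝓘(ℝ, E) x)]
  {E' : Type*} [NormedAddCommGroup E'] [NormedSpace ℝ E'] [FiniteDimensional ℝ E']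
  {Y : Type*} [TopologicalSpace Y] [ChartedSpace E' Y] [IsManifold 𝓘(ℝ, E') ∞ Y]
  [RiemannianBundle (fun y : Y ↦ TangentSpace 𝓘(ℝ, E') y)]
  [IsContMDiffRiemannianBundle 𝓘(ℝ, E') ∞ E' (fun y : Y ↦ TangentSpace 𝓘(ℝ, E') y)]
  {F : Type*} [NormedAddCommGroup F] [NormedSpace ℂ F] [FiniteDimensional ℂ F]
  {Z : Type*} [TopologicalSpace Z] [ChartedSpace F Z] [IsManifold 𝓘(ℂ, F) ω Z]
  {cov : AffineConnection E M} {p : Y → M}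
  {σ : Π y : Y, Submodule ℂ (ℂ ⊗[ℝ] TangentSpace 𝓘(ℝ, E) (p y))} {conjY : Y → Y}
  {covY : AffineConnection E' Y} {φ : Y → Z} {conjZ : Z → Z}

theorem IsGivenBy.smoothMatAt (h : IsGivenBy (E' := E') (F := F) cov p σ conjY covY φ conjZ) {x₀ : M}
    {y : Y} (hy : p y ∈ (chartAt E x₀).source) : SmoothMatAt (E' := E') (projFun σ x₀) y := by
  obtain ⟨k, s, hs, hsσ⟩ := h.almost.smooth y
  exact smoothMatAt_projMat h.almost.submersion.smooth.contMDiffAt hy hs hsσ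

/-- The Levi-Civita connection of the fibres, in terms of the Hermitian projections. -/
theorem IsGivenBy.inner_cov_vert (h : IsGivenBy (E' := E') (F := F) cov p σ conjY covY φ conjZ)
    (hcovY : IsLeviCivita covY) {c : ℝ} (hc : HasGrassmannFibreMetric (E' := E') cov p σ c)
    {x₀ : M} {y : Y} (hy : p y ∈ (chartAt E x₀).source)
    {A B C : Π y : Y, TangentSpace 𝓘(ℝ, E') y} (hA : SmoothFieldAt A y) (hB : SmoothFieldAt B y)
    (hC : SmoothFieldAt C y) (hAv : ∀ᶠ z in 𝓝 y, A z ∈ vert E E' p z)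
    (hBv : ∀ᶠ z in 𝓝 y, B z ∈ vert E E' p z) (hCv : ∀ᶠ z in 𝓝 y, C z ∈ vert E E' p z) :
    inner ℝ (covY B y (A y)) (C y) =
      c / 2 * (dMat (fun z ↦ dMat (projFun σ x₀) z (B z)) y (A y) *
        dMat (projFun σ x₀) y (C y)).trace.re := by
  have hps := h.almost.submersion.smooth.contMDiffAt (x := y)
  have hev := eventually_mem_source hps hy
  have hP := h.smoothMatAt hy
  have hdP : ∀ {D : Π y : Y, TangentSpace 𝓘(ℝ, E') y}, SmoothFieldAt D y →
      SmoothMatAt (E' := E') (fun z ↦ dMat (projFun σ x₀) z (D z)) y := fun hD ↦ hP.dMat hD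
  let α := {X : Π y : Y, TangentSpace 𝓘(ℝ, E') y // SmoothFieldAt X y ∧
    ∀ᶠ z in 𝓝 y, X z ∈ vert E E' p z}
  -- Koszul's argument: the difference of the two sides is symmetric in `A`, `B` because both
  -- antisymmetrize to the bracket, and skew in `B`, `C` because both differentiate the metric.
  have key := eq_zero_of_symm_of_skew (α := α) (fun A B C ↦ inner ℝ (covY B.1 y (A.1 y)) (C.1 y) -
      c / 2 * (dMat (fun z ↦ dMat (projFun σ x₀) z (B.1 z)) y (A.1 y) *
        dMat (projFun σ x₀) y (C.1 y)).trace.re) ?_ ?_ ⟨A, hA, hAv⟩ ⟨B, hB, hBv⟩ ⟨C, hC, hCv⟩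
  · exact sub_eq_zero.1 key
  · intro A B C
    have h1 := mlieBracket_mem_vert hps A.2.1.diff B.2.1.diff A.2.2 B.2.2
    have h2 := inner_vert hc hps hy hP h1 C.2.2.self_of_nhds
    rw [← hcovY.sub_eq_mlieBracket A.2.1.diff B.2.1.diff, inner_sub_left,
      hcovY.sub_eq_mlieBracket A.2.1.diff B.2.1.diff, dMat_mlieBracket hP A.2.1 B.2.1,
      Matrix.sub_mul, Matrix.trace_sub, Complex.sub_re] at h2
    linarith
  · intro A B C
    have h1 := hcovY.1 y B.1 C.1 (A.1 y) B.2.1.diff C.2.1.diff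
    have e : (fun z ↦ inner ℝ (B.1 z) (C.1 z)) =ᶠ[𝓝 y] fun z ↦ (((c / 2 : ℝ) : ℂ) •
        (dMat (projFun σ x₀) z (B.1 z) * dMat (projFun σ x₀) z (C.1 z))).trace.re := by
      filter_upwards [hev, B.2.2, C.2.2] with z hz hBz hCz
      rw [inner_vert hc h.almost.submersion.smooth.contMDiffAt hz (h.smoothMatAt hz) hBz hCz,
        Matrix.trace_smul, smul_eq_mul, Complex.re_ofReal_mul]
    have hBC := ((hdP B.2.1).mul (hdP C.2.1)).diff
    rw [mvfderiv_congr e, mvfderiv_re_trace (hBC.smul _), dMat_smul _ hBC,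
      dMat_mul (hdP B.2.1).diff (hdP C.2.1).diff, Matrix.trace_smul, smul_eq_mul,
      Complex.re_ofReal_mul, Matrix.trace_add, Complex.add_re,
      Matrix.trace_mul_comm (dMat (projFun σ x₀) y (B.1 y))] at h1
    rw [real_inner_comm (covY C.1 y (A.1 y)) (B.1 y)] at h1
    linarith

/-- The complex structure of the fibres is orthogonal. -/
theorem IsGivenBy.inner_complex_vert (h : IsGivenBy (E' := E') (F := F) cov p σ conjY covY φ conjZ)
    {y : Y} {v w v' w' : TangentSpace 𝓘(ℝ, E') y} (hv : v ∈ vert E E' p y) (hw : w ∈ vert E E' p y)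
    (hv' : v' ∈ (vert F E' φ y)ᗮ) (hw' : w' ∈ (vert F E' φ y)ᗮ)
    (hvv' : mfderiv 𝓘(ℝ, E') 𝓘(ℝ, F) φ y v' = mulI (φ y) (mfderiv 𝓘(ℝ, E') 𝓘(ℝ, F) φ y v))
    (hww' : mfderiv 𝓘(ℝ, E') 𝓘(ℝ, F) φ y w' = mulI (φ y) (mfderiv 𝓘(ℝ, E') 𝓘(ℝ, F) φ y w)) :
    inner ℝ v' w' = inner ℝ v w := by
  obtain ⟨c, -, hc⟩ := h.fibreMetric
  have hy := mem_chart_source E (p y)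
  have hps := h.almost.submersion.smooth.contMDiffAt (x := y)
  have hP := h.smoothMatAt hy
  have h1 := (h.isTwistorial y).vert_complex hv hv' hvv'
  have h2 := (h.isTwistorial y).vert_complex hw hw' hww'
  rw [inner_vert hc hps hy hP hv hw, inner_vert hc hps hy hP h1.1 h2.1,
    dMat_projFun_of_mem_kerNabla hps hy hP hv h1.1 h1.2,
    dMat_projFun_of_mem_kerNabla hps hy hP hw h2.1 h2.2,
    trace_complex_mul (isProjMat_projMat hy _).idem (dMat_projFun hps hy hP w)
      (dMat_projFun hps hy hP v)]

/-- The fibres of `p` are Kähler, hence `i dφ[X', X] = dφ(∇_X X + ∇_X' X')` if `X' = JX` is a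
vector field tangent to the fibres. -/
theorem IsGivenBy.tension_vertical
    (h : IsGivenBy (E' := E') (F := F) cov p σ conjY covY φ conjZ) (hcovY : IsLeviCivita covY) {y : Y}
    {X X' : Π y : Y, TangentSpace 𝓘(ℝ, E') y} (hX : SmoothFieldAt X y) (hX' : SmoothFieldAt X' y)
    (hXv : ∀ᶠ z in 𝓝 y, X z ∈ vert E E' p z) (hXv' : ∀ᶠ z in 𝓝 y, X' z ∈ vert E E' p z)
    (hXX' : ∀ᶠ z in 𝓝 y, mfderiv 𝓘(ℝ, E') 𝓘(ℝ, F) φ z (X' z) =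
      mulI (φ z) (mfderiv 𝓘(ℝ, E') 𝓘(ℝ, F) φ z (X z))) :
    mulI (φ y) (mfderiv 𝓘(ℝ, E') 𝓘(ℝ, F) φ y (VectorField.mlieBracket 𝓘(ℝ, E') X' X y)) -
      mfderiv 𝓘(ℝ, E') 𝓘(ℝ, F) φ y (covY X y (X y) + covY X' y (X' y)) = 0 := by
  obtain ⟨c, -, hc⟩ := h.fibreMetric
  set x₀ := p y with hx₀
  have hy : p y ∈ (chartAt E x₀).source := mem_chart_source E (p y)
  have hps := h.almost.submersion.smooth.contMDiffAt (x := y)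
  have hP := h.smoothMatAt hy
  have hidem := (isProjMat_projMat hy (σ y)).idem
  have hbr := mlieBracket_mem_vert hps hX'.diff hX.diff hXv' hXv
  -- `u` represents `J[X', X]`, so the assertion becomes an equality between vertical vectors, the
  -- fibres of `p` being totally geodesic. It is tested against vertical vectors.
  obtain ⟨u, hu, huφ⟩ := (h.isTwistorial y).exists_complex
    (VectorField.mlieBracket 𝓘(ℝ, E') X' X y)
  have hu2 := (h.isTwistorial y).vert_complex hbr hu huφ
  have hvX := h.totallyGeodesic y X (X y) hX hXv hXv.self_of_nhds
  have hvX' := h.totallyGeodesic y X' (X' y) hX' hXv' hXv'.self_of_nhds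
  have hQ' : (fun z ↦ dMat (projFun σ x₀) z (X' z)) =ᶠ[𝓝 y] fun z ↦
      Complex.I • (dMat (projFun σ x₀) z (X z) * projFun σ x₀ z -
        projFun σ x₀ z * dMat (projFun σ x₀) z (X z)) := by
    filter_upwards [hXv, hXv', hXX', eventually_mem_source hps hy] with z h1 h2 h3 h4
    exact dMat_projFun_of_mem_kerNabla h.almost.submersion.smooth.contMDiffAt h4 (h.smoothMatAt h4)
      h1 h2 ((h.isTwistorial z).vert_complex h1 (h.vert_le_orthogonal z h2) h3).2
  have hQd := (hP.dMat hX).diff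
  have hdQ' : ∀ a : TangentSpace 𝓘(ℝ, E') y, dMat (fun z ↦ dMat (projFun σ x₀) z (X' z)) y a =
      Complex.I • ((dMat (fun z ↦ dMat (projFun σ x₀) z (X z)) y a * projFun σ x₀ y +
        dMat (projFun σ x₀) y (X y) * dMat (projFun σ x₀) y a) -
        (dMat (projFun σ x₀) y a * dMat (projFun σ x₀) y (X y) +
          projFun σ x₀ y * dMat (fun z ↦ dMat (projFun σ x₀) z (X z)) y a)) := fun a ↦ by
    rw [dMat_congr hQ', dMat_smul _ ((hQd.mul hP.diff).sub (hP.diff.mul hQd)),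
      dMat_sub (hQd.mul hP.diff) (hP.diff.mul hQd), dMat_mul hQd hP.diff, dMat_mul hP.diff hQd]
  have hw : u - (covY X y (X y) + covY X' y (X' y)) = 0 := by
    have hmem : u - (covY X y (X y) + covY X' y (X' y)) ∈ vert E E' p y :=
      Submodule.sub_mem _ hu2.1 (Submodule.add_mem _ hvX hvX')
    have hort : ∀ w ∈ vert E E' p y, inner ℝ (u - (covY X y (X y) + covY X' y (X' y))) w = 0 := by
      intro w hw
      obtain ⟨C, hC, hCv, rfl⟩ := exists_vertical_field h.almost.submersion hw
      have hCv := Eventually.of_forall (f := 𝓝 y) hCv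
      have hN := dMat_projFun hps hy hP (C y)
      rw [inner_sub_left, inner_add_left, inner_vert hc hps hy hP hu2.1 hw,
        h.inner_cov_vert hcovY hc hy hX hX hC hXv hXv hCv,
        h.inner_cov_vert hcovY hc hy hX' hX' hC hXv' hXv' hCv,
        dMat_projFun_of_mem_kerNabla hps hy hP hbr hu2.1 hu2.2, dMat_mlieBracket hP hX' hX,
        hdQ' (X y), hdQ' (X' y), ← mul_add, ← Complex.add_re, ← Matrix.trace_add, ← Matrix.add_mul,
        ← trace_double_commutator hidem hN (dMat_projFun hps hy hP (X y))
          (dMat_projFun hps hy hP (X' y)), sub_eq_zero]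
      -- In the derivative of `X'(P)` along `X`, the two squares of `X(P)` cancel.
      congr 5
      rw [add_comm (dMat (projFun σ x₀) y (X y) * dMat (projFun σ x₀) y (X y)),
        add_sub_add_right_eq_sub]
    exact inner_self_eq_zero.1 (hort _ hmem)
  have hw2 := congrArg (mfderiv 𝓘(ℝ, E') 𝓘(ℝ, F) φ y) hw
  rw [map_sub, map_zero] at hw2
  refine Eq.trans ?_ hw2
  congr 1
  exact huφ.symm

end Vertical

/-! ### Traces over adapted bases -/

section Trace

variable {T : Type*} [NormedAddCommGroup T] [InnerProductSpace ℝ T] [FiniteDimensional ℝ T]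
  {G : Type*} [AddCommGroup G] [Module ℝ G] {ι κ : Type*} [Fintype ι] [Fintype κ]

theorem sum_bilin_eq_sum (B : T →ₗ[ℝ] T →ₗ[ℝ] G) (u : ι → T) : ∑ i, B (u i) (u i) =
    ∑ j, B (∑ i, inner ℝ (u i) (stdOrthonormalBasis ℝ T j) • u i) (stdOrthonormalBasis ℝ T j) := by
  simp only [map_sum, map_smul, LinearMap.sum_apply, LinearMap.smul_apply]
  rw [Finset.sum_comm]
  refine Finset.sum_congr rfl fun i _ ↦ ?_
  conv_lhs => rw [← (stdOrthonormalBasis ℝ T).sum_repr' (u i)]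
  conv_lhs => rw [map_sum (B _)]
  refine Finset.sum_congr rfl fun j _ ↦ ?_
  rw [map_smul, OrthonormalBasis.sum_repr', real_inner_comm]

/-- The trace of a bilinear map over a finite family depends only on the associated frame
operator. -/
theorem sum_bilin_eq_of_frame (B : T →ₗ[ℝ] T →ₗ[ℝ] G)
    {u : ι → T} {v : κ → T} (h : ∀ x, ∑ i, inner ℝ (u i) x • u i = ∑ k, inner ℝ (v k) x • v k) :
    ∑ i, B (u i) (u i) = ∑ k, B (v k) (v k) := by
  rw [sum_bilin_eq_sum, sum_bilin_eq_sum B v]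
  simp only [h]

theorem sum_inner_smul_eq_starProjection {S : Submodule ℝ T} (b : OrthonormalBasis ι ℝ S) (x : T) :
    ∑ i, inner ℝ (b i : T) x • (b i : T) = S.starProjection x := by
  rw [b.starProjection_eq_sum_rankOne]
  simp

/-- `J` is orthogonal on `S`, so the vectors `J b_i` have the same frame operator as the `b_i`,
namely the projection onto `S`; the two traces agree. -/
theorem sum_bilin_complex (B : T →ₗ[ℝ] T →ₗ[ℝ] G) {S : Submodule ℝ T} (b : OrthonormalBasis ι ℝ S)
    (J : T →ₗ[ℝ] T) (hJ : ∀ a ∈ S, J a ∈ S) (hJJ : ∀ a ∈ S, J (J a) = -a)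
    (hin : ∀ a ∈ S, ∀ b ∈ S, inner ℝ (J a) (J b) = inner ℝ a b) :
    ∑ i, B (b i : T) (b i : T) =
      (1 / 2 : ℝ) • ∑ i, (B (b i : T) (b i : T) + B (J (b i : T)) (J (b i : T))) := by
  have h1 : ∑ i, B (J (b i : T)) (J (b i : T)) = ∑ i, B (b i : T) (b i : T) := by
    refine sum_bilin_eq_of_frame B fun x ↦ ?_
    rw [sum_inner_smul_eq_starProjection]
    set w := S.starProjection x with hw
    have hwS : w ∈ S := Submodule.starProjection_apply_mem _ _
    have h2 : ∀ i, inner ℝ (J (b i : T)) x = - inner ℝ (b i : T) (J w) := fun i ↦ by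
      have h3 : inner ℝ (J (b i : T)) x = inner ℝ (J (b i : T)) w := by
        rw [← sub_eq_zero, ← inner_sub_right]
        exact Submodule.inner_right_of_mem_orthogonal (hJ _ (b i).2)
          (Submodule.sub_starProjection_mem_orthogonal x)
      have h4 := hin _ (b i).2 _ (hJ w hwS)
      rw [hJJ w hwS, inner_neg_right] at h4
      rw [h3, ← h4, neg_neg]
    simp only [h2, ← map_smul, neg_smul]
    rw [← map_sum, Finset.sum_neg_distrib, sum_inner_smul_eq_starProjection,
      Submodule.starProjection_eq_self_iff.2 (hJ w hwS), map_neg, hJJ w hwS, neg_neg]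
  rw [Finset.sum_add_distrib, h1]
  module

theorem starProjection_add_add {L V W : Submodule ℝ T} (hLV : L ≤ Vᗮ) (hW : W = Vᗮ ⊓ Lᗮ) (x : T) :
    L.starProjection x + W.starProjection x + V.starProjection x = x := by
  have hVL : V ≤ Lᗮ := (Submodule.le_orthogonal_iff_le_orthogonal).2 hLV
  have h1 := Submodule.starProjection_apply_mem V x
  have h2 := Submodule.starProjection_apply_mem L x
  have h3 : x - V.starProjection x - L.starProjection x = W.starProjection x := by
    refine (Submodule.eq_starProjection_of_mem_of_inner_eq_zero (K := W) ?_ fun w hw ↦ ?_).symm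
    · rw [hW]
      refine ⟨Submodule.sub_mem _ (Submodule.sub_starProjection_mem_orthogonal x) (hLV h2), ?_⟩
      rw [sub_right_comm]
      exact Submodule.sub_mem _ (Submodule.sub_starProjection_mem_orthogonal x) (hVL h1)
    · rw [hW] at hw
      have e : x - (x - V.starProjection x - L.starProjection x) =
        V.starProjection x + L.starProjection x := by abel
      rw [e, inner_add_left, Submodule.inner_right_of_mem_orthogonal h1 hw.1,
        Submodule.inner_right_of_mem_orthogonal h2 hw.2, add_zero]
  rw [← h3]
  abel

/-- The three bases together have the identity as frame operator. -/
theorem sum_bilin_add_add (B : T →ₗ[ℝ] T →ₗ[ℝ] G) {L V W : Submodule ℝ T} (hLV : L ≤ Vᗮ)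
    (hW : W = Vᗮ ⊓ Lᗮ) {α β γ : Type*} [Fintype α] [Fintype β] [Fintype γ]
    (e : OrthonormalBasis ι ℝ T) (l : OrthonormalBasis α ℝ L) (w : OrthonormalBasis β ℝ W)
    (v : OrthonormalBasis γ ℝ V) : ∑ i, B (e i) (e i) =
      ∑ i, B (l i : T) (l i : T) + ∑ i, B (w i : T) (w i : T) + ∑ i, B (v i : T) (v i : T) := by
  refine (sum_bilin_eq_of_frame B (v := Sum.elim (Sum.elim (fun i ↦ (l i : T)) fun i ↦ (w i : T))
    fun i ↦ (v i : T)) fun x ↦ ?_).trans ?_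
  · simp only [Fintype.sum_sum_type, Sum.elim_inl, Sum.elim_inr, sum_inner_smul_eq_starProjection,
      starProjection_add_add hLV hW, e.sum_repr']
  · simp only [Fintype.sum_sum_type, Sum.elim_inl, Sum.elim_inr]

end Trace

/-! ### The trace of a symmetric form determined by the tension on pairs `X`, `JX` -/

section TensionField

variable {E : Type*} [NormedAddCommGroup E] [NormedSpace ℝ E] [FiniteDimensional ℝ E]
  {M : Type*} [TopologicalSpace M] [ChartedSpace E M] [IsManifold 𝓘(ℝ, E) ∞ M]
  [RiemannianBundle (fun x : M ↦ TangentSpace 𝓘(ℝ, E) x)]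
  [IsContMDiffRiemannianBundle 𝓘(ℝ, E) ∞ E (fun x : M ↦ TangentSpace 𝓘(ℝ, E) x)]
  {E' : Type*} [NormedAddCommGroup E'] [NormedSpace ℝ E'] [FiniteDimensional ℝ E']
  {Y : Type*} [TopologicalSpace Y] [ChartedSpace E' Y] [IsManifold 𝓘(ℝ, E') ∞ Y]
  [RiemannianBundle (fun y : Y ↦ TangentSpace 𝓘(ℝ, E') y)]
  [IsContMDiffRiemannianBundle 𝓘(ℝ, E') ∞ E' (fun y : Y ↦ TangentSpace 𝓘(ℝ, E') y)]
  {F : Type*} [NormedAddCommGroup F] [NormedSpace ℂ F] [FiniteDimensional ℂ F]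
  {Z : Type*} [TopologicalSpace Z] [ChartedSpace F Z] [IsManifold 𝓘(ℂ, F) ω Z]
  {cov : AffineConnection E M} {p : Y → M}
  {σ : Π y : Y, Submodule ℂ (ℂ ⊗[ℝ] TangentSpace 𝓘(ℝ, E) (p y))} {conjY : Y → Y}
  {covY : AffineConnection E' Y} {φ : Y → Z} {conjZ : Z → Z}

/-- `Φ` is linear in its vector argument; symmetry transfers this to the field argument, so only the
value of the field at `y` matters. -/
theorem exists_bilin_of_symm {y : Y} {G : Type*} [AddCommGroup G] [Module ℝ G]
    (Φ : TangentSpace 𝓘(ℝ, E') y → (Π z : Y, TangentSpace 𝓘(ℝ, E') z) → G)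
    (hadd : ∀ X a b, Φ (a + b) X = Φ a X + Φ b X) (hsmul : ∀ X (r : ℝ) a, Φ (r • a) X = r • Φ a X)
    (hsymm : ∀ A X, SmoothFieldAt A y → SmoothFieldAt X y → Φ (A y) X = Φ (X y) A) :
    ∃ B : TangentSpace 𝓘(ℝ, E') y →ₗ[ℝ] TangentSpace 𝓘(ℝ, E') y →ₗ[ℝ] G,
      ∀ a X, SmoothFieldAt X y → Φ a X = B a (X y) := by
  have h1 : ∀ a X, SmoothFieldAt X y → Φ a X = Φ (X y) (FiberBundle.extend E' a) := fun a X hX ↦ by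
    have := hsymm _ X (smoothFieldAt_extend a) hX
    rwa [FiberBundle.extend_apply_self] at this
  have h2 : ∀ a b : TangentSpace 𝓘(ℝ, E') y,
      Φ a (FiberBundle.extend E' b) = Φ b (FiberBundle.extend E' a) := fun a b ↦ by
    rw [h1 a _ (smoothFieldAt_extend b), FiberBundle.extend_apply_self]
  refine ⟨LinearMap.mk₂ ℝ (fun a b ↦ Φ b (FiberBundle.extend E' a)) (fun a b c ↦ ?_)
    (fun r a b ↦ ?_) (fun a b c ↦ hadd _ _ _) fun r a b ↦ hsmul _ _ _, fun a X hX ↦ h1 a X hX⟩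
  · rw [← h2, hadd, h2, h2 b]
  · rw [← h2, hsmul, h2]

/-- The complex structure of `𝒦`, extended by zero on `ker dφ`, as a linear map. -/
noncomputable def complexStrL (hφ : IsSurjSubmersion F E' φ) (y : Y) :
    TangentSpace 𝓘(ℝ, E') y →ₗ[ℝ] TangentSpace 𝓘(ℝ, E') y where
  toFun := complexStr (F := F) φ y
  map_add' a b := by
    have : FiniteDimensional ℝ F := FiniteDimensional.complexToReal F
    rw [complexStr, map_add, map_add, horizontalLift_add hφ, complexStr, complexStr]
  map_smul' r a := by
    have : FiniteDimensional ℝ F := FiniteDimensional.complexToReal F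
    rw [complexStr, map_smul, map_smul, horizontalLift_smul hφ, complexStr, RingHom.id_apply]

theorem complexStr_complexStr (hφ : IsSurjSubmersion F E' φ) {y : Y} {a : TangentSpace 𝓘(ℝ, E') y}
    (ha : a ∈ (vert F E' φ y)ᗮ) :
    complexStr (F := F) φ y (complexStr (F := F) φ y a) = -a := by
  have : FiniteDimensional ℝ F := FiniteDimensional.complexToReal F
  refine (eq_horizontalLift (Submodule.neg_mem _ ha) ?_).symm
  rw [(complexStr_spec hφ y a).2, mulI_mulI, map_neg]

theorem IsGivenBy.complexStr_mem_vert
    (h : IsGivenBy (E' := E') (F := F) cov p σ conjY covY φ conjZ) {y : Y}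
    {a : TangentSpace 𝓘(ℝ, E') y} (ha : a ∈ vert E E' p y) :
    complexStr (F := F) φ y a ∈ vert E E' p y :=
  have k := complexStr_spec h.submersion y a
  ((h.isTwistorial y).vert_complex ha k.1 k.2).1

theorem IsGivenBy.complexStr_mem_horizK
    (h : IsGivenBy (E' := E') (F := F) cov p σ conjY covY φ conjZ) {y : Y}
    {a : TangentSpace 𝓘(ℝ, E') y} (ha : a ∈ (vert E E' p y)ᗮ) :
    complexStr (F := F) φ y a ∈ horizK (E' := E') E F p φ y :=
  have k := complexStr_spec h.submersion y a
  ⟨(h.isTwistorial y).horiz_of_horiz ha k.2, k.1⟩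

variable (cov p φ) in
/-- The vector `trace_ω (I^ℋ + P_{ℋ ∩ 𝒦} T)`. -/
noncomputable def traceOmega (y : Y) : TangentSpace 𝓘(ℝ, E') y :=
  ∑ i, (integrabilityTensor E p y
      (stdOrthonormalBasis ℝ (horizK (E' := E') E F p φ y) i : TangentSpace 𝓘(ℝ, E') y)
      (complexStr (F := F) φ y (stdOrthonormalBasis ℝ (horizK (E' := E') E F p φ y) i)) +
    (horizK (E' := E') E F p φ y).starProjection
      (torsionH cov p y (stdOrthonormalBasis ℝ (horizK (E' := E') E F p φ y) i)
        (complexStr (F := F) φ y (stdOrthonormalBasis ℝ (horizK (E' := E') E F p φ y) i))))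

theorem IsGivenBy.traceOmega_mem (h : IsGivenBy (E' := E') (F := F) cov p σ conjY covY φ conjZ)
    (y : Y) : traceOmega (F := F) cov p φ y ∈ (vert F E' φ y)ᗮ := by
  refine Submodule.sum_mem _ fun i _ ↦ Submodule.add_mem _ (h.vert_le_orthogonal y ?_) ?_
  · exact Submodule.neg_mem _ (Submodule.starProjection_apply_mem _ _)
  · exact (Submodule.starProjection_apply_mem (horizK (E' := E') E F p φ y) _).2

/-- A horizontal vector differs from its projection to `ℋ ∩ 𝒦` by an element of `ker dφ`, so `dφ`
does not see the projection in the trace condition. -/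
theorem IsGivenBy.mfderiv_starProjection_horizK
    (h : IsGivenBy (E' := E') (F := F) cov p σ conjY covY φ conjZ) {y : Y}
    {u : TangentSpace 𝓘(ℝ, E') y} (hu : u ∈ (vert E E' p y)ᗮ) :
    mfderiv 𝓘(ℝ, E') 𝓘(ℝ, F) φ y ((horizK (E' := E') E F p φ y).starProjection u) =
      mfderiv 𝓘(ℝ, E') 𝓘(ℝ, F) φ y u := by
  have h1 := starProjection_add_add (h.vert_le y) (W := horizK (E' := E') E F p φ y) rfl u
  have h2 : mfderiv 𝓘(ℝ, E') 𝓘(ℝ, F) φ y ((vert F E' φ y).starProjection u) = 0 :=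
    Submodule.starProjection_apply_mem (vert F E' φ y) u
  rw [(Submodule.starProjection_apply_eq_zero_iff (vert E E' p y)).2 hu, add_zero] at h1
  conv_rhs => rw [← h1, map_add, h2, zero_add]

/-- The trace of a symmetric form which, on pairs of vector fields `X`, `JX`, is given by the tension
of `φ`. -/
theorem IsGivenBy.sum_bilin (h : IsGivenBy (E' := E') (F := F) cov p σ conjY covY φ conjZ)
    (hcovY : IsLeviCivita covY) {y : Y} {G : Type*} [AddCommGroup G] [Module ℝ G]
    (B : TangentSpace 𝓘(ℝ, E') y →ₗ[ℝ] TangentSpace 𝓘(ℝ, E') y →ₗ[ℝ] G)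
    (ℓ : TangentSpace 𝓘(ℝ, F) (φ y) →ₗ[ℝ] G)
    (hB : ∀ X X' : Π z : Y, TangentSpace 𝓘(ℝ, E') z, SmoothFieldAt X y → SmoothFieldAt X' y →
      (∀ᶠ z in 𝓝 y, mfderiv 𝓘(ℝ, E') 𝓘(ℝ, F) φ z (X' z) =
        mulI (φ z) (mfderiv 𝓘(ℝ, E') 𝓘(ℝ, F) φ z (X z))) →
      B (X y) (X y) + B (X' y) (X' y) =
        ℓ (mulI (φ y) (mfderiv 𝓘(ℝ, E') 𝓘(ℝ, F) φ y (VectorField.mlieBracket 𝓘(ℝ, E') X' X y)) -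
          mfderiv 𝓘(ℝ, E') 𝓘(ℝ, F) φ y (covY X y (X y) + covY X' y (X' y)))) :
    ∑ i, B (stdOrthonormalBasis ℝ (TangentSpace 𝓘(ℝ, E') y) i)
        (stdOrthonormalBasis ℝ (TangentSpace 𝓘(ℝ, E') y) i) =
      (1 / 2 : ℝ) • ℓ (mulI (φ y) (mfderiv 𝓘(ℝ, E') 𝓘(ℝ, F) φ y (traceOmega (F := F) cov p φ y))) := by
  have : FiniteDimensional ℝ F := FiniteDimensional.complexToReal F
  have hφ := h.submersion
  have hJ : ∀ X : Π z : Y, TangentSpace 𝓘(ℝ, E') z, ∀ᶠ z in 𝓝 y,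
      mfderiv 𝓘(ℝ, E') 𝓘(ℝ, F) φ z (complexStr (F := F) φ z (X z)) =
        mulI (φ z) (mfderiv 𝓘(ℝ, E') 𝓘(ℝ, F) φ z (X z)) := fun X ↦
    Eventually.of_forall fun z ↦ (complexStr_spec hφ z (X z)).2
  have hL : ∀ a ∈ vert F E' φ y, B a a = 0 := by
    intro a ha
    obtain ⟨X, hX, hXv, rfl⟩ := exists_vertical_field hφ ha
    -- As `dφ X = 0`, the zero field is an admissible partner of `X`.
    have h1 := hB X 0 hX (SmoothSecAt.zero contMDiffAt_id) (Eventually.of_forall fun z ↦ by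
      have : mfderiv 𝓘(ℝ, E') 𝓘(ℝ, F) φ z (X z) = 0 := hXv z
      simp [this])
    have h2 : mfderiv 𝓘(ℝ, E') 𝓘(ℝ, F) φ y (covY X y (X y)) = 0 :=
      h.hasTotallyGeodesicFibres hcovY y X (X y) hX (Eventually.of_forall hXv) (hXv y)
    simpa [h2] using h1
  have hV : ∀ a ∈ vert E E' p y, B a a + B (complexStrL hφ y a) (complexStrL hφ y a) = 0 := by
    intro a ha
    obtain ⟨X, hX, hXv, rfl⟩ := exists_vertical_field h.almost.submersion ha
    have h1 := hB X _ hX (hX.complexStr hφ) (hJ X)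
    rw [h.tension_vertical hcovY hX (hX.complexStr hφ) (Eventually.of_forall hXv)
      (Eventually.of_forall fun z ↦ h.complexStr_mem_vert (hXv z)) (hJ X), map_zero] at h1
    exact h1
  have hW : ∀ a ∈ horizK (E' := E') E F p φ y,
      B a a + B (complexStr (F := F) φ y a) (complexStr (F := F) φ y a) =
      ℓ (mulI (φ y) (mfderiv 𝓘(ℝ, E') 𝓘(ℝ, F) φ y (integrabilityTensor E p y a
          (complexStr (F := F) φ y a) + (horizK (E' := E') E F p φ y).starProjection
            (torsionH cov p y a (complexStr (F := F) φ y a))))) := by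
    intro a ha
    obtain ⟨X, hX, hXh, rfl⟩ := exists_horizontal_field h.almost.submersion ha.1
    have h1 := hB X _ hX (hX.complexStr hφ) (hJ X)
    rw [h.tension_horizontal hcovY hX (hX.complexStr hφ) (Eventually.of_forall hXh)
      (Eventually.of_forall fun z ↦ (h.complexStr_mem_horizK (hXh z)).1) (hJ X)] at h1
    have h2 : torsionH cov p y (X y) (complexStr (F := F) φ y (X y)) ∈ (vert E E' p y)ᗮ :=
      (horizontalLift_spec (h.almost.submersion.submersion y) _).1
    rw [map_add (mfderiv 𝓘(ℝ, E') 𝓘(ℝ, F) φ y), h.mfderiv_starProjection_horizK h2, ← map_add]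
    exact h1
  -- The trace splits along `ker dφ`, `ℋ ∩ 𝒦` and `ker dp`. On the last two `J` is orthogonal, so
  -- each trace is half a sum over pairs `a`, `Ja`; this is the origin of the factor `1 / 2`.
  rw [sum_bilin_add_add B (h.vert_le y) (W := horizK (E' := E') E F p φ y) rfl
    (stdOrthonormalBasis ℝ (TangentSpace 𝓘(ℝ, E') y)) (stdOrthonormalBasis ℝ (vert F E' φ y))
    (stdOrthonormalBasis ℝ (horizK (E' := E') E F p φ y)) (stdOrthonormalBasis ℝ (vert E E' p y)),
    Finset.sum_eq_zero fun i _ ↦ hL _ (Subtype.coe_prop _), zero_add,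
    sum_bilin_complex B (stdOrthonormalBasis ℝ (vert E E' p y)) (complexStrL hφ y)
      (fun a ha ↦ h.complexStr_mem_vert ha)
      (fun a ha ↦ complexStr_complexStr hφ (h.vert_le_orthogonal y ha))
      (fun a ha b hb ↦ h.inner_complex_vert ha hb (complexStr_spec hφ y a).1
        (complexStr_spec hφ y b).1 (complexStr_spec hφ y a).2 (complexStr_spec hφ y b).2),
    Finset.sum_eq_zero fun i _ ↦ hV _ (Subtype.coe_prop _), smul_zero, add_zero,
    sum_bilin_complex B (stdOrthonormalBasis ℝ (horizK (E' := E') E F p φ y)) (complexStrL hφ y)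
      (fun a ha ↦ h.complexStr_mem_horizK ha.1)
      (fun a ha ↦ complexStr_complexStr hφ ha.2)
      (fun a ha b hb ↦ (h.isTwistorial y).inner_complex ha.1 ha.2 hb.1 hb.2 (complexStr_spec hφ y a).1
        (complexStr_spec hφ y b).1 (complexStr_spec hφ y a).2 (complexStr_spec hφ y b).2),
    traceOmega, map_sum, map_sum, map_sum]
  congr 1
  exact Finset.sum_congr rfl fun i _ ↦ hW _ (Subtype.coe_prop _)

end TensionField

/-! ### Laplacians of pulled back holomorphic functions, and the tension field -/

section HarmonicMorphism

variable {E : Type*} [NormedAddCommGroup E] [NormedSpace ℝ E] [FiniteDimensional ℝ E]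
  {M : Type*} [TopologicalSpace M] [ChartedSpace E M] [IsManifold 𝓘(ℝ, E) ∞ M]
  [RiemannianBundle (fun x : M ↦ TangentSpace 𝓘(ℝ, E) x)]
  [IsContMDiffRiemannianBundle 𝓘(ℝ, E) ∞ E (fun x : M ↦ TangentSpace 𝓘(ℝ, E) x)]
  {E' : Type*} [NormedAddCommGroup E'] [NormedSpace ℝ E'] [FiniteDimensional ℝ E']
  {Y : Type*} [TopologicalSpace Y] [ChartedSpace E' Y] [IsManifold 𝓘(ℝ, E') ∞ Y]
  [RiemannianBundle (fun y : Y ↦ TangentSpace 𝓘(ℝ, E') y)]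
  [IsContMDiffRiemannianBundle 𝓘(ℝ, E') ∞ E' (fun y : Y ↦ TangentSpace 𝓘(ℝ, E') y)]
  {F : Type*} [NormedAddCommGroup F] [NormedSpace ℂ F] [FiniteDimensional ℂ F]
  {Z : Type*} [TopologicalSpace Z] [ChartedSpace F Z] [IsManifold 𝓘(ℂ, F) ω Z]
  {cov : AffineConnection E M} {p : Y → M}
  {σ : Π y : Y, Submodule ℂ (ℂ ⊗[ℝ] TangentSpace 𝓘(ℝ, E) (p y))} {conjY : Y → Y}
  {covY : AffineConnection E' Y} {φ : Y → Z} {conjZ : Z → Z}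

theorem mvfderiv_comp_submersion (hφ : IsSurjSubmersion F E' φ) {y : Y} {g : Z → ℂ}
    (hg : ContMDiffAt 𝓘(ℝ, F) 𝓘(ℝ, ℂ) ∞ g (φ y)) (a : TangentSpace 𝓘(ℝ, E') y) :
    mvfderiv 𝓘(ℝ, E') (g ∘ φ) y a = mvfderiv 𝓘(ℝ, F) g (φ y) (mfderiv 𝓘(ℝ, E') 𝓘(ℝ, F) φ y a) :=
  mfderiv_comp_apply y (hg.mdifferentiableAt (by simp))
    (hφ.smooth.contMDiffAt.mdifferentiableAt (by simp)) a

theorem exists_bilin_hess (hcovY : IsLeviCivita covY) {y : Y} {g : Y → ℂ}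
    (hg : ContMDiffAt 𝓘(ℝ, E') 𝓘(ℝ, ℂ) ∞ g y) :
    ∃ B : TangentSpace 𝓘(ℝ, E') y →ₗ[ℝ] TangentSpace 𝓘(ℝ, E') y →ₗ[ℝ] ℂ,
      ∀ a X, SmoothFieldAt X y → mvfderiv 𝓘(ℝ, E') (fun z ↦ mvfderiv 𝓘(ℝ, E') g z (X z)) y a -
        mvfderiv 𝓘(ℝ, E') g y (covY X y a) = B a (X y) := by
  refine exists_bilin_of_symm _ (fun X a b ↦ ?_) (fun X r a ↦ ?_) fun A X hA hX ↦ ?_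
  · simp only [map_add]
    abel
  · simp only [map_smul, smul_sub]
  · have h1 := mvfderiv_mlieBracket hg hA.diff hX.diff
    rw [← hcovY.sub_eq_mlieBracket hA.diff hX.diff, map_sub] at h1
    rw [sub_eq_sub_iff_sub_eq_sub]
    exact h1.symm

theorem exists_bilin_secondFundamentalForm (hcovY : IsLeviCivita covY)
    [RiemannianBundle (fun z : Z ↦ TangentSpace 𝓘(ℝ, F) z)]
    {covZ : AffineConnection F Z} (hcovZ : IsLeviCivita covZ) (hφ : IsSurjSubmersion F E' φ) (y : Y) :
    ∃ B : TangentSpace 𝓘(ℝ, E') y →ₗ[ℝ] TangentSpace 𝓘(ℝ, E') y →ₗ[ℝ] TangentSpace 𝓘(ℝ, F) (φ y),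
      ∀ a X, SmoothFieldAt X y →
        pullbackCov covZ φ (fun z ↦ mfderiv 𝓘(ℝ, E') 𝓘(ℝ, F) φ z (X z)) y a -
          mfderiv 𝓘(ℝ, E') 𝓘(ℝ, F) φ y (covY X y a) = B a (X y) := by
  have : FiniteDimensional ℝ F := FiniteDimensional.complexToReal F
  refine exists_bilin_of_symm _ (fun X a b ↦ ?_) (fun X r a ↦ ?_) fun A X hA hX ↦ ?_
  · simp only [map_add]
    abel
  · simp only [map_smul, smul_sub]
  · have h1 := pullbackCov_sub_eq_torsion covZ hφ.smooth.contMDiffAt hA.diff hX.diff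
    rw [← hcovY.sub_eq_mlieBracket hA.diff hX.diff, map_sub, hcovZ.2] at h1
    rw [sub_eq_sub_iff_sub_eq_sub, h1]
    simp

/-- The Laplacian of the pullback by `φ` of a holomorphic function. -/
theorem IsGivenBy.laplacian_comp (h : IsGivenBy (E' := E') (F := F) cov p σ conjY covY φ conjZ)
    (hcovY : IsLeviCivita covY) {W : Set Z} (hW : IsOpen W) {f : Z → ℂ}
    (hf : MDifferentiableOn 𝓘(ℂ, F) 𝓘(ℂ, ℂ) f W) {y : Y} (hy : φ y ∈ W) :
    laplacian covY (f ∘ φ) y = (1 / 2 : ℝ) • mvfderiv 𝓘(ℝ, F) f (φ y)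
      (mulI (φ y) (mfderiv 𝓘(ℝ, E') 𝓘(ℝ, F) φ y (traceOmega (E' := E') (F := F) cov p φ y))) := by
  have hφ := h.submersion
  have hfs : ∀ z ∈ W, ContMDiffAt 𝓘(ℝ, F) 𝓘(ℝ, ℂ) ∞ f z := fun z hz ↦ contMDiffAt_of_holomorphic hW hf hz
  have hg : ContMDiffAt 𝓘(ℝ, E') 𝓘(ℝ, ℂ) ∞ (f ∘ φ) y := (hfs _ hy).comp y hφ.smooth.contMDiffAt
  obtain ⟨B, hB⟩ := exists_bilin_hess hcovY hg
  have h1 := h.sum_bilin hcovY B (mvfderiv 𝓘(ℝ, F) f (φ y)).toLinearMap ?_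
  · refine Eq.trans (Finset.sum_congr rfl fun i _ ↦ ?_) h1
    refine (hB _ _ (smoothFieldAt_extend _)).trans ?_
    rw [FiberBundle.extend_apply_self]
  · intro X X' hX hX' hXX'
    -- With `g = f ∘ φ`, the relation `X'g = i Xg` near `y` can be differentiated: `XXg + X'X'g =
    -- XXg + i X'Xg`, and `X'Xg = i XXg + [X', X]g`, so only `i [X', X]g` is left.
    have e1 : ∀ᶠ z in 𝓝 y, mvfderiv 𝓘(ℝ, E') (f ∘ φ) z (X' z) =
        Complex.I * mvfderiv 𝓘(ℝ, E') (f ∘ φ) z (X z) := by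
      filter_upwards [hXX', hφ.smooth.continuous.continuousAt.eventually (hW.mem_nhds hy)]
        with z h1 h2
      rw [mvfderiv_comp_submersion hφ (hfs _ h2), mvfderiv_comp_submersion hφ (hfs _ h2), h1,
        mvfderiv_mulI_of_holomorphic hW hf h2]
    have hXg : MDifferentiableAt 𝓘(ℝ, E') 𝓘(ℝ, ℂ) (fun z ↦ mvfderiv 𝓘(ℝ, E') (f ∘ φ) z (X z)) y :=
      mdifferentiableAt_mvfderiv_apply hg hX.diff
    have e2 : ∀ a, mvfderiv 𝓘(ℝ, E') (fun z ↦ mvfderiv 𝓘(ℝ, E') (f ∘ φ) z (X' z)) y a =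
        Complex.I * mvfderiv 𝓘(ℝ, E') (fun z ↦ mvfderiv 𝓘(ℝ, E') (f ∘ φ) z (X z)) y a := fun a ↦ by
      rw [mvfderiv_congr e1, mvfderiv_mul_complex mdifferentiableAt_const hXg, mvfderiv_const]
      simp
    have e3 := mvfderiv_mlieBracket hg hX'.diff hX.diff
    rw [e2] at e3
    rw [← hB _ X hX, ← hB _ X' hX', e2, eq_add_of_sub_eq e3.symm, ContinuousLinearMap.coe_coe, map_sub,
      mvfderiv_mulI_of_holomorphic hW hf hy, ← mvfderiv_comp_submersion hφ (hfs _ hy),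
      ← mvfderiv_comp_submersion hφ (hfs _ hy), map_add]
    linear_combination (mvfderiv 𝓘(ℝ, E') (fun z ↦ mvfderiv 𝓘(ℝ, E') (f ∘ φ) z (X z)) y (X y)) *
      Complex.I_mul_I

/-- The tension field of `φ`, for a Kähler metric of `Z`. -/
theorem IsGivenBy.sum_secondFundamentalForm
    (h : IsGivenBy (E' := E') (F := F) cov p σ conjY covY φ conjZ) (hcovY : IsLeviCivita covY)
    [RiemannianBundle (fun z : Z ↦ TangentSpace 𝓘(ℝ, F) z)]
    {covZ : AffineConnection F Z} (hcovZ : IsLeviCivita covZ) (hK : IsKahler covZ) (y : Y) :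
    ∑ i, secondFundamentalForm covY covZ φ y (stdOrthonormalBasis ℝ (TangentSpace 𝓘(ℝ, E') y) i)
        (stdOrthonormalBasis ℝ (TangentSpace 𝓘(ℝ, E') y) i) =
      (1 / 2 : ℝ) • mulI (φ y) (mfderiv 𝓘(ℝ, E') 𝓘(ℝ, F) φ y (traceOmega (E' := E') (F := F) cov p φ y)) := by
  have : FiniteDimensional ℝ F := FiniteDimensional.complexToReal F
  have hφ := h.submersion
  obtain ⟨B, hB⟩ := exists_bilin_secondFundamentalForm hcovY hcovZ hφ y
  have h1 := h.sum_bilin hcovY B LinearMap.id ?_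
  · refine Eq.trans (Finset.sum_congr rfl fun i _ ↦ ?_) h1
    refine (hB _ _ (smoothFieldAt_extend _)).trans ?_
    rw [FiberBundle.extend_apply_self]
  · intro X X' hX hX' hXX'
    -- The same computation as for functions, with the parallel complex structure of `Z` in the role
    -- of the constant `i`.
    have e2 : ∀ a, pullbackCov covZ φ (fun z ↦ mfderiv 𝓘(ℝ, E') 𝓘(ℝ, F) φ z (X' z)) y a =
        mulI (φ y) (pullbackCov covZ φ (fun z ↦ mfderiv 𝓘(ℝ, E') 𝓘(ℝ, F) φ z (X z)) y a) := fun a ↦ by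
      rw [pullbackCov_congr (E' := E') covZ hXX', pullbackCov_mulI hK (hX.mfderiv_apply hφ.smooth.contMDiffAt)]
    have e3 := pullbackCov_sub_eq_torsion covZ hφ.smooth.contMDiffAt hX'.diff hX.diff
    rw [e2, hcovZ.2, zero_apply, zero_apply, add_zero] at e3
    rw [← hB _ X hX, ← hB _ X' hX', e2, eq_add_of_sub_eq e3, map_add, mulI_mulI, map_add,
      LinearMap.id_apply]
    abel

/-- Multiplication by `i` is invertible, and `dφ` is injective on `𝒦`, which contains the trace
vector. -/
theorem IsGivenBy.mulI_mfderiv_traceOmega_eq_zero_iff (h : IsGivenBy (E' := E') (F := F) cov p σ conjY covY φ conjZ) (y : Y) :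
    mulI (φ y) (mfderiv 𝓘(ℝ, E') 𝓘(ℝ, F) φ y (traceOmega (E' := E') (F := F) cov p φ y)) = 0 ↔
      traceOmega (E' := E') (F := F) cov p φ y = 0 := by
  refine ⟨fun h0 ↦ ?_, fun h0 ↦ by rw [h0, map_zero, map_zero]⟩
  have h1 := congrArg (mulI (φ y)) h0
  rw [mulI_mulI, map_zero, neg_eq_zero] at h1
  exact inner_self_eq_zero.1 (Submodule.inner_right_of_mem_orthogonal
    (show traceOmega (E' := E') (F := F) cov p φ y ∈ vert F E' φ y from h1) (h.traceOmega_mem y))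

theorem mdifferentiableOn_dual_comp_chart (ℓ : F →L[ℂ] ℂ) (z : Z) :
    MDifferentiableOn 𝓘(ℂ, F) 𝓘(ℂ, ℂ) (fun u ↦ ℓ (chartAt F z u)) (chartAt F z).source := by
  intro u hu
  have h1 : MDifferentiableAt 𝓘(ℂ, F) 𝓘(ℂ, F) (chartAt F z) u :=
    mdifferentiableAt_atlas (chart_mem_atlas F z) hu
  exact (ℓ.differentiableAt.mdifferentiableAt.comp u h1).mdifferentiableWithinAt

theorem mvfderiv_dual_comp_chart (ℓ : F →L[ℂ] ℂ) (z : Z) (u : TangentSpace 𝓘(ℝ, F) z) :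
    mvfderiv 𝓘(ℝ, F) (fun u ↦ ℓ (chartAt F z u)) z u = ℓ u := by
  have h1 := mvfderiv_clm_comp (E' := F) (N := Z) (ℓ.restrictScalars ℝ) (g := extChartAt 𝓘(ℝ, F) z)
    (z := z) (mdifferentiableAt_extChartAt (mem_chart_source F z)) u
  refine h1.trans ?_
  have h2 : mfderiv 𝓘(ℝ, F) 𝓘(ℝ, F) (extChartAt 𝓘(ℝ, F) z) z = ContinuousLinearMap.id ℝ F :=
    mfderiv_extChartAt_self
  exact congrArg ℓ (congrArg (fun L : F →L[ℝ] F ↦ L u) h2)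

theorem IsGivenBy.pullsBack_iff (h : IsGivenBy (E' := E') (F := F) cov p σ conjY covY φ conjZ)
    (hcovY : IsLeviCivita covY) : PullsBackHolomorphicToHarmonic F covY φ ↔
      ∀ y, traceOmega (E' := E') (F := F) cov p φ y = 0 := by
  refine ⟨fun hφ y ↦ (h.mulI_mfderiv_traceOmega_eq_zero_iff y).1 ?_, fun h0 W f hW hf y hy ↦ ?_⟩
  · set u := mulI (φ y) (mfderiv 𝓘(ℝ, E') 𝓘(ℝ, F) φ y (traceOmega (E' := E') (F := F) cov p φ y)) with hu
    -- The test functions are complex linear functionals composed with the chart at `φ y`; the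
    -- differential of such a function at `φ y` is the functional itself.
    refine SeparatingDual.eq_zero_of_forall_dual_eq_zero (R := ℂ) (V := F) (x := u) fun ℓ ↦ ?_
    have h1 := h.laplacian_comp hcovY (chartAt F (φ y)).open_source
      (mdifferentiableOn_dual_comp_chart ℓ (φ y)) (mem_chart_source F (φ y))
    rw [hφ _ _ (chartAt F (φ y)).open_source (mdifferentiableOn_dual_comp_chart ℓ (φ y)) y
      (mem_chart_source F (φ y)), mvfderiv_dual_comp_chart] at h1
    exact (smul_eq_zero.1 h1.symm).resolve_left (by norm_num)
  · rw [h.laplacian_comp hcovY hW hf hy, h0 y, map_zero, map_zero, map_zero, smul_zero]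

end HarmonicMorphism

end RTwist

theorem corollary3p5
    {E : Type*} [NormedAddCommGroup E] [NormedSpace ℝ E] [FiniteDimensional ℝ E]
    {M : Type*} [TopologicalSpace M] [T2Space M] [SigmaCompactSpace M]
    [ChartedSpace E M] [IsManifold 𝓘(ℝ, E) ∞ M]
    [RiemannianBundle (fun x : M ↦ TangentSpace 𝓘(ℝ, E) x)]
    [IsContMDiffRiemannianBundle 𝓘(ℝ, E) ∞ E (fun x : M ↦ TangentSpace 𝓘(ℝ, E) x)]
    {E' : Type*} [NormedAddCommGroup E'] [NormedSpace ℝ E'] [FiniteDimensional ℝ E']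
    {Y : Type*} [TopologicalSpace Y] [T2Space Y] [SigmaCompactSpace Y]
    [ChartedSpace E' Y] [IsManifold 𝓘(ℝ, E') ∞ Y]
    [RiemannianBundle (fun y : Y ↦ TangentSpace 𝓘(ℝ, E') y)]
    [IsContMDiffRiemannianBundle 𝓘(ℝ, E') ∞ E' (fun y : Y ↦ TangentSpace 𝓘(ℝ, E') y)]
    {F : Type*} [NormedAddCommGroup F] [NormedSpace ℂ F] [FiniteDimensional ℂ F]
    {Z : Type*} [TopologicalSpace Z] [T2Space Z] [SigmaCompactSpace Z]
    [ChartedSpace F Z] [IsManifold 𝓘(ℂ, F) ω Z]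
    -- the Riemannian twistorial structure `(TM, Id, σ, ∇)`, given by `φ` and `p`
    (cov : RTwist.AffineConnection E M) (p : Y → M)
    (σ : Π y : Y, Submodule ℂ (ℂ ⊗[ℝ] TangentSpace 𝓘(ℝ, E) (p y))) (conjY : Y → Y)
    (covY : RTwist.AffineConnection E' Y) (hcovY : RTwist.IsLeviCivita covY)
    (φ : Y → Z) (conjZ : Z → Z)
    (h : RTwist.IsGivenBy (E' := E') (F := F) cov p σ conjY covY φ conjZ) :
    RTwist.HasTotallyGeodesicFibres F covY φ ∧
    (RTwist.PullsBackHolomorphicToHarmonic F covY φ ↔ RTwist.TraceCondition (E' := E') F cov p φ) ∧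
    (∀ [RiemannianBundle (fun z : Z ↦ TangentSpace 𝓘(ℝ, F) z)]
      [IsContMDiffRiemannianBundle 𝓘(ℝ, F) ∞ F (fun z : Z ↦ TangentSpace 𝓘(ℝ, F) z)]
      (covZ : RTwist.AffineConnection F Z), RTwist.IsLeviCivita covZ → RTwist.IsKahler covZ →
      RTwist.TraceCondition (E' := E') F cov p φ → RTwist.IsHarmonicMap covY covZ φ) := by
  refine ⟨h.hasTotallyGeodesicFibres hcovY, h.pullsBack_iff hcovY, fun covZ hcovZ hK hT y ↦ ?_⟩
  refine (h.sum_secondFundamentalForm hcovY hcovZ hK y).trans ?_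
  rw [show RTwist.traceOmega (E' := E') (F := F) cov p φ y = 0 from hT y, map_zero, map_zero, smul_zero]
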